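/- Let $n,m\ge 1$ be integers. For $v=(v_1,\dots,v_n)$ put $A(v)=\prod_{1\le i<j\le n}(v_i-v_j)$, and for $x,\lambda\in\mathbb C^n$ put $(\lambda,x)=\sum_{i=1}^n\lambda_ix_i$, $\bar x=x_1+\dots+x_n$. The rational Baker--Akhiezer (BA) function of type $A_{n-1}$ with multiplicity $m$ is the function $$\Psi^{(n)}_m(x,\lambda)=\frac{P(x,\lambda)}{A(x)^mA(\lambda)^m}\,e^{(\lambda,x)},$$ where $P$ is a polynomial in $x$ and $\lambda$ whose leading term, both with respect to $x$ and with respect to $\lambda$, is $A(x)^mA(\lambda)^m$ (that is, $P-A(x)^mA(\lambda)^m$ has degree less than $m\,n(n-1)/2$ in $x$ and degree less than $m\,n(n-1)/2$ in $\lambda$; for $n=1$ this means $P=1$), such that for all $x$ with distinct coordinates and all $\lambda$ with distinct coordinates $$\Big(-\sum_{i=1}^n\frac{\partial^2}{\partial x_i^2}+\sum_{i<j}\frac{2m(m+1)}{(x_i-x_j)^2}\Big)\Psi^{(n)}_m=-(\lambda,\lambda)\,\Psi^{(n)}_m .$$ There is exactly one such polynomial $P$, and the BA function is given by the following iterated residue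 formula. Let $x_1,\dots,x_n$ be distinct and let $\lambda_1,\dots,\lambda_n$ be distinct. Introduce $n(n-1)/2$ variables $t_{i,j}$, $1\le i\le j\le n-1$, put $t_{i,n}=x_i$ for $1\le i\le n$, and let $$\omega_m=\prod_{j=1}^{n-1}\ \prod_{i=1}^{j}\ \prod_{l=1}^{j+1}(t_{i,j}-t_{l,j+1})^{-m-1}\prod_{1\le i<l\le j\le n-1}(t_{i,j}-t_{l,j})^{2+2m}\prod_{1\le l\le j\le n-1}e^{(\lambda_j-\lambda_{j+1})t_{l,j}}\,dt_{l,j}.$$ Let $\Sigma$ be the product of the positively oriented circles $|t_{k,j}-x_k|=\epsilon(n-j)$, $1\le k\le j\le n-1$, where $\epsilon>0$ is so small that $2(n-1)\epsilon<|x_i-x_j|$ for all $i\ne j$. Then the integral below is absolutely convergent and $$\Psi^{(n)}_m(x,\lambda)=(-1)^{(m+1)\binom n3}\left(\frac{m!}{2\pi i}\right)^{\frac{n(n-1)}2}e^{\lambda_n\bar x}\,A(x)^{1+m}A(\lambda)^{-m}\oint_\Sigma\omega_m .$$ -/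

import Mathlib

open MeasureTheory

/-- The product `A(x) = ∏_{i<j} (x_i - x_j)`, over any commutative ring. -/
def prodDiff {R : Type*} [CommRing R] {n : ℕ} (x : Fin n → R) : R :=
  ∏ i, ∏ j ∈ Finset.Ioi i, (x i - x j)

/-- The `n`-particle Calogero--Moser operator
`-Δ + ∑_{i<j} 2 m (m+1) / (x_i - x_j)^2`, applied to `f` at the point `x`
(the partial derivatives are complex). -/
noncomputable def calogeroMoser (n m : ℕ) (f : (Fin n → ℂ) → ℂ) (x : Fin n → ℂ) : ℂ :=
  -(∑ i, iteratedDeriv 2 (fun s : ℂ => f (Function.update x i s)) (x i))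
    + ∑ i, ∑ j ∈ Finset.Ioi i, 2 * (m : ℂ) * ((m : ℂ) + 1) / (x i - x j) ^ 2 * f x

/-- Polynomials in both `x = (x_1, …, x_n)` (the variables `Sum.inl i`) and
`λ = (λ_1, …, λ_n)` (the variables `Sum.inr i`). -/
abbrev XLPoly (n : ℕ) := MvPolynomial (Fin n ⊕ Fin n) ℂ

/-- The polynomial `A(x)^m A(λ)^m`. -/
noncomputable def leadingPoly (n m : ℕ) : XLPoly n :=
  prodDiff (fun i : Fin n => (MvPolynomial.X (Sum.inl i) : XLPoly n)) ^ m *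
    prodDiff (fun i : Fin n => (MvPolynomial.X (Sum.inr i) : XLPoly n)) ^ m

/-- The function `Ψ(x, λ) = P(x, λ) / (A(x)^m A(λ)^m) * exp (∑ λ_i x_i)`. -/
noncomputable def baFunction (n m : ℕ) (P : XLPoly n) (x lam : Fin n → ℂ) : ℂ :=
  MvPolynomial.eval (Sum.elim x lam) P / (prodDiff x ^ m * prodDiff lam ^ m) *
    Complex.exp (∑ i, lam i * x i)

/-- `P` is the numerator of a rational Baker--Akhiezer function of type `A_{n-1}` with
multiplicity `m`: the polynomial `P` has the leading term `A(x)^m A(λ)^m`, both as a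
polynomial in `x` and as a polynomial in `λ` (all the other terms have smaller degree in `x`
and smaller degree in `λ` than the degree `m n (n-1) / 2` of this term), and
`Ψ = P / (A(x)^m A(λ)^m) exp (λ, x)` satisfies the Schrödinger equation
`L Ψ = -(λ, λ) Ψ`. -/
structure IsBANumerator (n m : ℕ) (P : XLPoly n) : Prop where
  leading_x : ∀ d ∈ (P - leadingPoly n m).support,
    ∑ i, d (Sum.inl i) < m * (n * (n - 1) / 2)
  leading_lam : ∀ d ∈ (P - leadingPoly n m).support,
    ∑ i, d (Sum.inr i) < m * (n * (n - 1) / 2)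
  schrodinger : ∀ x lam : Fin n → ℂ, Function.Injective x → Function.Injective lam →
    calogeroMoser n m (fun y => baFunction n m P y lam) x
      = -(∑ i, lam i ^ 2) * baFunction n m P x lam

/-- The index set of the `n (n-1) / 2` integration variables: the pair `⟨j, i⟩` stands for
the variable `t_{i+1, j+1}` (so that `1 ≤ i + 1 ≤ j + 1 ≤ n - 1`). -/
abbrev TriIndex (n : ℕ) := (j : Fin (n - 1)) × Fin (j.val + 1)

/-- The array `t_{l+1, j+1}`, with the convention `t_{l, n} = x_l` for the last row. -/
def rowVar {n : ℕ} (x : Fin n → ℂ) (t : TriIndex n → ℂ) (j : Fin n) (l : Fin (j.val + 1)) : ℂ :=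
  if h : j.val < n - 1 then t ⟨⟨j.val, h⟩, l⟩ else x (Fin.castLE (by omega) l)

/-- The density of the form `ω_m` with respect to `∏ dt_{i,j}`:
`∏_{j ≤ n-1} ∏_{i ≤ j, l ≤ j+1} (t_{i,j} - t_{l,j+1})^{-m-1}
  * ∏_{i < l ≤ j ≤ n-1} (t_{i,j} - t_{l,j})^{2+2m}
  * ∏_{l ≤ j ≤ n-1} exp ((λ_j - λ_{j+1}) t_{l,j})`. -/
noncomputable def omegaDensity {n : ℕ} (m : ℕ) (x lam : Fin n → ℂ) (t : TriIndex n → ℂ) : ℂ :=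
  (∏ p : TriIndex n, ∏ l : Fin (p.1.val + 2),
      (t p - rowVar x t ⟨p.1.val + 1, by omega⟩ l) ^ (-(m : ℤ) - 1)) *
  (∏ j : Fin (n - 1), ∏ i : Fin (j.val + 1), ∏ l ∈ Finset.Ioi i,
      (t ⟨j, i⟩ - t ⟨j, l⟩) ^ (2 + 2 * m)) *
  ∏ p : TriIndex n, Complex.exp
      ((lam ⟨p.1.val, by omega⟩ - lam ⟨p.1.val + 1, by omega⟩) * t p)

/-- The pull-back of `f(t) ∏ dt_i` to the angles `θ_i` on the product of the circles
`t_i = c_i + R_i exp (i θ_i)`. -/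
noncomputable def torusPullback {ι : Type*} [Fintype ι] (f : (ι → ℂ) → ℂ) (c : ι → ℂ)
    (R : ι → ℝ) (θ : ι → ℝ) : ℂ :=
  (∏ i, ((R i : ℂ) * Complex.exp (θ i * Complex.I) * Complex.I)) *
    f (fun i => c i + R i * Complex.exp (θ i * Complex.I))

/-- The integral of `f(t) ∏ dt_i` over the product of the positively oriented circles
`|t_i - c_i| = R_i`; this is `torusIntegral` for an arbitrary finite index type. -/
noncomputable def circlesIntegral {ι : Type*} [Fintype ι] (f : (ι → ℂ) → ℂ) (c : ι → ℂ)
    (R : ι → ℝ) : ℂ :=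
  ∫ θ : ι → ℝ in Set.Icc (0 : ι → ℝ) (fun _ => 2 * Real.pi), torusPullback f c R θ

theorem circlesIntegral_eq_torusIntegral {N : ℕ} (f : (Fin N → ℂ) → ℂ) (c : Fin N → ℂ)
    (R : Fin N → ℝ) : circlesIntegral f c R = torusIntegral f c R := by
  simp only [circlesIntegral, torusPullback, torusIntegral, smul_eq_mul]
  rfl

/-- The centres of the circles in the cycle `Σ`: the variable `t_{k,j}` goes around `x_k`. -/
def cycleCenter {n : ℕ} (x : Fin n → ℂ) (p : TriIndex n) : ℂ :=
  x (Fin.castLE (by omega) p.2)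

/-- The radii of the circles in the cycle `Σ`: `ε (n - j)` for the variable `t_{k,j}`. -/
def cycleRadius {n : ℕ} (ε : ℝ) (p : TriIndex n) : ℝ :=
  ε * ((n : ℝ) - ((p.1.val : ℝ) + 1))

/-!
The residue formula is a recursion in the number `n` of particles. Integrating out the last row
`t = (t_{1,n-1}, …, t_{n-1,n-1})` amounts to an integral over a torus of the function for `n - 1`
particles, at the point `t`, against the kernel
`A(x)^κ A(t)^κ ∏ (t_i - x_l)^{-κ} e^{λ_n (∑ x - ∑ t)}`, `κ = m + 1` (`cmKernel`), and the other
rows contribute the formula for `n - 1` particles (`circlesIntegral_omegaDensity`). In the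
variable `t_i` the integrand of a row has one pole inside the circle, at `t_i = x_i` and of order
`m + 1`, so the integral is given by Cauchy's formula: it applies `∏ (∂ / ∂t_i)^m` and sets
`t_i = x_i`. The result is an explicit function `psi`, which is `e^{(λ, x)}` times a polynomial
over a high power of `A(x)`. That it is the Baker--Akhiezer function, up to the factor
`A(λ)^{-m}`, rests on the following facts.

* The Schrödinger equation (`sum_iteratedDeriv_psi`). The Calogero--Moser operators in `x` and in
  `t` agree on the kernel up to a constant (`cmKernel_identity`), a consequence of the cancellation
  of the three-body terms. Under the integral the operator in `t` is moved to the function for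
  `n - 1` particles by integration by parts, which brings in its eigenvalue.
* The order of the poles (`exists_eq_xDiff_pow_mul`). The exponents of the Schrödinger equation at
  `x_i = x_j` are `-m` and `m + 1`. Hence, if `q e^{(λ, x)} / A(x)^K` with a polynomial `q` is a
  solution and `K > m`, then `q` is divisible by each of the primes `x_i - x_j`, and `K` can be
  lowered by one, until it is `m`.
* The leading terms (`exists_numerator`). The numerators are homogenized by a variable `h`: the
  derivatives `∂ / ∂t_i + λ_i - λ_n`, which act after the exponential has been split off, become
  `h ∂ / ∂t_i + λ_i - λ_n`. If `x`, `λ`, `h` have the weights `α`, `β`, `α + β`, the numerators are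
  homogeneous, and the part without `h` is `A(x)^a A(λ)^m`. So this is the leading term at
  `h = 1`; the weights `(1, 0)` and `(0, 1)` give the two conditions on `P`.
* Uniqueness (`eq_zero_of_schrodingerPoly`). The difference `q` of two numerators satisfies the same
  linear equation. Its part `p` of top degree in `λ` satisfies
  `A ∑ λ_i ∂_i p = m p ∑ λ_i ∂_i A`; along a line `x + s λ` this says that `p` is a multiple of
  `A(x)^m`, so `p` has degree `m n (n - 1) / 2` on the line, unless it vanishes. But the degree of
  `q` in `x` is smaller.
-/

/-! ### Circle and torus integrals -/

/-- The Cauchy formula for the `m`-th derivative at an arbitrary point `w` of the disc; the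
successive derivatives of `f 0` are given as a sequence. -/
theorem circleIntegral_sub_zpow_mul {c w : ℂ} {R : ℝ} (hw : w ∈ Metric.ball c R)
    (f : ℕ → ℂ → ℂ)
    (hf : ∀ k, ∀ z ∈ Metric.closedBall c R, HasDerivAt (f k) (f (k + 1) z) z) (m k : ℕ) :
    (∮ z in C(c, R), (z - w) ^ (-(m : ℤ) - 1) * f k z) =
      2 * Real.pi * Complex.I / m.factorial * f (k + m) w := by
  have hR : 0 < R := lt_of_le_of_lt dist_nonneg hw
  have hne : ∀ z ∈ Metric.sphere c R, z - w ≠ 0 := by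
    intro z hz h
    rw [sub_eq_zero.1 h] at hz
    exact absurd (Metric.mem_sphere.1 hz) (ne_of_lt hw)
  have hcont : ∀ k, ContinuousOn (f k) (Metric.sphere c R) := fun k z hz =>
    (hf k z (Metric.sphere_subset_closedBall hz)).continuousAt.continuousWithinAt
  have hint : ∀ (a : ℤ) (k : ℕ), CircleIntegrable (fun z => (z - w) ^ a * f k z) c R := by
    intro a k
    refine ContinuousOn.circleIntegrable hR.le (ContinuousOn.mul ?_ (hcont k))
    exact ContinuousOn.zpow₀ (by fun_prop) _ fun z hz => Or.inl (hne z hz)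
  induction m generalizing k with
  | zero =>
    have h : DifferentiableOn ℂ (f k) (Metric.closedBall c R) := fun z hz =>
      (hf k z hz).differentiableAt.differentiableWithinAt
    have := h.circleIntegral_sub_inv_smul hw
    simpa [zpow_neg_one] using this
  | succ m ih =>
    have h0 : (∮ z in C(c, R), ((-(m : ℤ) - 1 : ℤ) * (z - w) ^ (-(m : ℤ) - 1 - 1) * f k z +
        (z - w) ^ (-(m : ℤ) - 1) * f (k + 1) z)) = 0 := by
      refine circleIntegral.integral_eq_zero_of_hasDerivWithinAt
        (f := fun z => (z - w) ^ (-(m : ℤ) - 1) * f k z) hR.le fun z hz => ?_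
      refine HasDerivAt.hasDerivWithinAt ?_
      refine HasDerivAt.mul ?_ (hf k z (Metric.sphere_subset_closedBall hz))
      have := (hasDerivAt_zpow (-(m : ℤ) - 1) (z - w) (Or.inl (hne z hz))).comp z
        ((hasDerivAt_id z).sub_const w)
      rwa [mul_one] at this
    have h1 := ih (k + 1)
    have h2 : (∮ z in C(c, R), ((-(m : ℤ) - 1 : ℤ) : ℂ) *
        ((z - w) ^ (-(m : ℤ) - 1 - 1) * f k z)) +
        (∮ z in C(c, R), (z - w) ^ (-(m : ℤ) - 1) * f (k + 1) z) = 0 := by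
      rw [← circleIntegral.integral_add, ← h0]
      · simp only [mul_assoc]
      · exact CircleIntegrable.const_smul (a := ((-(m : ℤ) - 1 : ℤ) : ℂ))
          (hint (-(m : ℤ) - 1 - 1) k)
      · exact hint _ _
    rw [circleIntegral.integral_const_mul, h1] at h2
    have hm : (m : ℂ) + 1 ≠ 0 := Nat.cast_add_one_ne_zero m
    have e : (-((m + 1 : ℕ) : ℤ) - 1) = -(m : ℤ) - 1 - 1 := by push_cast; ring
    rw [e, Nat.factorial_succ]
    push_cast at h2 ⊢
    have h3 : ((m : ℂ) + 1) * (∮ z in C(c, R), (z - w) ^ (-(m : ℤ) - 1 - 1) * f k z) =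
        2 * Real.pi * Complex.I / m.factorial * f (k + 1 + m) w := by
      linear_combination -h2
    rw [show k + (m + 1) = k + 1 + m by ring]
    field_simp
    field_simp at h3
    linear_combination h3

theorem torusMap_apply_mem_sphere {n : ℕ} {c : Fin n → ℂ} {R : Fin n → ℝ} (hR : ∀ i, 0 ≤ R i)
    (θ : Fin n → ℝ) (i : Fin n) : ‖torusMap c R θ i - c i‖ = R i := by
  simp [torusMap, Complex.norm_exp_ofReal_mul_I, abs_of_nonneg (hR i)]

theorem continuous_torusMap {n : ℕ} (c : Fin n → ℂ) (R : Fin n → ℝ) :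
    Continuous (torusMap c R) := by
  unfold torusMap
  fun_prop

theorem torusIntegrable_of_continuousOn {n : ℕ} {c : Fin n → ℂ} {R : Fin n → ℝ}
    (hR : ∀ i, 0 ≤ R i) {f : (Fin n → ℂ) → ℂ}
    (hf : ContinuousOn f {t | ∀ i, ‖t i - c i‖ = R i}) : TorusIntegrable f c R := by
  refine Continuous.integrableOn_Icc ?_
  exact hf.comp_continuous (continuous_torusMap c R) fun θ i => torusMap_apply_mem_sphere hR θ i

theorem torusIntegral_congr {n : ℕ} {c : Fin n → ℂ} {R : Fin n → ℝ} (hR : ∀ i, 0 ≤ R i)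
    {f g : (Fin n → ℂ) → ℂ} (h : ∀ t : Fin n → ℂ, (∀ i, ‖t i - c i‖ = R i) → f t = g t) :
    (∯ t in T(c, R), f t) = ∯ t in T(c, R), g t := by
  unfold torusIntegral
  congr 1
  ext θ
  exact congrArg _ (h _ fun i => torusMap_apply_mem_sphere hR θ i)

/-- The iterated residue on a torus. A class of functions, indexed by `Q`, is closed under the
partial derivatives `∂ / ∂ t_i`, represented by the operators `D i` on `Q`; integrating against
`∏ (t_i - x_i)^{-m-1}` then applies `∏ (D i)^m` and evaluates at `x`, up to a constant. -/
theorem torusIntegral_prod_sub_zpow_mul {Q : Type*} (m : ℕ) {n : ℕ} (c x : Fin n → ℂ)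
    (R : Fin n → ℝ) (hx : ∀ i, ‖x i - c i‖ < R i) (ev : Q → (Fin n → ℂ) → ℂ)
    (D : Fin n → Q → Q)
    (hc : ∀ q, ContinuousOn (ev q) {t | ∀ i, ‖t i - c i‖ ≤ R i})
    (hD : ∀ q i t, (∀ i, ‖t i - c i‖ ≤ R i) →
      HasDerivAt (fun s => ev q (Function.update t i s)) (ev (D i q) t) (t i)) (q : Q) :
    (∯ t in T(c, R), (∏ i, (t i - x i) ^ (-(m : ℤ) - 1)) * ev q t) =
      (2 * Real.pi * Complex.I / m.factorial) ^ n *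
        ev (Fin.foldr n (fun i p => (D i)^[m] p) q) x := by
  induction n generalizing q with
  | zero =>
    simp only [torusIntegral_dim0, Finset.univ_eq_empty, Finset.prod_empty, one_mul, pow_zero,
      Fin.foldr_zero]
    congr 1
    exact Subsingleton.elim _ _
  | succ n ih =>
    have hR : ∀ i, 0 < R i := fun i => (norm_nonneg _).trans_lt (hx i)
    have hne : ∀ t : Fin (n + 1) → ℂ, ∀ i, ‖t i - c i‖ = R i → t i - x i ≠ 0 := by
      intro t i ht h
      rw [sub_eq_zero.1 h] at ht
      exact (hx i).ne ht
    rw [torusIntegral_succ]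
    swap
    · refine torusIntegrable_of_continuousOn (fun i => (hR i).le) (ContinuousOn.mul ?_ ?_)
      · refine continuousOn_finsetProd _ fun i _ => ?_
        exact ContinuousOn.zpow₀ (by fun_prop) _ fun t ht => Or.inl (hne t i (ht i))
      · exact (hc q).mono fun t ht i => (ht i).le
    set q' : Q := Fin.foldr n (fun i p => (D i.succ)^[m] p) q with hq'
    have inner : ∀ z ∈ Metric.sphere (c 0) (R 0),
        (∯ y in T(c ∘ Fin.succ, R ∘ Fin.succ),
          (∏ i, ((Fin.cons z y : Fin (n + 1) → ℂ) i - x i) ^ (-(m : ℤ) - 1)) *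
            ev q (Fin.cons z y)) =
        (2 * Real.pi * Complex.I / m.factorial) ^ n *
          ((z - x 0) ^ (-(m : ℤ) - 1) * ev q' (Fin.cons z (x ∘ Fin.succ))) := by
      intro z hz
      have hz' : ‖z - c 0‖ ≤ R 0 := by
        rw [← dist_eq_norm]
        exact (Metric.mem_sphere.1 hz).le
      have hmem : ∀ y : Fin n → ℂ, (∀ i, ‖y i - (c ∘ Fin.succ) i‖ ≤ (R ∘ Fin.succ) i) →
          ∀ i, ‖(Fin.cons z y : Fin (n + 1) → ℂ) i - c i‖ ≤ R i := by
        intro y hy i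
        refine Fin.cases ?_ (fun j => ?_) i
        · simpa using hz'
        · simpa using hy j
      have key := ih (c ∘ Fin.succ) (x ∘ Fin.succ) (R ∘ Fin.succ) (fun i => hx i.succ)
        (fun q y => ev q (Fin.cons z y)) (fun i => D i.succ)
        (fun q => (hc q).comp (by fun_prop) fun y hy => hmem y hy)
        (fun q i y hy => by
          have := hD q i.succ (Fin.cons z y) (hmem y hy)
          simpa [Fin.cons_update] using this) q
      rw [← hq'] at key
      simp only [Fin.prod_univ_succ, Fin.cons_zero, Fin.cons_succ]
      simp only [mul_assoc, torusIntegral_const_mul]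
      simp only [Function.comp_apply] at key
      rw [key]
      ring
    rw [circleIntegral.integral_congr (hR 0).le inner, circleIntegral.integral_const_mul,
      Fin.foldr_succ, ← hq']
    have hup : ∀ z s : ℂ, Function.update (Fin.cons z (x ∘ Fin.succ) : Fin (n + 1) → ℂ) 0 s =
        Fin.cons s (x ∘ Fin.succ) := fun z s => by simp
    have := circleIntegral_sub_zpow_mul (c := c 0) (w := x 0) (R := R 0)
      (by simpa [dist_eq_norm] using hx 0)
      (fun k z => ev ((D 0)^[k] q') (Fin.cons z (x ∘ Fin.succ)))
      (fun k z hz => by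
        have h := hD ((D 0)^[k] q') 0 (Fin.cons z (x ∘ Fin.succ)) (by
          intro i
          refine Fin.cases ?_ (fun j => ?_) i
          · simpa [dist_eq_norm] using hz
          · simpa using (hx j.succ).le)
        simp only [Fin.cons_zero, hup] at h
        simpa only [Function.iterate_succ', Function.comp_apply] using h) m 0
    simp only [Function.iterate_zero, id_eq, zero_add] at this
    rw [this]
    have hxx : (Fin.cons (x 0) (x ∘ Fin.succ) : Fin (n + 1) → ℂ) = x := by
      ext i
      refine Fin.cases ?_ (fun j => ?_) i <;> simp
    rw [hxx]
    ring

/-- Differentiation under a torus integral. -/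
theorem hasDerivAt_torusIntegral {n : ℕ} {c : Fin n → ℂ} {R : Fin n → ℝ} (hR : ∀ i, 0 ≤ R i)
    {U : Set ℂ} (hU : IsOpen U) {f f' : ℂ → (Fin n → ℂ) → ℂ}
    (hf : ∀ s ∈ U, ContinuousOn (f s) {t | ∀ i, ‖t i - c i‖ = R i})
    (hf' : ContinuousOn (fun p : ℂ × (Fin n → ℂ) => f' p.1 p.2)
      (U ×ˢ {t | ∀ i, ‖t i - c i‖ = R i}))
    (hd : ∀ s ∈ U, ∀ t : Fin n → ℂ, (∀ i, ‖t i - c i‖ = R i) →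
      HasDerivAt (fun s => f s t) (f' s t) s) {s₀ : ℂ} (hs₀ : s₀ ∈ U) :
    HasDerivAt (fun s => ∯ t in T(c, R), f s t) (∯ t in T(c, R), f' s₀ t) s₀ := by
  obtain ⟨δ, hδ, hball⟩ := Metric.nhds_basis_closedBall.mem_iff.1 (hU.mem_nhds hs₀)
  set T : Set (Fin n → ℂ) := {t | ∀ i, ‖t i - c i‖ = R i} with hT
  have hmem : ∀ θ, torusMap c R θ ∈ T := fun θ i => torusMap_apply_mem_sphere hR θ i
  set w : (Fin n → ℝ) → ℂ := fun θ => ∏ i, R i * Complex.exp (θ i * Complex.I) * Complex.I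
  have hw : Continuous w := by fun_prop
  have hcf : ∀ s ∈ U, Continuous fun θ => w θ * f s (torusMap c R θ) := fun s hs =>
    hw.mul ((hf s hs).comp_continuous (continuous_torusMap c R) hmem)
  have hcf' : ContinuousOn (fun p : ℂ × (Fin n → ℝ) => w p.2 * f' p.1 (torusMap c R p.2))
      (U ×ˢ Set.univ) := by
    refine ContinuousOn.mul (hw.comp continuous_snd).continuousOn ?_
    refine hf'.comp (f := fun p : ℂ × (Fin n → ℝ) => (p.1, torusMap c R p.2)) ?_ ?_
    · exact (continuous_fst.prodMk
        ((continuous_torusMap c R).comp continuous_snd)).continuousOn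
    · intro p hp
      exact ⟨hp.1, hmem _⟩
  obtain ⟨C, hC⟩ := ((isCompact_closedBall s₀ δ).prod
    (isCompact_Icc (a := (0 : Fin n → ℝ)) (b := fun _ => 2 * Real.pi))).exists_bound_of_continuousOn
    (hcf'.mono fun p hp => ⟨hball hp.1, trivial⟩)
  have hcf'' : ∀ s ∈ U, Continuous fun θ => w θ * f' s (torusMap c R θ) := by
    intro s hs
    have := hcf'.comp_continuous (f := fun θ : Fin n → ℝ => (s, θ)) (by fun_prop)
      fun θ => ⟨hs, trivial⟩
    exact this
  unfold torusIntegral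
  simp only [smul_eq_mul]
  refine (hasDerivAt_integral_of_dominated_loc_of_deriv_le (𝕜 := ℂ) (E := ℂ)
    (μ := volume.restrict (Set.Icc (0 : Fin n → ℝ) fun _ => 2 * Real.pi))
    (F := fun s θ => w θ * f s (torusMap c R θ)) (F' := fun s θ => w θ * f' s (torusMap c R θ))
    (bound := fun _ => C) (Metric.closedBall_mem_nhds s₀ hδ) ?_ ?_ ?_ ?_ ?_ ?_).2
  · filter_upwards [hU.mem_nhds hs₀] with s hs
    exact (hcf s hs).aestronglyMeasurable
  · exact (hcf s₀ hs₀).integrableOn_Icc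
  · exact (hcf'' s₀ hs₀).aestronglyMeasurable
  · refine (ae_restrict_iff' measurableSet_Icc).2 (Filter.Eventually.of_forall fun θ hθ s hs => ?_)
    exact hC (s, θ) ⟨hs, hθ⟩
  · exact continuous_const.integrableOn_Icc
  · refine Filter.Eventually.of_forall fun θ s hs => ?_
    exact (hd s (hball hs) _ (hmem θ)).const_mul _

/-- The torus integral of a partial derivative vanishes. -/
theorem torusIntegral_partialDeriv_eq_zero {n : ℕ} {c : Fin n → ℂ} {R : Fin n → ℝ}
    (hR : ∀ i, 0 ≤ R i) {V : Set (Fin n → ℂ)} (hV : IsOpen V)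
    (hTV : {t | ∀ i, ‖t i - c i‖ = R i} ⊆ V) (i : Fin n) {f f' : (Fin n → ℂ) → ℂ}
    (hf : ContinuousOn f V) (hf' : ContinuousOn f' V)
    (hd : ∀ t ∈ V, HasDerivAt (fun s => f (Function.update t i s)) (f' t) (t i)) :
    (∯ t in T(c, R), f' t) = 0 := by
  cases n with
  | zero => exact i.elim0
  | succ n =>
    rw [torusIntegral_succAbove (torusIntegrable_of_continuousOn hR (hf'.mono hTV)) i]
    set T' : Set (Fin n → ℂ) :=
      {y | ∀ j, ‖y j - (c ∘ i.succAbove) j‖ = (R ∘ i.succAbove) j} with hT'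
    have hcT' : IsCompact T' := by
      have : T' = Set.pi Set.univ fun j => Metric.sphere ((c ∘ i.succAbove) j)
          ((R ∘ i.succAbove) j) := by
        ext y
        simp [hT']
      rw [this]
      exact isCompact_univ_pi fun j => isCompact_sphere _ _
    have hins : Continuous fun p : ℂ × (Fin n → ℂ) => (i.insertNth p.1 p.2 : Fin (n + 1) → ℂ) := by
      fun_prop
    set O : Set (ℂ × (Fin n → ℂ)) :=
      (fun p : ℂ × (Fin n → ℂ) => (i.insertNth p.1 p.2 : Fin (n + 1) → ℂ)) ⁻¹' V with hO
    have hOo : IsOpen O := hV.preimage hins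
    refine circleIntegral.integral_eq_zero_of_hasDerivWithinAt
      (f := fun z => ∯ y in T(c ∘ i.succAbove, R ∘ i.succAbove), f (i.insertNth z y))
      (hR i) fun z hz => HasDerivAt.hasDerivWithinAt ?_
    have hsub : ({z} : Set ℂ) ×ˢ T' ⊆ O := by
      rintro ⟨z', y⟩ ⟨rfl, hy⟩
      refine hTV fun j => ?_
      refine Fin.succAboveCases i ?_ (fun j => ?_) j
      · simpa [dist_eq_norm] using hz
      · simpa using hy j
    obtain ⟨U, W, hU, hW, hzU, hTW, hUW⟩ := generalized_tube_lemma isCompact_singleton hcT' hOo hsub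
    refine hasDerivAt_torusIntegral (U := U) (f' := fun z y => f' (i.insertNth z y))
      (fun j => hR _) hU ?_ ?_ ?_ (hzU rfl)
    · intro s hs
      exact hf.comp (by fun_prop) fun y hy => (show (s, y) ∈ O from hUW ⟨hs, hTW hy⟩)
    · exact hf'.comp hins.continuousOn fun p hp => (show p ∈ O from hUW ⟨hp.1, hTW hp.2⟩)
    · intro s hs y hy
      have := hd (i.insertNth s y) (show (s, y) ∈ O from hUW ⟨hs, hTW hy⟩)
      simpa using this

/-! ### The product of differences and the kernel function -/

theorem map_prodDiff {R S : Type*} [CommRing R] [CommRing S] {n : ℕ} (f : R →+* S)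
    (x : Fin n → R) : f (prodDiff x) = prodDiff fun i => f (x i) := by
  simp [prodDiff, map_prod]

theorem prodDiff_ne_zero {R : Type*} [CommRing R] [IsDomain R] {n : ℕ} {x : Fin n → R}
    (hx : Function.Injective x) : prodDiff x ≠ 0 := by
  refine Finset.prod_ne_zero_iff.2 fun i _ => Finset.prod_ne_zero_iff.2 fun j hj => ?_
  exact sub_ne_zero.2 fun h => (Finset.mem_Ioi.1 hj).ne (hx h)

theorem prodDiff_succ {R : Type*} [CommRing R] {n : ℕ} (x : Fin (n + 1) → R) :
    prodDiff x = prodDiff (fun i : Fin n => x i.castSucc) *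
      ∏ i : Fin n, (x i.castSucc - x (Fin.last n)) := by
  unfold prodDiff
  rw [Fin.prod_univ_castSucc, ← Finset.prod_mul_distrib]
  have h : Finset.Ioi (Fin.last n) = ∅ := by ext j; simp [Fin.le_last]
  rw [h, Finset.prod_empty, mul_one]
  refine Finset.prod_congr rfl fun i _ => ?_
  have h : Finset.Ioi i.castSucc =
      insert (Fin.last n) ((Finset.Ioi i).map Fin.castSuccEmb) := by
    ext j
    refine Fin.lastCases ?_ (fun j => ?_) j
    · simp [Fin.castSucc_lt_last]
    · simp [Fin.le_last]
  rw [h, Finset.prod_insert, Finset.prod_map, mul_comm]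
  · rfl
  · simp

/-- The logarithmic derivative of `prodDiff` in the direction `l`. The term `j = l` vanishes,
as `0⁻¹ = 0`. -/
noncomputable def sumInv {n : ℕ} (x : Fin n → ℂ) (l : Fin n) : ℂ := ∑ j, (x l - x j)⁻¹

/-- The sum of `(x_l - x_j)^{-2}` over the ordered pairs with `l ≠ j`; the diagonal terms
vanish, as `0⁻¹ = 0`. -/
noncomputable def sumInvSq {n : ℕ} (x : Fin n → ℂ) : ℂ := ∑ l, ∑ j, (x l - x j)⁻¹ ^ 2

theorem hasDerivAt_finset_prod_log {ι : Type*} (s : Finset ι) {f : ι → ℂ → ℂ} {a : ι → ℂ}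
    {z : ℂ} (h : ∀ i ∈ s, HasDerivAt (f i) (f i z * a i) z) :
    HasDerivAt (fun w => ∏ i ∈ s, f i w) ((∏ i ∈ s, f i z) * ∑ i ∈ s, a i) z := by
  classical
  induction s using Finset.induction_on with
  | empty => simpa using hasDerivAt_const z (1 : ℂ)
  | insert i s hi ih =>
    have h1 := (h i (Finset.mem_insert_self i s)).mul
      (ih fun j hj => h j (Finset.mem_insert_of_mem hj))
    simp only [Finset.prod_insert hi, Finset.sum_insert hi]
    refine h1.congr_deriv ?_
    ring

theorem HasDerivAt.pow_log {f : ℂ → ℂ} {a z : ℂ} (h : HasDerivAt f (f z * a) z) (k : ℕ) :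
    HasDerivAt (fun w => f w ^ k) (f z ^ k * (k * a)) z := by
  refine (h.pow k).congr_deriv ?_
  rcases k with _ | k
  · simp
  · simp only [Nat.add_sub_cancel]
    ring

theorem HasDerivAt.inv_log {f : ℂ → ℂ} {a z : ℂ} (h : HasDerivAt f (f z * a) z) (hz : f z ≠ 0) :
    HasDerivAt (fun w => (f w)⁻¹) ((f z)⁻¹ * -a) z := by
  refine (h.inv hz).congr_deriv ?_
  field_simp

theorem HasDerivAt.mul_log {f g : ℂ → ℂ} {a b z : ℂ} (hf : HasDerivAt f (f z * a) z)
    (hg : HasDerivAt g (g z * b) z) :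
    HasDerivAt (fun w => f w * g w) (f z * g z * (a + b)) z := by
  refine (hf.mul hg).congr_deriv ?_
  ring

theorem hasDerivAt_update_apply {ι : Type*} [DecidableEq ι] (x : ι → ℂ) (l i : ι) (z : ℂ) :
    HasDerivAt (fun s => Function.update x l s i) (if i = l then 1 else 0) z := by
  by_cases h : i = l
  · subst h
    simpa using hasDerivAt_id' z
  · simpa [h] using hasDerivAt_const z (x i)

theorem sum_Ioi_add_swap {n : ℕ} (f : Fin n → Fin n → ℂ) (hf : ∀ i, f i i = 0) :
    ∑ i, ∑ j ∈ Finset.Ioi i, (f i j + f j i) = ∑ i, ∑ j, f i j := by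
  have h := Finset.sum_sum_Ioi_add_eq_sum_sum_off_diag fun j i : Fin n => f i j
  rw [h]
  refine Finset.sum_congr rfl fun i _ => ?_
  rw [← Finset.sum_add_sum_compl {i}]
  simp [hf]

theorem hasDerivAt_prodDiff_update {n : ℕ} {x : Fin n → ℂ} (hx : Function.Injective x)
    (l : Fin n) :
    HasDerivAt (fun s => prodDiff (Function.update x l s)) (prodDiff x * sumInv x l) (x l) := by
  have hsum : sumInv x l = ∑ i, ∑ j ∈ Finset.Ioi i,
      ((if i = l then 1 else 0) - (if j = l then 1 else 0)) * (x i - x j)⁻¹ := by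
    have h := sum_Ioi_add_swap (fun i j : Fin n => if i = l then (x i - x j)⁻¹ else 0) (by simp)
    have h' : ∑ i, ∑ j, (if i = l then (x i - x j)⁻¹ else 0) = sumInv x l := by
      rw [Finset.sum_comm]
      simp [sumInv]
    rw [← h', ← h]
    refine Finset.sum_congr rfl fun i _ => Finset.sum_congr rfl fun j _ => ?_
    rw [← neg_sub (x i) (x j), inv_neg]
    split_ifs <;> ring
  rw [hsum]
  have key := hasDerivAt_finset_prod_log Finset.univ (z := x l)
    (f := fun i s => ∏ j ∈ Finset.Ioi i,
      (Function.update x l s i - Function.update x l s j))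
    (a := fun i => ∑ j ∈ Finset.Ioi i,
      ((if i = l then 1 else 0) - (if j = l then 1 else 0)) * (x i - x j)⁻¹) (fun i _ => by
      refine hasDerivAt_finset_prod_log _ fun j hj => ?_
      refine ((hasDerivAt_update_apply x l i _).sub
        (hasDerivAt_update_apply x l j _)).congr_deriv ?_
      have : x i - x j ≠ 0 := sub_ne_zero.2 fun h => (Finset.mem_Ioi.1 hj).ne (hx h)
      simp only [Function.update_eq_self]
      field_simp)
  simpa only [Function.update_eq_self, prodDiff] using key

theorem hasDerivAt_sumInv_update {n : ℕ} {x : Fin n → ℂ} (hx : Function.Injective x)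
    (l : Fin n) :
    HasDerivAt (fun s => sumInv (Function.update x l s) l) (-∑ j, (x l - x j)⁻¹ ^ 2) (x l) := by
  unfold sumInv
  rw [← Finset.sum_neg_distrib]
  refine HasDerivAt.fun_sum fun j _ => ?_
  by_cases hj : j = l
  · subst hj
    simpa using hasDerivAt_const (x j) (0 : ℂ)
  · have hne : x l - x j ≠ 0 := sub_ne_zero.2 fun h => hj (hx h).symm
    simp only [Function.update_self, Function.update_of_ne hj]
    refine ((hasDerivAt_id (x l)).sub_const (x j)).inv hne |>.congr_deriv ?_
    simp [neg_div, inv_pow]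

theorem sum_rotate {n : ℕ} (T : Fin n → Fin n → Fin n → ℂ) :
    ∑ l, ∑ j, ∑ k, T j k l = ∑ l, ∑ j, ∑ k, T l j k := by
  rw [Finset.sum_comm]
  exact Finset.sum_congr rfl fun l _ => Finset.sum_comm

/-- The three-term identity: the sums of `1 / ((x_l - x_j) (x_l - x_k))` over distinct
`j`, `k`, `l` cancel. -/
theorem sum_sumInv_sq {n : ℕ} {x : Fin n → ℂ} (hx : Function.Injective x) :
    ∑ l, sumInv x l ^ 2 = sumInvSq x := by
  set T : Fin n → Fin n → Fin n → ℂ := fun l j k => (x l - x j)⁻¹ * (x l - x k)⁻¹ with hT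
  have h1 : ∑ l, sumInv x l ^ 2 = ∑ l, ∑ j, ∑ k, T l j k := by
    simp only [sumInv, sq, Finset.sum_mul_sum, hT]
  have hcyc : ∀ l j k, T l j k + T j k l + T k l j =
      (if j = k then (x l - x j)⁻¹ ^ 2 else 0) + (if k = l then (x j - x k)⁻¹ ^ 2 else 0) +
        (if l = j then (x k - x l)⁻¹ ^ 2 else 0) := by
    intro l j k
    simp only [hT]
    have hh : ∀ a b : Fin n, a ≠ b → x a - x b ≠ 0 := fun a b h =>
      sub_ne_zero.2 fun h' => h (hx h')
    by_cases hjk : j = k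
    · subst hjk
      by_cases hjl : j = l
      · subst hjl; simp
      · have := hh l j (Ne.symm hjl)
        simp [hjl, Ne.symm hjl, sq]
    · by_cases hkl : k = l
      · subst hkl
        have := hh k j (Ne.symm hjk)
        simp [hjk, Ne.symm hjk, sq]
      · by_cases hlj : l = j
        · subst hlj
          simp [hkl, Ne.symm hkl, sq]
        · have h1 := hh l j hlj
          have h2 := hh j l (Ne.symm hlj)
          have h3 := hh k j (Ne.symm hjk)
          have h4 := hh j k hjk
          have h5 := hh k l hkl
          have h6 := hh l k (Ne.symm hkl)
          simp only [hjk, hkl, hlj, if_false]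
          rw [← neg_sub (x l) (x j), ← neg_sub (x k) (x l), ← neg_sub (x j) (x k)]
          rw [← neg_sub] at h2 h3 h6
          field_simp
          ring
  have h4 : ∑ l, ∑ j, ∑ k, (T l j k + T j k l + T k l j) = 3 * sumInvSq x := by
    simp only [hcyc, Finset.sum_add_distrib]
    have e1 : ∑ l, ∑ j, ∑ k, (if j = k then (x l - x j)⁻¹ ^ 2 else 0) = sumInvSq x := by
      simp [sumInvSq]
    have e2 := sum_rotate fun l j k => if j = k then (x l - x j)⁻¹ ^ 2 else 0
    have e3 := sum_rotate fun j k l => if k = l then (x j - x k)⁻¹ ^ 2 else 0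
    have e4 := sum_rotate fun l j k => if k = l then (x j - x k)⁻¹ ^ 2 else 0
    rw [e4, e2, e1]
    ring
  simp only [Finset.sum_add_distrib] at h4
  rw [sum_rotate (fun l j k => T j k l), sum_rotate T] at h4
  rw [h1]
  linear_combination h4 / 3

theorem sum_Ioi_inv_sq {n : ℕ} (x : Fin n → ℂ) :
    2 * ∑ i, ∑ j ∈ Finset.Ioi i, (x i - x j)⁻¹ ^ 2 = sumInvSq x := by
  rw [sumInvSq, ← sum_Ioi_add_swap (fun i j : Fin n => (x i - x j)⁻¹ ^ 2) (by simp),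
    Finset.mul_sum]
  refine Finset.sum_congr rfl fun i _ => ?_
  rw [Finset.mul_sum]
  refine Finset.sum_congr rfl fun j _ => ?_
  rw [← neg_sub (x i) (x j), inv_neg]
  ring

/-- The product `∏ (t_i - x_l)` over all pairs of indices. -/
noncomputable def crossProd {N n : ℕ} (x : Fin N → ℂ) (t : Fin n → ℂ) : ℂ :=
  ∏ i, ∏ l, (t i - x l)

theorem crossProd_ne_zero {N n : ℕ} {x : Fin N → ℂ} {t : Fin n → ℂ} (h : ∀ i l, t i ≠ x l) :
    crossProd x t ≠ 0 :=
  Finset.prod_ne_zero_iff.2 fun i _ => Finset.prod_ne_zero_iff.2 fun l _ => sub_ne_zero.2 (h i l)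

theorem hasDerivAt_crossProd_left {N n : ℕ} {x : Fin N → ℂ} {t : Fin n → ℂ}
    (h : ∀ i l, t i ≠ x l) (l : Fin N) :
    HasDerivAt (fun s => crossProd (Function.update x l s) t)
      (crossProd x t * -∑ i, (t i - x l)⁻¹) (x l) := by
  have key := hasDerivAt_finset_prod_log Finset.univ (z := x l)
    (f := fun i s => ∏ k, (t i - Function.update x l s k))
    (a := fun i => ∑ k, (if k = l then -(t i - x k)⁻¹ else 0)) (fun i _ => by
      refine hasDerivAt_finset_prod_log _ fun k _ => ?_
      refine ((hasDerivAt_update_apply x l k _).const_sub (t i)).congr_deriv ?_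
      have : t i - x k ≠ 0 := sub_ne_zero.2 (h i k)
      simp only [Function.update_eq_self]
      split_ifs <;> simp [this])
  simpa only [Function.update_eq_self, crossProd, Finset.sum_ite_eq', Finset.mem_univ, if_true,
    Finset.sum_neg_distrib] using key

theorem hasDerivAt_crossProd_right {N n : ℕ} {x : Fin N → ℂ} {t : Fin n → ℂ}
    (h : ∀ i l, t i ≠ x l) (i : Fin n) :
    HasDerivAt (fun s => crossProd x (Function.update t i s))
      (crossProd x t * ∑ l, (t i - x l)⁻¹) (t i) := by
  have key := hasDerivAt_finset_prod_log Finset.univ (z := t i)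
    (f := fun k s => ∏ l, (Function.update t i s k - x l))
    (a := fun k => if k = i then ∑ l, (t k - x l)⁻¹ else 0) (fun k _ => by
      have := hasDerivAt_finset_prod_log Finset.univ (z := t i)
        (f := fun l s => (Function.update t i s k - x l))
        (a := fun l => if k = i then (t k - x l)⁻¹ else 0) fun l _ => by
          refine ((hasDerivAt_update_apply t i k _).sub_const (x l)).congr_deriv ?_
          have : t k - x l ≠ 0 := sub_ne_zero.2 (h k l)
          simp only [Function.update_eq_self]
          split_ifs <;> simp [this]
      refine this.congr_deriv ?_
      split_ifs <;> simp)
  simpa only [Function.update_eq_self, crossProd, Finset.sum_ite_eq', Finset.mem_univ, if_true]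
    using key

theorem hasDerivAt_sum_update {n : ℕ} (x : Fin n → ℂ) (l : Fin n) :
    HasDerivAt (fun s => ∑ k, Function.update x l s k) 1 (x l) := by
  have := HasDerivAt.fun_sum (u := Finset.univ) fun k _ => hasDerivAt_update_apply x l k (x l)
  simpa using this

/-- The kernel `A(x)^κ A(t)^κ ∏ (t_i - x_l)^{-κ} e^{μ (∑ x - ∑ t)}`, which intertwines the
Calogero--Moser operators in the variables `x` and `t` with the coupling constant
`κ (κ - 1)`. -/
noncomputable def cmKernel {N n : ℕ} (κ : ℕ) (μ : ℂ) (x : Fin N → ℂ) (t : Fin n → ℂ) : ℂ :=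
  prodDiff x ^ κ * prodDiff t ^ κ * (crossProd x t)⁻¹ ^ κ *
    Complex.exp (μ * (∑ l, x l - ∑ i, t i))

/-- The logarithmic derivative of `cmKernel` in `x_l`. -/
noncomputable def kernelLogX {N n : ℕ} (κ : ℕ) (μ : ℂ) (x : Fin N → ℂ) (t : Fin n → ℂ)
    (l : Fin N) : ℂ :=
  κ * (sumInv x l + ∑ i, (t i - x l)⁻¹) + μ

/-- The logarithmic derivative of `cmKernel` in `t_i`. -/
noncomputable def kernelLogT {N n : ℕ} (κ : ℕ) (μ : ℂ) (x : Fin N → ℂ) (t : Fin n → ℂ)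
    (i : Fin n) : ℂ :=
  κ * (sumInv t i - ∑ l, (t i - x l)⁻¹) - μ

theorem hasDerivAt_cmKernel_left {N n : ℕ} (κ : ℕ) (μ : ℂ) {x : Fin N → ℂ} {t : Fin n → ℂ}
    (hx : Function.Injective x) (h : ∀ i l, t i ≠ x l) (l : Fin N) :
    HasDerivAt (fun s => cmKernel κ μ (Function.update x l s) t)
      (cmKernel κ μ x t * kernelLogX κ μ x t l) (x l) := by
  unfold cmKernel
  have h1 : HasDerivAt (fun s => prodDiff (Function.update x l s))
      (prodDiff (Function.update x l (x l)) * sumInv x l) (x l) := by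
    simpa using hasDerivAt_prodDiff_update hx l
  have h2 : HasDerivAt (fun s => crossProd (Function.update x l s) t)
      (crossProd (Function.update x l (x l)) t * -∑ i, (t i - x l)⁻¹) (x l) := by
    simpa using hasDerivAt_crossProd_left h l
  have h3 := (((hasDerivAt_sum_update x l).sub_const (∑ i, t i)).const_mul μ).cexp
  have h4 := (((h1.pow_log κ).mul_const (prodDiff t ^ κ)).congr_deriv
    (mul_right_comm _ _ _)).mul_log
    ((h2.inv_log (by simpa using crossProd_ne_zero h)).pow_log κ) |>.mul_log h3
  refine h4.congr_deriv ?_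
  simp only [Function.update_eq_self, kernelLogX]
  rw [neg_neg, mul_one, ← mul_add]

theorem hasDerivAt_cmKernel_right {N n : ℕ} (κ : ℕ) (μ : ℂ) {x : Fin N → ℂ} {t : Fin n → ℂ}
    (ht : Function.Injective t) (h : ∀ i l, t i ≠ x l) (i : Fin n) :
    HasDerivAt (fun s => cmKernel κ μ x (Function.update t i s))
      (cmKernel κ μ x t * kernelLogT κ μ x t i) (t i) := by
  unfold cmKernel
  have h1 : HasDerivAt (fun s => prodDiff (Function.update t i s))
      (prodDiff (Function.update t i (t i)) * sumInv t i) (t i) := by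
    simpa using hasDerivAt_prodDiff_update ht i
  have h2 : HasDerivAt (fun s => crossProd x (Function.update t i s))
      (crossProd x (Function.update t i (t i)) * ∑ l, (t i - x l)⁻¹) (t i) := by
    simpa using hasDerivAt_crossProd_right h i
  have h3 := (((hasDerivAt_sum_update t i).const_sub (∑ l, x l)).const_mul μ).cexp
  have h4 := (((h1.pow_log κ).const_mul (prodDiff x ^ κ)).congr_deriv
    (mul_assoc _ _ _).symm).mul_log
    ((h2.inv_log (by simpa using crossProd_ne_zero h)).pow_log κ) |>.mul_log h3
  refine h4.congr_deriv ?_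
  simp only [Function.update_eq_self, kernelLogT]
  ring

theorem hasDerivAt_kernelLogX {N n : ℕ} (κ : ℕ) (μ : ℂ) {x : Fin N → ℂ} {t : Fin n → ℂ}
    (hx : Function.Injective x) (h : ∀ i l, t i ≠ x l) (l : Fin N) :
    HasDerivAt (fun s => kernelLogX κ μ (Function.update x l s) t l)
      (κ * (-∑ j, (x l - x j)⁻¹ ^ 2 + ∑ i, (t i - x l)⁻¹ ^ 2)) (x l) := by
  unfold kernelLogX
  refine HasDerivAt.add_const _ (HasDerivAt.const_mul _ ((hasDerivAt_sumInv_update hx l).add ?_))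
  refine HasDerivAt.fun_sum fun i _ => ?_
  simp only [Function.update_self]
  refine (((hasDerivAt_id (x l)).const_sub (t i)).inv
    (sub_ne_zero.2 (h i l))).congr_deriv ?_
  simp

theorem hasDerivAt_kernelLogT {N n : ℕ} (κ : ℕ) (μ : ℂ) {x : Fin N → ℂ} {t : Fin n → ℂ}
    (ht : Function.Injective t) (h : ∀ i l, t i ≠ x l) (i : Fin n) :
    HasDerivAt (fun s => kernelLogT κ μ x (Function.update t i s) i)
      (κ * (-∑ j, (t i - t j)⁻¹ ^ 2 + ∑ l, (t i - x l)⁻¹ ^ 2)) (t i) := by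
  unfold kernelLogT
  refine HasDerivAt.sub_const _ (HasDerivAt.const_mul _ ?_)
  rw [← sub_neg_eq_add]
  refine (hasDerivAt_sumInv_update ht i).sub ?_
  rw [← Finset.sum_neg_distrib]
  refine HasDerivAt.fun_sum fun l _ => ?_
  simp only [Function.update_self]
  refine (((hasDerivAt_id (t i)).sub_const (x l)).inv
    (sub_ne_zero.2 (h i l))).congr_deriv ?_
  simp [neg_div]

theorem sum_sumInv {n : ℕ} (x : Fin n → ℂ) : ∑ l, sumInv x l = 0 := by
  have h : ∑ l, ∑ j, (x j - x l)⁻¹ = -∑ l, ∑ j, (x l - x j)⁻¹ := by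
    simp only [← Finset.sum_neg_distrib, ← inv_neg, neg_sub]
  rw [Finset.sum_comm] at h
  change ∑ l, ∑ j, (x l - x j)⁻¹ = 0
  linear_combination h / 2

/-- Partial fractions: `1 / ((x_l - x_j) (τ - x_l))`, summed over the ordered pairs. -/
theorem two_mul_sum_sumInv_mul {N : ℕ} {x : Fin N → ℂ} (hx : Function.Injective x) {τ : ℂ}
    (h : ∀ l, τ ≠ x l) :
    2 * ∑ l, sumInv x l * (τ - x l)⁻¹ = (∑ l, (τ - x l)⁻¹) ^ 2 - ∑ l, (τ - x l)⁻¹ ^ 2 := by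
  have h1 : ∑ l, sumInv x l * (τ - x l)⁻¹ = ∑ l, ∑ j, (x l - x j)⁻¹ * (τ - x l)⁻¹ := by
    simp [sumInv, Finset.sum_mul]
  have h2 : ∑ l, sumInv x l * (τ - x l)⁻¹ = ∑ l, ∑ j, (x j - x l)⁻¹ * (τ - x j)⁻¹ := by
    rw [h1, Finset.sum_comm]
  have h3 : ∀ l j, (x l - x j)⁻¹ * (τ - x l)⁻¹ + (x j - x l)⁻¹ * (τ - x j)⁻¹ =
      (τ - x l)⁻¹ * (τ - x j)⁻¹ - if l = j then (τ - x l)⁻¹ ^ 2 else 0 := by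
    intro l j
    split_ifs with hlj
    · subst hlj; simp [sq]
    · have e1 : x l - x j ≠ 0 := sub_ne_zero.2 fun h' => hlj (hx h')
      have e2 := sub_ne_zero.2 (h l)
      have e3 := sub_ne_zero.2 (h j)
      rw [← neg_sub (x l) (x j)]
      field_simp
      ring
  rw [two_mul]
  nth_rewrite 1 [h1]
  rw [h2, ← Finset.sum_add_distrib]
  simp only [← Finset.sum_add_distrib, h3, Finset.sum_sub_distrib, sq, Finset.sum_mul_sum]
  simp

/-- The kernel identity: the Calogero--Moser operators in `x` and in `t`, applied to the kernel,
differ by a constant. -/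
theorem cmKernel_identity {N n : ℕ} (κ : ℕ) (μ : ℂ) {x : Fin N → ℂ} {t : Fin n → ℂ}
    (hx : Function.Injective x) (ht : Function.Injective t) (h : ∀ i l, t i ≠ x l) :
    ∑ l, (kernelLogX κ μ x t l ^ 2 + κ * (-∑ j, (x l - x j)⁻¹ ^ 2 + ∑ i, (t i - x l)⁻¹ ^ 2)) -
      ∑ i, (kernelLogT κ μ x t i ^ 2 + κ * (-∑ j, (t i - t j)⁻¹ ^ 2 + ∑ l, (t i - x l)⁻¹ ^ 2)) =
    κ * (κ - 1) * (sumInvSq x - sumInvSq t) + (N - n) * μ ^ 2 := by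
  have zx := sum_sumInv x
  have zt := sum_sumInv t
  have sx := sum_sumInv_sq hx
  have st := sum_sumInv_sq ht
  have cx : 2 * ∑ l, sumInv x l * ∑ i, (t i - x l)⁻¹ =
      ∑ i, (∑ l, (t i - x l)⁻¹) ^ 2 - ∑ i, ∑ l, (t i - x l)⁻¹ ^ 2 := by
    simp only [← Finset.sum_sub_distrib, ← fun i => two_mul_sum_sumInv_mul hx (h i)]
    simp only [Finset.mul_sum]
    rw [Finset.sum_comm]
  have ct : -2 * ∑ i, sumInv t i * ∑ l, (t i - x l)⁻¹ =
      ∑ l, (∑ i, (t i - x l)⁻¹) ^ 2 - ∑ i, ∑ l, (t i - x l)⁻¹ ^ 2 := by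
    have e : ∀ l, ∀ i, (t i - x l)⁻¹ = -(x l - t i)⁻¹ := fun l i => by rw [← inv_neg, neg_sub]
    have e2 := fun l => two_mul_sum_sumInv_mul ht (τ := x l) fun i => (h i l).symm
    rw [Finset.sum_comm (f := fun i l => (t i - x l)⁻¹ ^ 2), ← Finset.sum_sub_distrib]
    simp only [e, Finset.sum_neg_distrib, neg_sq, ← e2]
    simp only [Finset.mul_sum]
    rw [Finset.sum_comm]
    simp [Finset.mul_sum]
  have sw : ∑ l, ∑ i, (t i - x l)⁻¹ ^ 2 = ∑ i, ∑ l, (t i - x l)⁻¹ ^ 2 := Finset.sum_comm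
  have sw1 : ∑ l, ∑ i, (t i - x l)⁻¹ = ∑ i, ∑ l, (t i - x l)⁻¹ := Finset.sum_comm
  have ex : ∑ l, kernelLogX κ μ x t l ^ 2 = κ ^ 2 * (∑ l, sumInv x l ^ 2 +
      2 * ∑ l, sumInv x l * ∑ i, (t i - x l)⁻¹ + ∑ l, (∑ i, (t i - x l)⁻¹) ^ 2) +
      2 * κ * μ * (∑ l, sumInv x l + ∑ l, ∑ i, (t i - x l)⁻¹) + N * μ ^ 2 := by
    have : (N : ℂ) * μ ^ 2 = ∑ _l : Fin N, μ ^ 2 := by simp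
    rw [this]
    simp only [Finset.mul_sum (s := (Finset.univ : Finset (Fin N))), ← Finset.sum_add_distrib]
    refine Finset.sum_congr rfl fun l _ => ?_
    rw [kernelLogX]
    ring
  have et : ∑ i, kernelLogT κ μ x t i ^ 2 = κ ^ 2 * (∑ i, sumInv t i ^ 2 +
      -2 * ∑ i, sumInv t i * ∑ l, (t i - x l)⁻¹ + ∑ i, (∑ l, (t i - x l)⁻¹) ^ 2) -
      2 * κ * μ * (∑ i, sumInv t i - ∑ i, ∑ l, (t i - x l)⁻¹) + n * μ ^ 2 := by
    have : (n : ℂ) * μ ^ 2 = ∑ _l : Fin n, μ ^ 2 := by simp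
    rw [this]
    simp only [Finset.mul_sum (s := (Finset.univ : Finset (Fin n))), ← Finset.sum_add_distrib,
      ← Finset.sum_sub_distrib]
    refine Finset.sum_congr rfl fun l _ => ?_
    rw [kernelLogT]
    ring
  simp only [Finset.sum_add_distrib, ex, et, sx, st, cx, ct, zx, zt, sw1, ← Finset.mul_sum,
    Finset.sum_neg_distrib, sw]
  simp only [← sumInvSq.eq_1]
  ring

theorem isOpen_setOf_injective (n : ℕ) : IsOpen {x : Fin n → ℂ | Function.Injective x} := by
  have : {x : Fin n → ℂ | Function.Injective x} =
      ⋂ i : Fin n, ⋂ j : Fin n, {x | i ≠ j → x i ≠ x j} := by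
    ext x
    simp only [Set.mem_ofPred_eq, Set.mem_iInter, Function.Injective]
    exact ⟨fun h i j hij he => hij (h he), fun h i j he => by_contra fun hij => h i j hij he⟩
  rw [this]
  refine isOpen_iInter_of_finite fun i => isOpen_iInter_of_finite fun j => ?_
  by_cases hij : i = j
  · simp [hij]
  · simp only [ne_eq, hij, not_false_eq_true, true_imp_iff]
    exact isOpen_ne_fun (continuous_apply i) (continuous_apply j)

theorem iteratedDeriv_two_update {ι : Type*} [Fintype ι] [DecidableEq ι] {U : Set (ι → ℂ)}
    (hU : IsOpen U) {l : ι} {f f₁ f₂ : (ι → ℂ) → ℂ}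
    (h₁ : ∀ x ∈ U, HasDerivAt (fun s => f (Function.update x l s)) (f₁ x) (x l))
    (h₂ : ∀ x ∈ U, HasDerivAt (fun s => f₁ (Function.update x l s)) (f₂ x) (x l))
    {x : ι → ℂ} (hx : x ∈ U) :
    iteratedDeriv 2 (fun s => f (Function.update x l s)) (x l) = f₂ x := by
  rw [iteratedDeriv_succ, iteratedDeriv_one]
  rw [← (h₂ x hx).deriv]
  refine Filter.EventuallyEq.deriv_eq ?_
  have hc : Continuous fun s => Function.update x l s := by fun_prop
  have : ∀ᶠ s in nhds (x l), Function.update x l s ∈ U :=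
    hc.continuousAt.eventually_mem (by simpa using hU.mem_nhds hx)
  filter_upwards [this] with s hs
  simpa using (h₁ _ hs).deriv

/-! ### Polynomial numerators for the iterated residue -/

theorem hasDerivAt_eval_update {σ : Type*} [DecidableEq σ] (q : MvPolynomial σ ℂ) (y : σ → ℂ)
    (j : σ) :
    HasDerivAt (fun s => MvPolynomial.eval (Function.update y j s) q)
      (MvPolynomial.eval y (MvPolynomial.pderiv j q)) (y j) := by
  induction q using MvPolynomial.induction_on with
  | C a => simpa using hasDerivAt_const (y j) a
  | add p q hp hq => simpa only [map_add] using hp.fun_add hq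
  | mul_X p i hp =>
    simp only [map_mul, MvPolynomial.eval_X]
    refine (hp.mul (hasDerivAt_update_apply y j i (y j))).congr_deriv ?_
    simp only [Function.update_eq_self, MvPolynomial.pderiv_mul, map_add, map_mul,
      MvPolynomial.eval_X, MvPolynomial.pderiv_X]
    by_cases h : i = j
    · subst h; simp
    · simp [h]

theorem foldr_iterate_induction {Q : Type*} (m : ℕ) {n : ℕ} (D : Fin n → Q → Q) (p : Q → Prop)
    (h : ∀ i q, p q → p (D i q)) {q : Q} (hq : p q) :
    p (Fin.foldr n (fun i q => (D i)^[m] q) q) := by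
  induction n with
  | zero => simpa using hq
  | succ n ih =>
    rw [Fin.foldr_succ]
    exact Function.Iterate.rec p (ih (fun i => D i.succ) fun i => h i.succ) (h 0) m

theorem foldr_iterate_eq_prod {Q R : Type*} [CommMonoid R] (m : ℕ) {n : ℕ} (D : Fin n → Q → Q)
    (φ : Q → R) (b : Fin n → R) (h : ∀ i q, φ (D i q) = b i * φ q) (q : Q) :
    φ (Fin.foldr n (fun i q => (D i)^[m] q) q) = (∏ i, b i) ^ m * φ q := by
  induction n with
  | zero => simp
  | succ n ih =>
    rw [Fin.foldr_succ, Fin.prod_univ_succ]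
    have := ih (fun i => D i.succ) (fun i => b i.succ) (fun i => h i.succ)
    have h0 : ∀ k q, φ ((D 0)^[k] q) = b 0 ^ k * φ q := by
      intro k q
      induction k with
      | zero => simp
      | succ k ihk => rw [Function.iterate_succ_apply', h, ihk, pow_succ', mul_assoc]
    rw [h0, this, mul_pow, mul_assoc]

/-- Weighted homogeneity of unspecified degree. -/
def IsHom {σ : Type*} (w : σ → ℕ) (q : MvPolynomial σ ℂ) : Prop :=
  ∃ d, MvPolynomial.IsWeightedHomogeneous w q d

namespace IsHom

variable {σ τ : Type*} {w : σ → ℕ} {p q : MvPolynomial σ ℂ}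

theorem mul (hp : IsHom w p) (hq : IsHom w q) : IsHom w (p * q) :=
  ⟨_, hp.choose_spec.mul hq.choose_spec⟩

theorem pow (hp : IsHom w p) (k : ℕ) : IsHom w (p ^ k) := ⟨_, hp.choose_spec.pow k⟩

theorem prod {ι : Type*} (s : Finset ι) {f : ι → MvPolynomial σ ℂ} (h : ∀ i, IsHom w (f i)) :
    IsHom w (∏ i ∈ s, f i) :=
  ⟨_, MvPolynomial.IsWeightedHomogeneous.prod s f _ fun i _ => (h i).choose_spec⟩

theorem X_sub_X {i j : σ} (h : w i = w j) :
    IsHom w (MvPolynomial.X i - MvPolynomial.X j : MvPolynomial σ ℂ) :=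
  ⟨w i, (MvPolynomial.isWeightedHomogeneous_X ℂ w i).sub
    (h ▸ MvPolynomial.isWeightedHomogeneous_X ℂ w j)⟩

theorem prodDiff_X {n : ℕ} {v : Fin n → σ} (h : ∀ i j, w (v i) = w (v j)) :
    IsHom w (prodDiff fun i => (MvPolynomial.X (v i) : MvPolynomial σ ℂ)) :=
  prod _ fun i => prod _ fun j => X_sub_X (h i j)

theorem rename (f : τ → σ) {q : MvPolynomial τ ℂ} (hq : IsHom (w ∘ f) q) :
    IsHom w (MvPolynomial.rename f q) := by
  obtain ⟨d, hd⟩ := hq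
  refine ⟨d, fun e he => ?_⟩
  obtain ⟨u, rfl, hu⟩ := MvPolynomial.coeff_rename_ne_zero f q e he
  rw [← hd hu, Finsupp.weight, Finsupp.weight]
  exact Finsupp.linearCombination_mapDomain ℕ f u

end IsHom

theorem isWeightedHomogeneous_X_mul_pderiv {σ : Type*} {w : σ → ℕ} {q : MvPolynomial σ ℂ}
    {d b : ℕ} (hq : MvPolynomial.IsWeightedHomogeneous w q d) {i k : σ} (hk : w k = w i + b) :
    MvPolynomial.IsWeightedHomogeneous w (MvPolynomial.X k * MvPolynomial.pderiv i q)
      (b + d) := by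
  by_cases hd : w i ≤ d
  · have h1 := hq.pderiv (i := i) (n' := d - w i) (by omega)
    have h2 := (MvPolynomial.isWeightedHomogeneous_X ℂ w k).mul h1
    rwa [show w k + (d - w i) = b + d by omega] at h2
  · rw [MvPolynomial.pderiv_eq_zero_of_notMem_vars, mul_zero]
    · exact MvPolynomial.isWeightedHomogeneous_zero ℂ w _
    · intro hi
      obtain ⟨e, he, hie⟩ := (MvPolynomial.mem_vars_iff_mem_support i).1 hi
      have := hq (MvPolynomial.mem_support_iff.1 he)
      have h2 := Finsupp.le_weight_of_ne_zero' w (Finsupp.mem_support_iff.1 hie)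
      omega

/-- The product of the differences `t_i - x_l` with `i ≠ l`, with the sign chosen so that at
`t_i = x_i` it is the product of `prodDiff` of the first `n` coordinates and `prodDiff x`. -/
def crossReg {R : Type*} [CommRing R] {n : ℕ} (t : Fin n → R) (x : Fin (n + 1) → R) : R :=
  ∏ i, ((∏ l ∈ Finset.Ioi i, (t i - x l.castSucc)) *
    (∏ l ∈ Finset.Iio i, (x l.castSucc - t i)) * (t i - x (Fin.last n)))

/-- The product of the differences `x_i - x_n` between the last coordinate and the others. -/
def lastProd {R : Type*} [CommRing R] {n : ℕ} (x : Fin (n + 1) → R) : R :=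
  ∏ i : Fin n, (x i.castSucc - x (Fin.last n))

/-- A common denominator for the integrand of one row; it is `prodDiff x ^ 3` at
`t_i = x_i`. -/
def rowDenom {R : Type*} [CommRing R] {n : ℕ} (t : Fin n → R) (x : Fin (n + 1) → R) : R :=
  prodDiff t * crossReg t x * lastProd x ^ 2

theorem crossReg_self {R : Type*} [CommRing R] {n : ℕ} (x : Fin (n + 1) → R) :
    crossReg (fun i : Fin n => x i.castSucc) x =
      prodDiff (fun i : Fin n => x i.castSucc) ^ 2 * lastProd x := by
  have h : ∏ i : Fin n, ∏ l ∈ Finset.Iio i, (x l.castSucc - x i.castSucc) =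
      prodDiff fun i : Fin n => x i.castSucc := by
    unfold prodDiff
    rw [Finset.prod_sigma', Finset.prod_sigma']
    refine Finset.prod_nbij' (fun i => ⟨i.2, i.1⟩) (fun i => ⟨i.2, i.1⟩) ?_ ?_ ?_ ?_ ?_ <;> simp
  unfold crossReg lastProd
  rw [Finset.prod_mul_distrib, Finset.prod_mul_distrib, h, sq]
  rfl

theorem rowDenom_self {R : Type*} [CommRing R] {n : ℕ} (x : Fin (n + 1) → R) :
    rowDenom (fun i : Fin n => x i.castSucc) x = prodDiff x ^ 3 := by
  rw [rowDenom, crossReg_self, prodDiff_succ]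
  unfold lastProd
  ring

theorem crossProd_eq {n : ℕ} (t : Fin n → ℂ) (x : Fin (n + 1) → ℂ) :
    crossProd x t = (-1) ^ n.choose 2 * (∏ i, (t i - x i.castSucc)) * crossReg t x := by
  have hsign : ((-1) ^ n.choose 2 : ℂ) = ∏ i : Fin n, (-1) ^ (i : ℕ) := by
    rw [Finset.prod_pow_eq_pow_sum, Fin.sum_univ_eq_sum_range (fun i => i), Finset.sum_range_id,
      Nat.choose_two_right]
  unfold crossProd crossReg
  rw [hsign, ← Finset.prod_mul_distrib, ← Finset.prod_mul_distrib]
  refine Finset.prod_congr rfl fun i _ => ?_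
  rw [Fin.prod_univ_castSucc]
  have h1 : ∏ l : Fin n, (t i - x l.castSucc) = (t i - x i.castSucc) *
      ((∏ l ∈ Finset.Ioi i, (t i - x l.castSucc)) *
        ∏ l ∈ Finset.Iio i, (t i - x l.castSucc)) := by
    rw [← Finset.prod_mul_prod_compl {i}, Finset.prod_singleton, ← Finset.Ioi_disjUnion_Iio,
      Finset.prod_disjUnion]
  have h2 : ∏ l ∈ Finset.Iio i, (t i - x l.castSucc) =
      (-1) ^ (i : ℕ) * ∏ l ∈ Finset.Iio i, (x l.castSucc - t i) := by
    have : (-1 : ℂ) ^ (i : ℕ) = ∏ l ∈ Finset.Iio i, (-1 : ℂ) := by simp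
    rw [this, ← Finset.prod_mul_distrib]
    exact Finset.prod_congr rfl fun l _ => by ring
  rw [h1, h2]
  ring

theorem crossReg_ne_zero {n : ℕ} {t : Fin n → ℂ} {x : Fin (n + 1) → ℂ}
    (h : ∀ i l, l ≠ i.castSucc → t i ≠ x l) : crossReg t x ≠ 0 := by
  refine Finset.prod_ne_zero_iff.2 fun i _ => mul_ne_zero (mul_ne_zero ?_ ?_) ?_
  · refine Finset.prod_ne_zero_iff.2 fun l hl => sub_ne_zero.2 (h i _ ?_)
    simpa using (Finset.mem_Ioi.1 hl).ne'
  · refine Finset.prod_ne_zero_iff.2 fun l hl => sub_ne_zero.2 (h i _ ?_).symm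
    simpa using (Finset.mem_Iio.1 hl).ne
  · exact sub_ne_zero.2 (h i _ (Fin.castSucc_lt_last i).ne')

theorem lastProd_ne_zero {n : ℕ} {x : Fin (n + 1) → ℂ} (hx : Function.Injective x) :
    lastProd x ≠ 0 :=
  Finset.prod_ne_zero_iff.2 fun i _ => sub_ne_zero.2 fun h => (Fin.castSucc_lt_last i).ne (hx h)

theorem rowDenom_ne_zero {n : ℕ} {t : Fin n → ℂ} {x : Fin (n + 1) → ℂ}
    (hx : Function.Injective x) (ht : Function.Injective t)
    (h : ∀ i l, l ≠ i.castSucc → t i ≠ x l) : rowDenom t x ≠ 0 :=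
  mul_ne_zero (mul_ne_zero (prodDiff_ne_zero ht) (crossReg_ne_zero h))
    (pow_ne_zero _ (lastProd_ne_zero hx))

theorem map_crossReg {R S : Type*} [CommRing R] [CommRing S] {n : ℕ} (f : R →+* S)
    (t : Fin n → R) (x : Fin (n + 1) → R) :
    f (crossReg t x) = crossReg (fun i => f (t i)) fun i => f (x i) := by
  simp [crossReg, map_prod]

theorem map_lastProd {R S : Type*} [CommRing R] [CommRing S] {n : ℕ} (f : R →+* S)
    (x : Fin (n + 1) → R) : f (lastProd x) = lastProd fun i => f (x i) := by
  simp [lastProd, map_prod]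

theorem map_rowDenom {R S : Type*} [CommRing R] [CommRing S] {n : ℕ} (f : R →+* S)
    (t : Fin n → R) (x : Fin (n + 1) → R) :
    f (rowDenom t x) = rowDenom (fun i => f (t i)) fun i => f (x i) := by
  simp [rowDenom, map_prodDiff, map_crossReg, map_lastProd]

/-- Polynomials in `x`, `λ` and a homogenizing variable `h` (the variable `none`). Assigning to
`h` the sum of the weights of `x` and `λ` makes the operators `h ∂ / ∂x_i + λ_j` homogeneous. -/
abbrev HPoly (n : ℕ) := MvPolynomial (Option (Fin n ⊕ Fin n)) ℂ

/-- Polynomials in the variables `t_1, …, t_n` of one row, in `x`, `λ` with `n + 1` coordinates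
and in the homogenizing variable `h`. -/
abbrev RowPoly (n : ℕ) := MvPolynomial (Fin n ⊕ Option (Fin (n + 1) ⊕ Fin (n + 1))) ℂ

/-- The point with coordinates `x`, `λ`, `h`. -/
def hPoint {n : ℕ} (x lam : Fin n → ℂ) (h : ℂ) : Option (Fin n ⊕ Fin n) → ℂ :=
  fun o => o.elim h (Sum.elim x lam)

/-- The weights `α` of `x`, `β` of `λ` and `α + β` of `h`. -/
def hWeight (n α β : ℕ) : Option (Fin n ⊕ Fin n) → ℕ :=
  fun o => o.elim (α + β) (Sum.elim (fun _ => α) fun _ => β)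

/-- The weights `α` of `t` and of `x`, `β` of `λ` and `α + β` of `h`. -/
def rowWeight (n α β : ℕ) : Fin n ⊕ Option (Fin (n + 1) ⊕ Fin (n + 1)) → ℕ :=
  Sum.elim (fun _ => α) (hWeight (n + 1) α β)

namespace RowPoly

variable {n : ℕ}

/-- The variable `t_i`. -/
noncomputable def T (i : Fin n) : RowPoly n := MvPolynomial.X (Sum.inl i)

/-- The variable `x_l`. -/
noncomputable def x (l : Fin (n + 1)) : RowPoly n := MvPolynomial.X (Sum.inr (some (Sum.inl l)))

/-- The variable `λ_l`. -/
noncomputable def lam (l : Fin (n + 1)) : RowPoly n := MvPolynomial.X (Sum.inr (some (Sum.inr l)))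

/-- The homogenizing variable. -/
noncomputable def hom : RowPoly n := MvPolynomial.X (Sum.inr none)

/-- The common denominator as a polynomial. -/
noncomputable def denom : RowPoly n := rowDenom T x

/-- The pair `(q, a)` stands for `q / B^a * exp (∑ (λ_i - λ_n) t_i / h)`, where `B` is the common
denominator; this is the operator `h ∂ / ∂t_i` on such functions. -/
noncomputable def deriv (i : Fin n) (p : RowPoly n × ℕ) : RowPoly n × ℕ :=
  (hom * (denom * MvPolynomial.pderiv (Sum.inl i) p.1 -
      (p.2 : RowPoly n) * p.1 * MvPolynomial.pderiv (Sum.inl i) denom) +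
    (lam i.castSucc - lam (Fin.last n)) * (denom * p.1), p.2 + 1)

/-- The function represented by a pair, at `h = 1`. -/
noncomputable def toFun (x lam : Fin (n + 1) → ℂ) (p : RowPoly n × ℕ) (t : Fin n → ℂ) : ℂ :=
  MvPolynomial.eval (Sum.elim t (hPoint x lam 1)) p.1 / rowDenom t x ^ p.2 *
    Complex.exp (∑ i, (lam i.castSucc - lam (Fin.last n)) * t i)

theorem eval_denom (t : Fin n → ℂ) (x lam : Fin (n + 1) → ℂ) (h : ℂ) :
    MvPolynomial.eval (Sum.elim t (hPoint x lam h)) denom = rowDenom t x := by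
  simp [denom, map_rowDenom, T, RowPoly.x, hPoint]

theorem hasDerivAt_eval (q : RowPoly n) (t : Fin n → ℂ)
    (v : Option (Fin (n + 1) ⊕ Fin (n + 1)) → ℂ) (i : Fin n) :
    HasDerivAt (fun s => MvPolynomial.eval (Sum.elim (Function.update t i s) v) q)
      (MvPolynomial.eval (Sum.elim t v) (MvPolynomial.pderiv (Sum.inl i) q)) (t i) := by
  have := hasDerivAt_eval_update q (Sum.elim t v) (Sum.inl i)
  simpa only [Sum.update_elim_inl, Sum.elim_inl] using this

theorem hasDerivAt_toFun (x lam : Fin (n + 1) → ℂ) (p : RowPoly n × ℕ) (i : Fin n)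
    {t : Fin n → ℂ} (ht : rowDenom t x ≠ 0) :
    HasDerivAt (fun s => toFun x lam p (Function.update t i s)) (toFun x lam (deriv i p) t)
      (t i) := by
  have h1 := hasDerivAt_eval p.1 t (hPoint x lam 1) i
  have h2 : HasDerivAt (fun s => rowDenom (Function.update t i s) x)
      (rowDenom t x * (MvPolynomial.eval (Sum.elim t (hPoint x lam 1))
        (MvPolynomial.pderiv (Sum.inl i) denom) / rowDenom t x)) (t i) := by
    have := hasDerivAt_eval denom t (hPoint x lam 1) i
    simp only [eval_denom] at this
    exact this.congr_deriv (by field_simp)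
  have h3 : HasDerivAt (fun s => ∑ j, (lam j.castSucc - lam (Fin.last n)) *
      Function.update t i s j) (lam i.castSucc - lam (Fin.last n)) (t i) := by
    have := HasDerivAt.fun_sum (u := Finset.univ) fun j _ =>
      (hasDerivAt_update_apply t i j (t i)).const_mul (lam j.castSucc - lam (Fin.last n))
    simpa using this
  have h2' : HasDerivAt (fun s => rowDenom (Function.update t i s) x)
      (rowDenom (Function.update t i (t i)) x * (MvPolynomial.eval (Sum.elim t (hPoint x lam 1))
        (MvPolynomial.pderiv (Sum.inl i) denom) / rowDenom t x)) (t i) := by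
    simpa using h2
  have h4 := (h1.fun_mul ((h2'.pow_log p.2).inv_log
    (by simpa using pow_ne_zero _ ht))).fun_mul h3.cexp
  simp only [toFun, div_eq_mul_inv]
  refine h4.congr_deriv ?_
  simp only [Function.update_eq_self, deriv, map_add, map_mul, map_sub, eval_denom, map_natCast]
  have e1 : MvPolynomial.eval (Sum.elim t (hPoint x lam 1)) hom = 1 := by
    simp [hom, hPoint]
  have e2 : ∀ l, MvPolynomial.eval (Sum.elim t (hPoint x lam 1)) (RowPoly.lam l) = lam l := by
    simp [RowPoly.lam, hPoint]
  simp only [e1, e2]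
  field_simp
  ring

theorem isHom_denom (α β : ℕ) : IsHom (rowWeight n α β) (denom : RowPoly n) := by
  have h1 : ∀ i l, IsHom (rowWeight n α β) (T i - x l : RowPoly n) := fun i l =>
    IsHom.X_sub_X rfl
  have h2 : ∀ i l, IsHom (rowWeight n α β) (x l - T i : RowPoly n) := fun i l =>
    IsHom.X_sub_X rfl
  have h3 : ∀ i l, IsHom (rowWeight n α β) (x l - x i : RowPoly n) := fun i l =>
    IsHom.X_sub_X rfl
  exact ((IsHom.prodDiff_X fun _ _ => rfl).mul (IsHom.prod _ fun i =>
    ((IsHom.prod _ fun l => h1 i _).mul (IsHom.prod _ fun l => h2 i _)).mul (h1 i _))).mul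
      ((IsHom.prod _ fun i => h3 _ _).pow 2)

theorem isHom_deriv {α β : ℕ} (i : Fin n) {p : RowPoly n × ℕ}
    (hp : IsHom (rowWeight n α β) p.1) : IsHom (rowWeight n α β) (deriv i p).1 := by
  obtain ⟨d, hd⟩ := hp
  obtain ⟨b, hb⟩ := isHom_denom (n := n) α β
  have hw : rowWeight n α β (Sum.inr none) = rowWeight n α β (Sum.inl i) + β := rfl
  have h1 := hb.mul (isWeightedHomogeneous_X_mul_pderiv hd hw)
  have h2 := (hd.mul (isWeightedHomogeneous_X_mul_pderiv hb hw)).C_mul (p.2 : ℂ)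
  have h3 : MvPolynomial.IsWeightedHomogeneous (rowWeight n α β)
      (lam i.castSucc - lam (Fin.last n) : RowPoly n) β :=
    (MvPolynomial.isWeightedHomogeneous_X ℂ (rowWeight n α β)
      (Sum.inr (some (Sum.inr i.castSucc)))).sub
    (MvPolynomial.isWeightedHomogeneous_X ℂ (rowWeight n α β)
      (Sum.inr (some (Sum.inr (Fin.last n)))))
  have h4 := h3.mul (hb.mul hd)
  rw [show d + (β + b) = b + (β + d) by ring] at h2
  rw [show β + (b + d) = b + (β + d) by ring] at h4
  refine ⟨b + (β + d), ?_⟩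
  have e : (deriv i p).1 = denom * (MvPolynomial.X (Sum.inr none) *
      MvPolynomial.pderiv (Sum.inl i) p.1) - MvPolynomial.C (p.2 : ℂ) *
        (p.1 * (MvPolynomial.X (Sum.inr none) * MvPolynomial.pderiv (Sum.inl i) denom)) +
      (lam i.castSucc - lam (Fin.last n)) * (denom * p.1) := by
    rw [deriv, hom, map_natCast]
    ring
  rw [e]
  exact (h1.sub h2).add h4

/-- The embedding of the variables for `n` particles, evaluated at the row `t`. -/
def ofHPoly (n : ℕ) :
    Option (Fin n ⊕ Fin n) → Fin n ⊕ Option (Fin (n + 1) ⊕ Fin (n + 1)) :=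
  fun o => o.elim (Sum.inr none)
    (Sum.elim Sum.inl fun i => Sum.inr (some (Sum.inr i.castSucc)))

/-- The substitution `t_i = x_i`. -/
def toHPoly (n : ℕ) :
    Fin n ⊕ Option (Fin (n + 1) ⊕ Fin (n + 1)) → Option (Fin (n + 1) ⊕ Fin (n + 1)) :=
  Sum.elim (fun i => some (Sum.inl i.castSucc)) id

/-- The integrand of a row over the common denominator, without its poles at `t_i = x_i`, for
the function `q / prodDiff t ^ a` of the row `t`. -/
noncomputable def start (m : ℕ) (p : HPoly n × ℕ) : RowPoly n × ℕ :=
  (prodDiff T ^ (m + 1) * MvPolynomial.rename (ofHPoly n) p.1 *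
    (prodDiff T * lastProd x ^ 2) ^ (m + 1) * (crossReg T x * lastProd x ^ 2) ^ p.2,
    m + 1 + p.2)

/-- The residue at `t_i = x_i` of the integrand of a row. -/
noncomputable def residue (m : ℕ) (p : HPoly n × ℕ) : RowPoly n × ℕ :=
  Fin.foldr n (fun i q => (deriv i)^[m] q) (start m p)

end RowPoly

/-- The numerator of the Baker--Akhiezer function, over a high power of `A(x)` and
homogenized by `h`, together with the exponent of that power. -/
noncomputable def numer (m : ℕ) : (n : ℕ) → HPoly n × ℕ
  | 0 => (1, 0)
  | n + 1 =>
    (prodDiff (fun i => MvPolynomial.X (some (Sum.inl i))) ^ (m + 1) *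
      MvPolynomial.rename (RowPoly.toHPoly n) (RowPoly.residue m (numer m n)).1,
      3 * (RowPoly.residue m (numer m n)).2)

theorem isHom_numer (m α β : ℕ) (n : ℕ) : IsHom (hWeight n α β) (numer m n).1 := by
  induction n with
  | zero => exact ⟨0, MvPolynomial.isWeightedHomogeneous_one ℂ _⟩
  | succ n ih =>
    refine ((IsHom.prodDiff_X fun _ _ => rfl).pow _).mul (IsHom.rename _ ?_)
    have hw : hWeight (n + 1) α β ∘ RowPoly.toHPoly n = rowWeight n α β := by
      ext o
      rcases o with i | o <;> rfl
    rw [hw]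
    refine foldr_iterate_induction m RowPoly.deriv
      (fun p => IsHom (rowWeight n α β) p.1) (fun i p hp => RowPoly.isHom_deriv i hp) ?_
    have h1 : ∀ i l, IsHom (rowWeight n α β) (RowPoly.T i - RowPoly.x l : RowPoly n) :=
      fun i l => IsHom.X_sub_X rfl
    have h2 : ∀ i l, IsHom (rowWeight n α β) (RowPoly.x l - RowPoly.T i : RowPoly n) :=
      fun i l => IsHom.X_sub_X rfl
    have h3 : ∀ i l, IsHom (rowWeight n α β) (RowPoly.x l - RowPoly.x i : RowPoly n) :=
      fun i l => IsHom.X_sub_X rfl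
    have hT : IsHom (rowWeight n α β) (prodDiff RowPoly.T : RowPoly n) :=
      IsHom.prodDiff_X fun _ _ => rfl
    have hl : IsHom (rowWeight n α β) (lastProd RowPoly.x : RowPoly n) :=
      IsHom.prod _ fun i => h3 _ _
    have hr : IsHom (rowWeight n α β) (crossReg RowPoly.T RowPoly.x : RowPoly n) :=
      IsHom.prod _ fun i =>
        ((IsHom.prod _ fun l => h1 i _).mul (IsHom.prod _ fun l => h2 i _)).mul (h1 i _)
    have hw' : rowWeight n α β ∘ RowPoly.ofHPoly n = hWeight n α β := by
      ext o
      rcases o with _ | i | i <;> rfl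
    exact (((hT.pow _).mul (IsHom.rename _ (hw' ▸ ih))).mul ((hT.mul (hl.pow 2)).pow _)).mul
      ((hr.mul (hl.pow 2)).pow _)

theorem RowPoly.snd_residue (m : ℕ) {n : ℕ} (p : HPoly n × ℕ) :
    (RowPoly.residue m p).2 = m + 1 + p.2 + m * n := by
  have := foldr_iterate_eq_prod m RowPoly.deriv
    (fun q : RowPoly n × ℕ => Multiplicative.ofAdd q.2) (fun _ => Multiplicative.ofAdd 1)
    (fun i q => congrArg Multiplicative.ofAdd (add_comm q.2 1)) (RowPoly.start m p)
  have h := congrArg Multiplicative.toAdd this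
  simp only [toAdd_ofAdd, toAdd_mul, toAdd_pow, Finset.prod_const, Finset.card_univ,
    Fintype.card_fin] at h
  rw [RowPoly.residue, h, RowPoly.start]
  simp
  ring

theorem RowPoly.eval_start {m n : ℕ} (p : HPoly n × ℕ) (t : Fin n → ℂ)
    (x lam : Fin (n + 1) → ℂ) (h : ℂ) :
    MvPolynomial.eval (Sum.elim t (hPoint x lam h)) (RowPoly.start m p).1 =
      prodDiff t ^ (m + 1) *
        MvPolynomial.eval (hPoint t (fun i => lam i.castSucc) h) p.1 *
        (prodDiff t * lastProd x ^ 2) ^ (m + 1) * (crossReg t x * lastProd x ^ 2) ^ p.2 := by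
  have he : Sum.elim t (hPoint x lam h) ∘ RowPoly.ofHPoly n =
      hPoint t (fun i => lam i.castSucc) h := by
    ext o
    rcases o with _ | i | i <;> rfl
  simp [RowPoly.start, map_prodDiff, map_crossReg, map_lastProd, MvPolynomial.eval_rename, he,
    RowPoly.T, RowPoly.x, hPoint]

theorem eval_rename_toHPoly {n : ℕ} (q : RowPoly n) (x lam : Fin (n + 1) → ℂ) (h : ℂ) :
    MvPolynomial.eval (hPoint x lam h) (MvPolynomial.rename (RowPoly.toHPoly n) q) =
      MvPolynomial.eval (Sum.elim (fun i : Fin n => x i.castSucc) (hPoint x lam h)) q := by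
  rw [MvPolynomial.eval_rename]
  congr 2
  ext o
  rcases o with i | o <;> rfl

/-- The leading term of the numerator. At `h = 0` the operators `h ∂ / ∂t_i + λ_i - λ_n` act as
multiplications. -/
theorem eval_numer_zero (m n : ℕ) (x lam : Fin n → ℂ) :
    MvPolynomial.eval (hPoint x lam 0) (numer m n).1 =
      prodDiff x ^ (numer m n).2 * prodDiff lam ^ m := by
  induction n with
  | zero => simp [numer, prodDiff]
  | succ n ih =>
    have key := foldr_iterate_eq_prod m RowPoly.deriv
      (fun q : RowPoly n × ℕ => MvPolynomial.eval
        (Sum.elim (fun i : Fin n => x i.castSucc) (hPoint x lam 0)) q.1)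
      (fun i => (lam i.castSucc - lam (Fin.last n)) * prodDiff x ^ 3)
      (fun i q => by
        have e1 : MvPolynomial.eval (Sum.elim (fun i : Fin n => x i.castSucc)
            (hPoint x lam 0)) RowPoly.hom = 0 := by
          simp [RowPoly.hom, hPoint]
        have e2 : ∀ l, MvPolynomial.eval (Sum.elim (fun i : Fin n => x i.castSucc)
            (hPoint x lam 0)) (RowPoly.lam l) = lam l := by
          simp [RowPoly.lam, hPoint]
        simp only [RowPoly.deriv, map_add, map_mul, map_sub, e1, e2, RowPoly.eval_denom,
          rowDenom_self]
        ring) (RowPoly.start m (numer m n))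
    simp only [RowPoly.eval_start, ih] at key
    have e3 : MvPolynomial.eval (hPoint x lam 0)
        (prodDiff fun i => (MvPolynomial.X (some (Sum.inl i)) : HPoly (n + 1))) = prodDiff x := by
      simp [map_prodDiff, hPoint]
    rw [numer]
    simp only [map_mul, map_pow, eval_rename_toHPoly, e3, RowPoly.snd_residue]
    rw [RowPoly.residue, key, crossReg_self, Finset.prod_mul_distrib, Finset.prod_const,
      Finset.card_univ, Fintype.card_fin, prodDiff_succ x, prodDiff_succ lam]
    change _ * ((lastProd lam * _) ^ m * _) = _ * (_ * lastProd lam) ^ m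
    change (_ * lastProd x) ^ _ * ((_ * ((_ * lastProd x) ^ _) ^ n) ^ m * _) =
      (_ * lastProd x) ^ _ * _
    ring

/-! ### The recursion for the Baker--Akhiezer function -/

/-- The Baker--Akhiezer function, up to the factor `A(λ)^{-m}`. -/
noncomputable def psi (m n : ℕ) (x lam : Fin n → ℂ) : ℂ :=
  MvPolynomial.eval (hPoint x lam 1) (numer m n).1 / prodDiff x ^ (numer m n).2 *
    Complex.exp (∑ i, lam i * x i)

theorem cmKernel_mul_psi {m n : ℕ} {x lam : Fin (n + 1) → ℂ} {t : Fin n → ℂ}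
    (hx : Function.Injective x) (ht : Function.Injective t) (h : ∀ i l, t i ≠ x l) :
    cmKernel (m + 1) (lam (Fin.last n)) x t * psi m n t (fun i => lam i.castSucc) =
      prodDiff x ^ (m + 1) * Complex.exp (lam (Fin.last n) * ∑ l, x l) *
        (-1) ^ ((m + 1) * n.choose 2) *
        ((∏ i, (t i - x i.castSucc) ^ (-(m : ℤ) - 1)) *
          RowPoly.toFun x lam (RowPoly.start m (numer m n)) t) := by
  have h1 : ∏ i, (t i - x i.castSucc) ^ (-(m : ℤ) - 1) =
      (∏ i, (t i - x i.castSucc))⁻¹ ^ (m + 1) := by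
    rw [← Finset.prod_inv_distrib, ← Finset.prod_pow]
    refine Finset.prod_congr rfl fun i _ => ?_
    rw [show -(m : ℤ) - 1 = -((m + 1 : ℕ) : ℤ) by push_cast; ring, zpow_neg, zpow_natCast, inv_pow]
  have h2 : Complex.exp (lam (Fin.last n) * (∑ l, x l - ∑ i, t i)) *
      Complex.exp (∑ i : Fin n, lam i.castSucc * t i) =
      Complex.exp (lam (Fin.last n) * ∑ l, x l) *
        Complex.exp (∑ i : Fin n, (lam i.castSucc - lam (Fin.last n)) * t i) := by
    rw [← Complex.exp_add, ← Complex.exp_add]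
    congr 1
    simp only [sub_mul, Finset.sum_sub_distrib, Finset.mul_sum, mul_sub]
    ring
  have hs : ((-1 : ℂ) ^ n.choose 2)⁻¹ = (-1) ^ n.choose 2 := by
    rw [← inv_pow]; norm_num
  have e1 := crossReg_ne_zero fun i l _ => h i l
  have e2 := prodDiff_ne_zero ht
  have e3 := lastProd_ne_zero hx
  have e4 : ∏ i, (t i - x i.castSucc) ≠ 0 :=
    Finset.prod_ne_zero_iff.2 fun i _ => sub_ne_zero.2 (h i _)
  have h3 : MvPolynomial.eval (Sum.elim t (hPoint x lam 1)) (RowPoly.start m (numer m n)).1 /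
      rowDenom t x ^ (RowPoly.start m (numer m n)).2 =
      prodDiff t ^ (m + 1) * (crossReg t x)⁻¹ ^ (m + 1) *
        (MvPolynomial.eval (hPoint t (fun i => lam i.castSucc) 1) (numer m n).1 /
          prodDiff t ^ (numer m n).2) := by
    rw [RowPoly.eval_start]
    simp only [RowPoly.start, rowDenom, pow_add _ (m + 1), mul_pow, inv_pow]
    field_simp
  rw [cmKernel, psi, RowPoly.toFun, h3, crossProd_eq, mul_inv, mul_inv, hs, h1]
  rw [mul_pow, mul_pow, ← pow_mul, mul_comm (n.choose 2)]
  linear_combination (prodDiff x ^ (m + 1) * prodDiff t ^ (m + 1) *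
    ((-1) ^ ((m + 1) * n.choose 2) * (∏ i, (t i - x i.castSucc))⁻¹ ^ (m + 1) *
      (crossReg t x)⁻¹ ^ (m + 1)) *
      (MvPolynomial.eval (hPoint t (fun i => lam i.castSucc) 1) (numer m n).1 /
          prodDiff t ^ (numer m n).2)) * h2

/-- The row integral of the kernel against the function for `n` particles is a multiple of the
function for `n + 1` particles. -/
theorem torusIntegral_cmKernel_mul_psi {m n : ℕ} (lam : Fin (n + 1) → ℂ) {x : Fin (n + 1) → ℂ}
    (hx : Function.Injective x) {c : Fin n → ℂ} {R : Fin n → ℝ}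
    (hxR : ∀ i, ‖x i.castSucc - c i‖ < R i)
    (sep : ∀ t : Fin n → ℂ, (∀ i, ‖t i - c i‖ ≤ R i) →
      Function.Injective t ∧ ∀ i l, l ≠ i.castSucc → t i ≠ x l) :
    (∯ t in T(c, R), cmKernel (m + 1) (lam (Fin.last n)) x t *
        psi m n t (fun i => lam i.castSucc)) =
      (2 * Real.pi * Complex.I / m.factorial) ^ n * (-1) ^ ((m + 1) * n.choose 2) *
        psi m (n + 1) x lam := by
  have hR : ∀ i, 0 ≤ R i := fun i => (norm_nonneg _).trans (hxR i).le
  have hden : ∀ t : Fin n → ℂ, (∀ i, ‖t i - c i‖ ≤ R i) → rowDenom t x ≠ 0 := fun t ht =>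
    rowDenom_ne_zero hx (sep t ht).1 (sep t ht).2
  have h1 := torusIntegral_congr (c := c) hR (fun t ht => cmKernel_mul_psi (m := m) (lam := lam) hx
    (sep t fun i => (ht i).le).1 fun i l => by
      by_cases hl : l = i.castSucc
      · subst hl
        intro h
        exact (hxR i).ne (h ▸ ht i)
      · exact (sep t fun i => (ht i).le).2 i l hl)
  have hcont : ∀ q : RowPoly n, Continuous fun t : Fin n → ℂ =>
      MvPolynomial.eval (Sum.elim t (hPoint x lam 1)) q := by
    intro q
    refine (MvPolynomial.continuous_eval q).comp (continuous_pi fun j => ?_)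
    rcases j with j | j
    · exact continuous_apply j
    · exact continuous_const
  have h2 := torusIntegral_prod_sub_zpow_mul m c (fun i => x i.castSucc) R hxR
    (RowPoly.toFun x lam) RowPoly.deriv (fun q => by
      unfold RowPoly.toFun
      refine ContinuousOn.mul (ContinuousOn.div ?_ ?_ fun t ht => pow_ne_zero _ (hden t ht)) ?_
      · exact (hcont q.1).continuousOn
      · simp only [← RowPoly.eval_denom _ x lam 1]
        exact ((hcont RowPoly.denom).pow q.2).continuousOn
      · refine Continuous.continuousOn ?_
        fun_prop) (fun q i t ht => RowPoly.hasDerivAt_toFun x lam q i (hden t ht))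
      (RowPoly.start m (numer m n))
  rw [h1, torusIntegral_const_mul, h2]
  change _ * (_ * RowPoly.toFun x lam (RowPoly.residue m (numer m n)) _) = _
  have e3 : MvPolynomial.eval (hPoint x lam 1)
      (prodDiff fun i => (MvPolynomial.X (some (Sum.inl i)) : HPoly (n + 1))) = prodDiff x := by
    simp [map_prodDiff, hPoint]
  have h4 : Complex.exp (lam (Fin.last n) * ∑ l, x l) * Complex.exp (∑ i : Fin n,
      (lam i.castSucc - lam (Fin.last n)) * x i.castSucc) =
      Complex.exp (∑ i, lam i * x i) := by
    rw [← Complex.exp_add]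
    congr 1
    simp only [sub_mul, Finset.sum_sub_distrib, Fin.sum_univ_castSucc, ← Finset.mul_sum]
    ring
  rw [psi, RowPoly.toFun, numer, rowDenom_self, ← h4]
  simp only [map_mul, map_pow, eval_rename_toHPoly, e3, ← pow_mul]
  ring

/-! ### The Schrödinger equation -/

/-- The partial derivative of `f` in the `i`-th coordinate. -/
noncomputable def partialDeriv {n : ℕ} (i : Fin n) (f : (Fin n → ℂ) → ℂ) (x : Fin n → ℂ) : ℂ :=
  fderiv ℂ f x (Pi.single i 1)

theorem hasDerivAt_partialDeriv {n : ℕ} (i : Fin n) {f : (Fin n → ℂ) → ℂ} {x : Fin n → ℂ}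
    (hf : DifferentiableAt ℂ f x) :
    HasDerivAt (fun s => f (Function.update x i s)) (partialDeriv i f x) (x i) := by
  have h1 : HasFDerivAt f (fderiv ℂ f x) (Function.update x i (x i)) := by
    simpa using hf.hasFDerivAt
  exact h1.comp_hasDerivAt (x i) (hasDerivAt_update x i (x i))

theorem contDiffOn_partialDeriv {n : ℕ} (i : Fin n) {f : (Fin n → ℂ) → ℂ}
    {U : Set (Fin n → ℂ)} (hU : IsOpen U) (hf : ContDiffOn ℂ (⊤ : ℕ∞) f U) :
    ContDiffOn ℂ (⊤ : ℕ∞) (partialDeriv i f) U :=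
  ((contDiffOn_infty_iff_fderiv_of_isOpen hU).1 hf).2.clm_apply contDiffOn_const

theorem contDiffOn_psi (m n : ℕ) (lam : Fin n → ℂ) :
    ContDiffOn ℂ (⊤ : ℕ∞) (fun x => psi m n x lam) {x | Function.Injective x} := by
  have h1 : ∀ q : HPoly n, ContDiff ℂ (⊤ : ℕ∞) fun x : Fin n → ℂ =>
      MvPolynomial.eval (hPoint x lam 1) q := by
    intro q
    induction q using MvPolynomial.induction_on with
    | C a => simpa using contDiff_const
    | add p q hp hq => simpa only [map_add] using hp.add hq
    | mul_X p o hp =>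
      simp only [map_mul, MvPolynomial.eval_X]
      refine hp.mul ?_
      rcases o with _ | l | l
      · exact contDiff_const
      · exact contDiff_apply ℂ ℂ l
      · exact contDiff_const
  have h2 : ContDiff ℂ (⊤ : ℕ∞) fun x : Fin n → ℂ => prodDiff x ^ (numer m n).2 := by
    unfold prodDiff
    fun_prop
  refine ContDiffOn.mul (ContDiffOn.div (h1 _).contDiffOn h2.contDiffOn fun x hx =>
    pow_ne_zero _ (prodDiff_ne_zero hx)) (ContDiff.contDiffOn ?_)
  fun_prop

theorem continuousOn_inv_sub {X : Type*} [TopologicalSpace X] {S : Set X} {f g : X → ℂ}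
    (hf : Continuous f) (hg : Continuous g) (h : ∀ x ∈ S, f x ≠ g x) :
    ContinuousOn (fun x => (f x - g x)⁻¹) S :=
  (hf.sub hg).continuousOn.inv₀ fun x hx => sub_ne_zero.2 (h x hx)

/-- The set of pairs `(x, t)` at which the kernel is regular. -/
def kernelDomain (N n : ℕ) : Set ((Fin N → ℂ) × (Fin n → ℂ)) :=
  {p | Function.Injective p.1 ∧ Function.Injective p.2 ∧ ∀ i l, p.2 i ≠ p.1 l}

theorem continuousOn_cmKernel {N n : ℕ} (κ : ℕ) (μ : ℂ) :
    ContinuousOn (fun p : (Fin N → ℂ) × (Fin n → ℂ) => cmKernel κ μ p.1 p.2)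
      (kernelDomain N n) := by
  unfold cmKernel
  refine ContinuousOn.mul (ContinuousOn.mul (Continuous.continuousOn ?_)
    (ContinuousOn.pow (ContinuousOn.inv₀ (Continuous.continuousOn ?_) fun p hp =>
      crossProd_ne_zero hp.2.2) _)) (Continuous.continuousOn ?_)
  · unfold prodDiff
    fun_prop
  · unfold crossProd
    fun_prop
  · fun_prop

theorem continuousOn_inv_sub_left {N n : ℕ} (l j : Fin N) :
    ContinuousOn (fun p : (Fin N → ℂ) × (Fin n → ℂ) => (p.1 l - p.1 j)⁻¹)
      (kernelDomain N n) := by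
  by_cases h : l = j
  · subst h
    simpa using continuousOn_const
  · exact continuousOn_inv_sub (by fun_prop) (by fun_prop) fun p hp he => h (hp.1 he)

theorem continuousOn_inv_sub_right {N n : ℕ} (i j : Fin n) :
    ContinuousOn (fun p : (Fin N → ℂ) × (Fin n → ℂ) => (p.2 i - p.2 j)⁻¹)
      (kernelDomain N n) := by
  by_cases h : i = j
  · subst h
    simpa using continuousOn_const
  · exact continuousOn_inv_sub (by fun_prop) (by fun_prop) fun p hp he => h (hp.2.1 he)

theorem continuousOn_inv_sub_cross {N n : ℕ} (i : Fin n) (l : Fin N) :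
    ContinuousOn (fun p : (Fin N → ℂ) × (Fin n → ℂ) => (p.2 i - p.1 l)⁻¹)
      (kernelDomain N n) :=
  continuousOn_inv_sub (by fun_prop) (by fun_prop) fun p hp => hp.2.2 i l

theorem continuousOn_kernelLogX {N n : ℕ} (κ : ℕ) (μ : ℂ) (l : Fin N) :
    ContinuousOn (fun p : (Fin N → ℂ) × (Fin n → ℂ) => kernelLogX κ μ p.1 p.2 l)
      (kernelDomain N n) :=
  (continuousOn_const.mul
    ((continuousOn_finsetSum _ fun j _ => continuousOn_inv_sub_left l j).add
    (continuousOn_finsetSum _ fun i _ => continuousOn_inv_sub_cross i l))).add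
      continuousOn_const

theorem continuousOn_kernelLogT {N n : ℕ} (κ : ℕ) (μ : ℂ) (i : Fin n) :
    ContinuousOn (fun p : (Fin N → ℂ) × (Fin n → ℂ) => kernelLogT κ μ p.1 p.2 i)
      (kernelDomain N n) :=
  (continuousOn_const.mul
    ((continuousOn_finsetSum _ fun j _ => continuousOn_inv_sub_right i j).sub
    (continuousOn_finsetSum _ fun l _ => continuousOn_inv_sub_cross i l))).sub
      continuousOn_const

/-- The second logarithmic derivative `K'' / K` of the kernel in `x_l`. -/
noncomputable def kernelSndX {N n : ℕ} (κ : ℕ) (μ : ℂ) (x : Fin N → ℂ) (t : Fin n → ℂ)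
    (l : Fin N) : ℂ :=
  kernelLogX κ μ x t l ^ 2 + κ * (-∑ j, (x l - x j)⁻¹ ^ 2 + ∑ i, (t i - x l)⁻¹ ^ 2)

/-- The second logarithmic derivative `K'' / K` of the kernel in `t_i`. -/
noncomputable def kernelSndT {N n : ℕ} (κ : ℕ) (μ : ℂ) (x : Fin N → ℂ) (t : Fin n → ℂ)
    (i : Fin n) : ℂ :=
  kernelLogT κ μ x t i ^ 2 + κ * (-∑ j, (t i - t j)⁻¹ ^ 2 + ∑ l, (t i - x l)⁻¹ ^ 2)

theorem continuousOn_kernelSndX {N n : ℕ} (κ : ℕ) (μ : ℂ) (l : Fin N) :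
    ContinuousOn (fun p : (Fin N → ℂ) × (Fin n → ℂ) => kernelSndX κ μ p.1 p.2 l)
      (kernelDomain N n) :=
  ((continuousOn_kernelLogX κ μ l).pow 2).add (continuousOn_const.mul
    ((continuousOn_finsetSum _ fun j _ => (continuousOn_inv_sub_left l j).pow 2).neg.add
    (continuousOn_finsetSum _ fun i _ => (continuousOn_inv_sub_cross i l).pow 2)))

theorem continuousOn_kernelSndT {N n : ℕ} (κ : ℕ) (μ : ℂ) (i : Fin n) :
    ContinuousOn (fun p : (Fin N → ℂ) × (Fin n → ℂ) => kernelSndT κ μ p.1 p.2 i)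
      (kernelDomain N n) :=
  ((continuousOn_kernelLogT κ μ i).pow 2).add (continuousOn_const.mul
    ((continuousOn_finsetSum _ fun j _ => (continuousOn_inv_sub_right i j).pow 2).neg.add
    (continuousOn_finsetSum _ fun l _ => (continuousOn_inv_sub_cross i l).pow 2)))

theorem hasDerivAt_cmKernel_mul_log_left {N n : ℕ} (κ : ℕ) (μ : ℂ) {x : Fin N → ℂ}
    {t : Fin n → ℂ} (hx : Function.Injective x) (h : ∀ i l, t i ≠ x l) (l : Fin N) :
    HasDerivAt (fun s => cmKernel κ μ (Function.update x l s) t *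
        kernelLogX κ μ (Function.update x l s) t l)
      (cmKernel κ μ x t * kernelSndX κ μ x t l) (x l) := by
  refine ((hasDerivAt_cmKernel_left κ μ hx h l).fun_mul
    (hasDerivAt_kernelLogX κ μ hx h l)).congr_deriv ?_
  simp only [Function.update_eq_self, kernelSndX]
  ring

theorem hasDerivAt_cmKernel_mul_log_right {N n : ℕ} (κ : ℕ) (μ : ℂ) {x : Fin N → ℂ}
    {t : Fin n → ℂ} (ht : Function.Injective t) (h : ∀ i l, t i ≠ x l) (i : Fin n) :
    HasDerivAt (fun s => cmKernel κ μ x (Function.update t i s) *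
        kernelLogT κ μ x (Function.update t i s) i)
      (cmKernel κ μ x t * kernelSndT κ μ x t i) (t i) := by
  refine ((hasDerivAt_cmKernel_right κ μ ht h i).fun_mul
    (hasDerivAt_kernelLogT κ μ ht h i)).congr_deriv ?_
  simp only [Function.update_eq_self, kernelSndT]
  ring

theorem torusIntegral_finset_sum {n : ℕ} {c : Fin n → ℂ} {R : Fin n → ℝ} {ι : Type*}
    (s : Finset ι) {f : ι → (Fin n → ℂ) → ℂ} (hf : ∀ i ∈ s, TorusIntegrable (f i) c R) :
    (∯ t in T(c, R), ∑ i ∈ s, f i t) = ∑ i ∈ s, ∯ t in T(c, R), f i t := by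
  unfold torusIntegral
  simp only [Finset.smul_sum]
  exact integral_finsetSum s fun i hi => (hf i hi).function_integrable

theorem isOpen_setOf_injective_and_ne {N n : ℕ} (x : Fin N → ℂ) :
    IsOpen {t : Fin n → ℂ | Function.Injective t ∧ ∀ i l, t i ≠ x l} := by
  refine (isOpen_setOf_injective n).inter ?_
  have : {t : Fin n → ℂ | ∀ i l, t i ≠ x l} = ⋂ i : Fin n, ⋂ l : Fin N, {t | t i ≠ x l} := by
    ext t
    simp
  change IsOpen {t : Fin n → ℂ | ∀ i l, t i ≠ x l}
  rw [this]
  exact isOpen_iInter_of_finite fun i => isOpen_iInter_of_finite fun l =>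
    isOpen_ne_fun (continuous_apply i) continuous_const

/-- Integration by parts: under the torus integral, the second derivatives of the kernel in `t`
may be moved to the other factor. -/
theorem torusIntegral_integration_by_parts {N n : ℕ} (κ : ℕ) (μ : ℂ) {x : Fin N → ℂ}
    (hx : Function.Injective x) {c : Fin n → ℂ} {R : Fin n → ℝ} (hR : ∀ i, 0 ≤ R i)
    (hT : ∀ t : Fin n → ℂ, (∀ i, ‖t i - c i‖ = R i) →
      Function.Injective t ∧ ∀ i l, t i ≠ x l)
    {f : (Fin n → ℂ) → ℂ} (hf : ContDiffOn ℂ (⊤ : ℕ∞) f {t | Function.Injective t}) (i : Fin n) :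
    (∯ t in T(c, R), (cmKernel κ μ x t * kernelSndT κ μ x t i * f t -
      cmKernel κ μ x t * partialDeriv i (partialDeriv i f) t)) = 0 := by
  have hf1 := contDiffOn_partialDeriv i (isOpen_setOf_injective n) hf
  have hf2 := contDiffOn_partialDeriv i (isOpen_setOf_injective n) hf1
  set V : Set (Fin n → ℂ) := {t | Function.Injective t ∧ ∀ i l, t i ≠ x l} with hV
  have hVi : V ⊆ {t | Function.Injective t} := fun t ht => ht.1
  have hmap : Set.MapsTo (fun t : Fin n → ℂ => (x, t)) V (kernelDomain N n) :=
    fun t ht => ⟨hx, ht⟩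
  have hcont : Continuous fun t : Fin n → ℂ => (x, t) := by fun_prop
  have cK := (continuousOn_cmKernel κ μ).comp hcont.continuousOn hmap
  have cL := (continuousOn_kernelLogT κ μ i).comp hcont.continuousOn hmap
  have cS := (continuousOn_kernelSndT κ μ i).comp hcont.continuousOn hmap
  have c0 := hf.continuousOn.mono hVi
  have c1 := hf1.continuousOn.mono hVi
  have c2 := hf2.continuousOn.mono hVi
  refine torusIntegral_partialDeriv_eq_zero hR (isOpen_setOf_injective_and_ne x) (V := V)
    (fun t ht => hT t ht) i
    (f := fun t => cmKernel κ μ x t * kernelLogT κ μ x t i * f t -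
      cmKernel κ μ x t * partialDeriv i f t)
    (((cK.mul cL).mul c0).sub (cK.mul c1)) (((cK.mul cS).mul c0).sub (cK.mul c2)) ?_
  intro t ht
  have d0 : DifferentiableAt ℂ f t :=
    (hf.contDiffAt ((isOpen_setOf_injective n).mem_nhds ht.1)).differentiableAt (by simp)
  have d1 : DifferentiableAt ℂ (partialDeriv i f) t :=
    (hf1.contDiffAt ((isOpen_setOf_injective n).mem_nhds ht.1)).differentiableAt (by simp)
  have h1 := (hasDerivAt_cmKernel_mul_log_right κ μ ht.1 ht.2 i).fun_mul
    (hasDerivAt_partialDeriv i d0)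
  have h2 := (hasDerivAt_cmKernel_right κ μ ht.1 ht.2 i).fun_mul (hasDerivAt_partialDeriv i d1)
  refine (h1.fun_sub h2).congr_deriv ?_
  simp only [Function.update_eq_self]
  ring

/-- The discs of radius `r` around the coordinates of `x`, where `4 r` is smaller than all the
distances between the coordinates, are disjoint. -/
theorem exists_radius {n : ℕ} {x : Fin n → ℂ} (hx : Function.Injective x) :
    ∃ r : ℝ, 0 < r ∧ ∀ i j, i ≠ j → 4 * r < ‖x i - x j‖ := by
  have h : ∀ p : Fin n × Fin n, ∃ r : ℝ, 0 < r ∧ (p.1 ≠ p.2 → 4 * r < ‖x p.1 - x p.2‖) := by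
    intro p
    by_cases hp : p.1 = p.2
    · exact ⟨1, one_pos, fun h => absurd hp h⟩
    · have : 0 < ‖x p.1 - x p.2‖ := norm_pos_iff.2 (sub_ne_zero.2 fun h => hp (hx h))
      exact ⟨‖x p.1 - x p.2‖ / 5, by positivity, fun _ => by linarith⟩
  choose r hr hrx using h
  obtain ⟨δ, hδ, hδr⟩ : ∃ δ : ℝ, 0 < δ ∧ ∀ p, δ ≤ r p := by
    rcases isEmpty_or_nonempty (Fin n × Fin n) with he | he
    · exact ⟨1, one_pos, fun p => (he.false p).elim⟩
    · obtain ⟨p, hp⟩ := Finite.exists_min r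
      exact ⟨r p, hr p, hp⟩
  exact ⟨δ, hδ, fun i j hij => by linarith [hrx (i, j) hij, hδr (i, j)]⟩

/-- The eigenvalue equation: the kernel identity and an integration by parts transport it from
`n` to `n + 1` particles. -/
theorem sum_iteratedDeriv_psi (m n : ℕ) (x lam : Fin n → ℂ) (hx : Function.Injective x) :
    ∑ i, iteratedDeriv 2 (fun s => psi m n (Function.update x i s) lam) (x i) =
      ((m * (m + 1) : ℂ) * sumInvSq x + ∑ i, lam i ^ 2) * psi m n x lam := by
  induction n with
  | zero => simp [sumInvSq]
  | succ n ih =>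
    obtain ⟨r, hr, hrx⟩ := exists_radius hx
    set lam' : Fin n → ℂ := fun i => lam i.castSucc with hlam'
    set μ : ℂ := lam (Fin.last n) with hμ
    set c : Fin n → ℂ := fun i => x i.castSucc with hc
    set R : Fin n → ℝ := fun _ => r with hR
    set Ψ : (Fin n → ℂ) → ℂ := fun t => psi m n t lam' with hΨ
    set κ : ℕ := m + 1 with hκ
    have hR0 : ∀ i, 0 ≤ R i := fun _ => hr.le
    -- the points `y` and the rows `t` considered below stay in the discs of radius `r`
    set U : Set (Fin (n + 1) → ℂ) := {y | ∀ l, ‖y l - x l‖ < r} with hU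
    have hUo : IsOpen U := by
      have : U = ⋂ l, {y | ‖y l - x l‖ < r} := by ext y; simp [hU]
      rw [this]
      exact isOpen_iInter_of_finite fun l => isOpen_lt (by fun_prop) continuous_const
    have hxU : x ∈ U := fun l => by simpa using hr
    have hinj : ∀ y ∈ U, Function.Injective y := by
      intro y hy i j hij
      by_contra hne
      have h1 := hrx i j hne
      have h2 : x i - x j = (y j - x j) - (y i - x i) := by rw [hij]; ring
      have h3 := norm_sub_le (y j - x j) (y i - x i)
      rw [← h2] at h3
      linarith [hy i, hy j]
    have hsepU : ∀ y ∈ U, ∀ t : Fin n → ℂ, (∀ i, ‖t i - c i‖ ≤ R i) →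
        Function.Injective t ∧ ∀ i l, l ≠ i.castSucc → t i ≠ y l := by
      intro y hy t ht
      refine ⟨fun i j hij => ?_, fun i l hl h => ?_⟩
      · by_contra hne
        have h1 := hrx i.castSucc j.castSucc fun h => hne (Fin.castSucc_injective n h)
        have h2 : x i.castSucc - x j.castSucc = (t j - c j) - (t i - c i) := by
          rw [hij]; simp [hc]
        have h3 := norm_sub_le (t j - c j) (t i - c i)
        rw [← h2] at h3
        linarith [ht i, ht j, show R i = r from rfl, show R j = r from rfl]
      · have h1 := hrx i.castSucc l (Ne.symm hl)
        have h2 : x i.castSucc - x l = (y l - x l) - (t i - c i) := by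
          rw [h]; simp [hc]
        have h3 := norm_sub_le (y l - x l) (t i - c i)
        rw [← h2] at h3
        linarith [ht i, hy l, show R i = r from rfl]
    have hne : ∀ y ∈ U, ∀ t : Fin n → ℂ, (∀ i, ‖t i - c i‖ = R i) →
        Function.Injective t ∧ ∀ i l, t i ≠ y l := by
      intro y hy t ht
      have h1 := hsepU y hy t fun i => (ht i).le
      refine ⟨h1.1, fun i l => ?_⟩
      by_cases hl : l = i.castSucc
      · subst hl
        intro h
        have := hy i.castSucc
        rw [← h] at this
        exact this.ne (ht i)
      · exact h1.2 i l hl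
    have hdom : ∀ y ∈ U, ∀ t : Fin n → ℂ, (∀ i, ‖t i - c i‖ = R i) →
        (y, t) ∈ kernelDomain (n + 1) n := fun y hy t ht => ⟨hinj y hy, hne y hy t ht⟩
    have hΨs : ContDiffOn ℂ (⊤ : ℕ∞) Ψ {t | Function.Injective t} := contDiffOn_psi m n lam'
    -- the row integral near `x`
    set C : ℂ := (2 * Real.pi * Complex.I / m.factorial) ^ n * (-1) ^ ((m + 1) * n.choose 2)
      with hC
    have hC0 : C ≠ 0 := by
      refine mul_ne_zero (pow_ne_zero _ (div_ne_zero ?_ ?_)) (pow_ne_zero _ (by norm_num))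
      · exact Complex.two_pi_I_ne_zero
      · exact_mod_cast m.factorial_ne_zero
    have hrow : ∀ y ∈ U, (∯ t in T(c, R), cmKernel κ μ y t * Ψ t) = C * psi m (n + 1) y lam :=
      fun y hy => torusIntegral_cmKernel_mul_psi lam (hinj y hy) (fun i => hy i.castSucc)
        (hsepU y hy)
    have hderiv : ∀ (l : Fin (n + 1)) (g g' : (Fin (n + 1) → ℂ) → (Fin n → ℂ) → ℂ),
        ContinuousOn (fun p : (Fin (n + 1) → ℂ) × (Fin n → ℂ) => g p.1 p.2)
          (kernelDomain (n + 1) n) →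
        ContinuousOn (fun p : (Fin (n + 1) → ℂ) × (Fin n → ℂ) => g' p.1 p.2)
          (kernelDomain (n + 1) n) →
        (∀ y t, Function.Injective y → (∀ i l, t i ≠ y l) →
          HasDerivAt (fun s => g (Function.update y l s) t) (g' y t) (y l)) →
        ∀ y ∈ U, HasDerivAt (fun s => ∯ t in T(c, R), g (Function.update y l s) t * Ψ t)
          (∯ t in T(c, R), g' y t * Ψ t) (y l) := by
      intro l g g' hg hg' hd y hy
      have hup : Continuous fun s => Function.update y l s := by fun_prop
      have := hasDerivAt_torusIntegral (c := c) hR0 (U := {s | Function.update y l s ∈ U})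
        (hUo.preimage hup) (f := fun s t => g (Function.update y l s) t * Ψ t)
        (f' := fun s t => g' (Function.update y l s) t * Ψ t) (s₀ := y l) ?_ ?_ ?_
        (by simpa using hy)
      · simpa using this
      · intro s hs
        refine ContinuousOn.mul ?_ (hΨs.continuousOn.mono fun t ht => (hne _ hs t ht).1)
        exact hg.comp (f := fun t => (Function.update y l s, t)) (by fun_prop)
          fun t ht => hdom _ hs t ht
      · refine ContinuousOn.mul ?_ (hΨs.continuousOn.comp continuousOn_snd
          fun p hp => (hne _ hp.1 p.2 hp.2).1)
        exact hg'.comp (f := fun p : ℂ × (Fin n → ℂ) => (Function.update y l p.1, p.2))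
          (Continuous.continuousOn (by fun_prop)) fun p hp => hdom _ hp.1 p.2 hp.2
      · intro s hs t ht
        have := hd (Function.update y l s) t (hinj _ hs) (hne _ hs t ht).2
        simpa using this.mul_const (Ψ t)
    have hX : ∀ l, iteratedDeriv 2 (fun s => psi m (n + 1) (Function.update x l s) lam) (x l) =
        C⁻¹ * ∯ t in T(c, R), cmKernel κ μ x t * kernelSndX κ μ x t l * Ψ t := by
      intro l
      have h1 := hderiv l (cmKernel κ μ) (fun y t => cmKernel κ μ y t * kernelLogX κ μ y t l)
        (continuousOn_cmKernel κ μ)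
        ((continuousOn_cmKernel κ μ).mul (continuousOn_kernelLogX κ μ l))
        (fun y t hy ht => hasDerivAt_cmKernel_left κ μ hy ht l)
      have h2 := hderiv l (fun y t => cmKernel κ μ y t * kernelLogX κ μ y t l)
        (fun y t => cmKernel κ μ y t * kernelSndX κ μ y t l)
        ((continuousOn_cmKernel κ μ).mul (continuousOn_kernelLogX κ μ l))
        ((continuousOn_cmKernel κ μ).mul (continuousOn_kernelSndX κ μ l))
        (fun y t hy ht => hasDerivAt_cmKernel_mul_log_left κ μ hy ht l)
      refine iteratedDeriv_two_update hUo (l := l) (f := fun y => psi m (n + 1) y lam)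
        (f₁ := fun y => C⁻¹ * ∯ t in T(c, R), cmKernel κ μ y t * kernelLogX κ μ y t l * Ψ t)
        (f₂ := fun y => C⁻¹ * ∯ t in T(c, R), cmKernel κ μ y t * kernelSndX κ μ y t l * Ψ t)
        (fun y hy => ?_) (fun y hy => (h2 y hy).const_mul C⁻¹) hxU
      refine ((h1 y hy).const_mul C⁻¹).congr_of_eventuallyEq ?_
      have hup : Continuous fun s => Function.update y l s := by fun_prop
      have : ∀ᶠ s in nhds (y l), Function.update y l s ∈ U :=
        hup.continuousAt.eventually_mem (by simpa using hUo.mem_nhds hy)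
      filter_upwards [this] with s hs
      rw [hrow _ hs, inv_mul_cancel_left₀ hC0]
    have hparts := torusIntegral_integration_by_parts κ μ hx hR0 (hne x hxU) hΨs
    have hΨ1 := fun i => contDiffOn_partialDeriv i (isOpen_setOf_injective n) hΨs
    have hΨ2 := fun i => contDiffOn_partialDeriv i (isOpen_setOf_injective n) (hΨ1 i)
    -- the equation for `n` particles
    have hLap : ∀ t : Fin n → ℂ, Function.Injective t →
        ∑ i, partialDeriv i (partialDeriv i Ψ) t =
          ((m * (m + 1) : ℂ) * sumInvSq t + ∑ i, lam' i ^ 2) * Ψ t := by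
      intro t ht
      rw [← ih t lam' ht]
      refine Finset.sum_congr rfl fun i _ => ?_
      refine (iteratedDeriv_two_update (isOpen_setOf_injective n) (f := Ψ)
        (fun y hy => hasDerivAt_partialDeriv i ?_) (fun y hy => hasDerivAt_partialDeriv i ?_)
        ht).symm
      · exact (hΨs.contDiffAt ((isOpen_setOf_injective n).mem_nhds hy)).differentiableAt (by simp)
      · exact ((hΨ1 i).contDiffAt
          ((isOpen_setOf_injective n).mem_nhds hy)).differentiableAt (by simp)
    have hpt : ∀ t : Fin n → ℂ, (∀ i, ‖t i - c i‖ = R i) →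
        ∑ l, cmKernel κ μ x t * kernelSndX κ μ x t l * Ψ t =
          (∑ i, (cmKernel κ μ x t * kernelSndT κ μ x t i * Ψ t -
            cmKernel κ μ x t * partialDeriv i (partialDeriv i Ψ) t)) +
          ((m * (m + 1) : ℂ) * sumInvSq x + ∑ i, lam i ^ 2) * (cmKernel κ μ x t * Ψ t) := by
      intro t ht
      have ht' := hne x hxU t ht
      have h1 := cmKernel_identity κ μ hx ht'.1 ht'.2
      have h2 := hLap t ht'.1
      have hl : ∑ i, lam i ^ 2 = ∑ i, lam' i ^ 2 + μ ^ 2 := Fin.sum_univ_castSucc _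
      simp only [← kernelSndX.eq_1, ← kernelSndT.eq_1] at h1
      rw [← Finset.sum_mul, ← Finset.mul_sum, Finset.sum_sub_distrib, ← Finset.sum_mul,
        ← Finset.mul_sum, ← Finset.mul_sum, h2, hl]
      simp only [hκ] at h1 ⊢
      push_cast at h1
      linear_combination (cmKernel (m + 1) μ x t * Ψ t) * h1
    have hmap : Set.MapsTo (fun t : Fin n → ℂ => (x, t)) {t | ∀ i, ‖t i - c i‖ = R i}
        (kernelDomain (n + 1) n) := fun t ht => hdom x hxU t ht
    have hcont : Continuous fun t : Fin n → ℂ => (x, t) := by fun_prop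
    have hsub : {t : Fin n → ℂ | ∀ i, ‖t i - c i‖ = R i} ⊆ {t | Function.Injective t} :=
      fun t ht => (hne x hxU t ht).1
    have cK := (continuousOn_cmKernel κ μ).comp hcont.continuousOn hmap
    have cX := fun l => (continuousOn_kernelSndX κ μ l).comp hcont.continuousOn hmap
    have cT := fun i => (continuousOn_kernelSndT κ μ i).comp hcont.continuousOn hmap
    have c0 := hΨs.continuousOn.mono hsub
    have c2 := fun i => (hΨ2 i).continuousOn.mono hsub
    have hZ := fun i => ((cK.mul (cT i)).mul c0).sub (cK.mul (c2 i))
    simp only [hX]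
    rw [← Finset.mul_sum, ← torusIntegral_finset_sum]
    swap
    · exact fun l _ => torusIntegrable_of_continuousOn hR0 ((cK.mul (cX l)).mul c0)
    rw [torusIntegral_congr hR0 hpt, torusIntegral_add
      (f := fun t => ∑ i, (cmKernel κ μ x t * kernelSndT κ μ x t i * Ψ t -
            cmKernel κ μ x t * partialDeriv i (partialDeriv i Ψ) t)), torusIntegral_finset_sum]
    · simp only [hparts, Finset.sum_const_zero, zero_add]
      rw [torusIntegral_const_mul, hrow x hxU]
      field_simp
    · exact fun i _ => torusIntegrable_of_continuousOn hR0 (hZ i)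
    · exact torusIntegrable_of_continuousOn hR0 (continuousOn_finsetSum _ fun i _ => hZ i)
    · exact torusIntegrable_of_continuousOn hR0 (continuousOn_const.mul (cK.mul c0))

/-! ### The iterated residue formula -/

/-- Fubini's theorem for integrals over products of circles. -/
theorem circlesIntegral_sum_equiv {ι κ τ : Type*} [Fintype ι] [Fintype κ] [Fintype τ]
    (e : κ ⊕ ι ≃ τ) (f : (τ → ℂ) → ℂ) (c : τ → ℂ) (R : τ → ℝ)
    (hint : IntegrableOn (torusPullback f c R) (Set.Icc (0 : τ → ℝ) fun _ => 2 * Real.pi)) :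
    circlesIntegral f c R =
      circlesIntegral (fun y : κ → ℂ => circlesIntegral
        (fun t : ι → ℂ => f (fun p => Sum.elim y t (e.symm p)))
        (fun i => c (e (Sum.inr i))) (fun i => R (e (Sum.inr i))))
        (fun i => c (e (Sum.inl i))) (fun i => R (e (Sum.inl i))) := by
  set E : (κ → ℝ) × (ι → ℝ) ≃ᵐ (τ → ℝ) :=
    (MeasurableEquiv.sumPiEquivProdPi fun _ : κ ⊕ ι => ℝ).symm.trans
      (MeasurableEquiv.piCongrLeft (fun _ : τ => ℝ) e) with hE
  have hEm : MeasurePreserving E :=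
    (volume_measurePreserving_sumPiEquivProdPi_symm fun _ : κ ⊕ ι => ℝ).trans
      (volume_measurePreserving_piCongrLeft (fun _ : τ => ℝ) e)
  have hEl : ∀ a b i, E (a, b) (e (Sum.inl i)) = a i := fun a b i =>
    Equiv.piCongrLeft_sumInl (fun _ : τ => ℝ) e a b i
  have hEr : ∀ a b i, E (a, b) (e (Sum.inr i)) = b i := fun a b i =>
    Equiv.piCongrLeft_sumInr (fun _ : τ => ℝ) e a b i
  have hpre : E ⁻¹' (Set.Icc (0 : τ → ℝ) fun _ => 2 * Real.pi) =
      (Set.Icc (0 : κ → ℝ) fun _ => 2 * Real.pi) ×ˢ (Set.Icc (0 : ι → ℝ) fun _ => 2 * Real.pi) := by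
    ext ⟨a, b⟩
    simp only [Set.mem_preimage, Set.mem_Icc, Pi.le_def, Set.mem_prod, ← e.forall_congr_right,
      Sum.forall, hEl, hEr, Pi.zero_apply]
    tauto
  unfold circlesIntegral
  rw [← hEm.setIntegral_preimage_emb E.measurableEmbedding, hpre, Measure.volume_eq_prod,
    setIntegral_prod]
  · refine integral_congr_ae (Filter.Eventually.of_forall fun a => ?_)
    simp only [torusPullback]
    rw [← integral_const_mul]
    refine integral_congr_ae (Filter.Eventually.of_forall fun b => ?_)
    simp only
    rw [← e.prod_comp, Fintype.prod_sum_type, mul_assoc]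
    simp only [hEl, hEr]
    congr 3
    ext p
    obtain ⟨q, rfl⟩ := e.surjective p
    rcases q with i | i
    · simp [hEl]
    · simp [hEr]
  · have := (hEm.integrableOn_comp_preimage E.measurableEmbedding).2 hint
    rwa [hpre] at this

/-- The row `k + 1` together with the triangle of the first `k` rows. -/
noncomputable def triEquiv (k : ℕ) : Fin (k + 1) ⊕ TriIndex (k + 1) ≃ TriIndex (k + 2) :=
  Equiv.ofBijective
    (Sum.elim (fun i => ⟨Fin.last k, i⟩) fun p => ⟨Fin.castSucc p.1, p.2⟩) (by
      constructor
      · rintro (i | ⟨p, i⟩) (j | ⟨q, j⟩) h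
        · simpa using h
        · have := congrArg (fun z : TriIndex (k + 2) => z.1.val) h
          simp only [Sum.elim_inl, Sum.elim_inr, Fin.val_last, Fin.val_castSucc] at this
          have := q.2
          omega
        · have := congrArg (fun z : TriIndex (k + 2) => z.1.val) h
          simp only [Sum.elim_inl, Sum.elim_inr, Fin.val_last, Fin.val_castSucc] at this
          have := p.2
          omega
        · have h1 := congrArg (fun z : TriIndex (k + 2) => z.1.val) h
          have h2 : p = q := Fin.ext h1
          subst h2
          simpa using h
      · rintro ⟨p, i⟩
        by_cases hp : p.val < k
        · exact ⟨Sum.inr ⟨⟨p.val, hp⟩, i⟩, rfl⟩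
        · have h : p = Fin.last k := by
            have := p.2
            ext
            simp only [Fin.val_last]
            omega
          subst h
          exact ⟨Sum.inl i, rfl⟩)

theorem rowVar_of_lt {n : ℕ} (x : Fin n → ℂ) (t : TriIndex n → ℂ) {j : Fin n} (h : j.val < n - 1)
    (l : Fin (j.val + 1)) : rowVar x t j l = t ⟨⟨j.val, h⟩, l⟩ := dif_pos h

theorem rowVar_of_not_lt {n : ℕ} (x : Fin n → ℂ) (t : TriIndex n → ℂ) {j : Fin n}
    (h : ¬ j.val < n - 1) (l : Fin (j.val + 1)) :
    rowVar x t j l = x (Fin.castLE (by omega) l) := dif_neg h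

/-- The factors of the density which involve the last row `y`, split off from the density for the
rows above it. -/
theorem omegaDensity_succ {k m : ℕ} (x lam : Fin (k + 2) → ℂ) (t : TriIndex (k + 2) → ℂ)
    (y : Fin (k + 1) → ℂ) (T : TriIndex (k + 1) → ℂ)
    (hy : ∀ i, t (triEquiv k (Sum.inl i)) = y i) (hT : ∀ p, t (triEquiv k (Sum.inr p)) = T p) :
    omegaDensity m x lam t =
      (crossProd x y)⁻¹ ^ (m + 1) * prodDiff y ^ (2 + 2 * m) *
        Complex.exp ((lam (Fin.last k).castSucc - lam (Fin.last (k + 1))) * ∑ i, y i) *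
        omegaDensity m y (fun i => lam i.castSucc) T := by
  have key : ∀ (j : Fin (k + 1)) (l : Fin (j.val + 1)), j = Fin.last k →
      t ⟨j, l⟩ = y (Fin.castLE (by omega) l) := by
    rintro j l rfl
    exact hy l
  have h1 : ∏ p : TriIndex (k + 2), ∏ l : Fin (p.1.val + 2),
      (t p - rowVar x t ⟨p.1.val + 1, by omega⟩ l) ^ (-(m : ℤ) - 1) =
      (crossProd x y)⁻¹ ^ (m + 1) * ∏ p : TriIndex (k + 1), ∏ l : Fin (p.1.val + 2),
        (T p - rowVar y T ⟨p.1.val + 1, by omega⟩ l) ^ (-(m : ℤ) - 1) := by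
    rw [← (triEquiv k).prod_comp, Fintype.prod_sum_type]
    congr 1
    · unfold crossProd
      rw [← Finset.prod_inv_distrib, ← Finset.prod_pow]
      refine Finset.prod_congr rfl fun i _ => ?_
      rw [← Finset.prod_inv_distrib, ← Finset.prod_pow]
      refine Finset.prod_congr rfl fun l _ => ?_
      rw [hy, show -(m : ℤ) - 1 = -((m + 1 : ℕ) : ℤ) by push_cast; ring, zpow_neg, zpow_natCast,
        inv_pow]
      rw [rowVar_of_not_lt]
      · rfl
      · change ¬ (k + 1 < k + 1)
        omega
    · refine Finset.prod_congr rfl fun p _ => Finset.prod_congr rfl fun l _ => ?_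
      rw [hT]
      congr 2
      have hp : p.1.val + 1 < k + 2 - 1 := by omega
      refine (rowVar_of_lt x t (j := ⟨p.1.val + 1, by omega⟩) hp l).trans ?_
      by_cases h : p.1.val + 1 < k
      · rw [rowVar_of_lt y T (j := ⟨p.1.val + 1, by omega⟩) h l]
        exact hT ⟨⟨p.1.val + 1, h⟩, l⟩
      · rw [rowVar_of_not_lt y T (j := ⟨p.1.val + 1, by omega⟩) h l]
        refine key ⟨p.1.val + 1, hp⟩ l (Fin.ext ?_)
        have := p.1.2
        simp only [Fin.val_last]
        omega
  have h2 : ∏ j : Fin (k + 1), ∏ i : Fin (j.val + 1), ∏ l ∈ Finset.Ioi i,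
      (t ⟨j, i⟩ - t ⟨j, l⟩) ^ (2 + 2 * m) =
      prodDiff y ^ (2 + 2 * m) * ∏ j : Fin k, ∏ i : Fin (j.val + 1), ∏ l ∈ Finset.Ioi i,
        (T ⟨j, i⟩ - T ⟨j, l⟩) ^ (2 + 2 * m) := by
    rw [Fin.prod_univ_castSucc, mul_comm]
    congr 1
    · unfold prodDiff
      rw [← Finset.prod_pow]
      refine Finset.prod_congr rfl fun i _ => ?_
      rw [← Finset.prod_pow]
      exact Finset.prod_congr rfl fun l _ => by rw [← hy, ← hy]; rfl
    · refine Finset.prod_congr rfl fun j _ => Finset.prod_congr rfl fun i _ =>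
        Finset.prod_congr rfl fun l _ => ?_
      rw [← hT, ← hT]
      rfl
  have h3 : ∏ p : TriIndex (k + 2), Complex.exp
      ((lam ⟨p.1.val, by omega⟩ - lam ⟨p.1.val + 1, by omega⟩) * t p) =
      Complex.exp ((lam (Fin.last k).castSucc - lam (Fin.last (k + 1))) * ∑ i, y i) *
      ∏ p : TriIndex (k + 1), Complex.exp
        ((lam (Fin.castSucc ⟨p.1.val, by omega⟩) - lam (Fin.castSucc ⟨p.1.val + 1, by omega⟩)) *
          T p) := by
    rw [← (triEquiv k).prod_comp, Fintype.prod_sum_type, Finset.mul_sum, Complex.exp_sum]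
    congr 1
    · exact Finset.prod_congr rfl fun i _ => by rw [hy]; rfl
    · exact Finset.prod_congr rfl fun p _ => by rw [hT]; rfl
  unfold omegaDensity
  rw [h1, h3]
  refine (congrArg (fun z => _ * z * _) h2).trans ?_
  have hr : ∀ a b c d e f : ℂ, a * b * (c * d) * (e * f) = a * c * e * (b * d * f) := by
    intros
    ring
  exact hr _ _ _ _ _ _

/-- The cycle of integration for the function of `x`, with centres `c` and radii `ρ j` depending
on the row: the radii decrease towards the last row, the circles in different columns are
separated, and the coordinates of `x` lie inside the smallest circles. -/
structure IsNestedCycle {n : ℕ} (c x : Fin n → ℂ) (ρ : ℕ → ℝ) : Prop where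
  strictAnti : StrictAnti ρ
  sep : ∀ i j, i ≠ j → 2 * ρ 0 < ‖c i - c j‖
  lt : ∀ j < n - 1, ∀ i, ‖x i - c i‖ < ρ j

namespace IsNestedCycle

variable {n : ℕ} {c x : Fin n → ℂ} {ρ : ℕ → ℝ}

theorem pos (h : IsNestedCycle c x ρ) (p : TriIndex n) : 0 < ρ p.1.val :=
  (norm_nonneg _).trans_lt (h.lt _ p.1.2 ⟨p.1.val, by omega⟩)

/-- The density has no poles on the cycle: within a column the radii of consecutive rows differ,
and different columns are separated. -/
theorem sub_rowVar_ne_zero (h : IsNestedCycle c x ρ) {t : TriIndex n → ℂ}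
    (ht : ∀ p, ‖t p - cycleCenter c p‖ = ρ p.1.val) (p : TriIndex n) (l : Fin (p.1.val + 2)) :
    t p - rowVar x t ⟨p.1.val + 1, by omega⟩ l ≠ 0 := by
  set u := rowVar x t ⟨p.1.val + 1, by omega⟩ l with hu
  have hul : ‖u - c (Fin.castLE (by omega) l)‖ < ρ p.1.val := by
    by_cases hp : p.1.val + 1 < n - 1
    · rw [hu, rowVar_of_lt x t (j := ⟨p.1.val + 1, by omega⟩) hp l]
      refine lt_of_eq_of_lt (ht ⟨⟨p.1.val + 1, hp⟩, l⟩) ?_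
      exact h.strictAnti (Nat.lt_succ_self _)
    · rw [hu, rowVar_of_not_lt x t (j := ⟨p.1.val + 1, by omega⟩) hp l]
      exact h.lt _ p.1.2 _
  intro he
  rw [sub_eq_zero] at he
  have htp := ht p
  unfold cycleCenter at htp
  by_cases hl : (Fin.castLE (by omega) l : Fin n) = Fin.castLE (by omega) p.2
  · rw [hl, ← he] at hul
    exact hul.ne htp
  · have h1 := h.sep _ _ hl
    have h2 : c (Fin.castLE (by omega) l) - c (Fin.castLE (by omega) p.2) =
        (t p - c (Fin.castLE (by omega) p.2)) - (u - c (Fin.castLE (by omega) l)) := by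
      rw [he]; ring
    have h3 := norm_sub_le (t p - c (Fin.castLE (by omega) p.2))
      (u - c (Fin.castLE (by omega) l))
    rw [← h2] at h3
    have h4 := h.strictAnti.antitone (Nat.zero_le p.1.val)
    linarith

theorem integrableOn (h : IsNestedCycle c x ρ) (m : ℕ) (lam : Fin n → ℂ) :
    IntegrableOn (torusPullback (omegaDensity m x lam) (cycleCenter c) fun p => ρ p.1.val)
      (Set.Icc (0 : TriIndex n → ℝ) fun _ => 2 * Real.pi) := by
  refine Continuous.integrableOn_Icc ?_
  set τ : (TriIndex n → ℝ) → TriIndex n → ℂ := fun θ p =>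
    cycleCenter c p + (ρ p.1.val : ℝ) * Complex.exp (θ p * Complex.I) with hτ
  have hτc : Continuous τ := by fun_prop
  have hτp : ∀ p, Continuous fun θ => τ θ p := fun p => (continuous_apply p).comp hτc
  have hmem : ∀ θ p, ‖τ θ p - cycleCenter c p‖ = ρ p.1.val := fun θ p => by
    simp [hτ, Complex.norm_exp_ofReal_mul_I, abs_of_nonneg (h.pos p).le]
  have hrow : ∀ j l, Continuous fun θ => rowVar x (τ θ) j l := by
    intro j l
    by_cases hj : j.val < n - 1
    · simp only [rowVar_of_lt x _ hj]
      exact hτp _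
    · simp only [rowVar_of_not_lt x _ hj]
      exact continuous_const
  change Continuous fun θ => (∏ p : TriIndex n, ((ρ p.1.val : ℂ) *
    Complex.exp (θ p * Complex.I) * Complex.I)) * omegaDensity m x lam (τ θ)
  refine Continuous.mul (by fun_prop) ?_
  unfold omegaDensity
  refine ((continuous_finsetProd _ fun p _ => continuous_finsetProd _ fun l _ => ?_).mul
    (continuous_finsetProd _ fun j _ => continuous_finsetProd _ fun i _ =>
      continuous_finsetProd _ fun l _ => ?_)).mul (continuous_finsetProd _ fun p _ => ?_)
  · exact ((hτp p).fun_sub (hrow ⟨p.1.val + 1, by omega⟩ l)).zpow₀ _ fun θ =>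
      Or.inl (h.sub_rowVar_ne_zero (hmem θ) p l)
  · exact ((hτp _).sub (hτp _)).pow _
  · exact (continuous_const.mul (hτp p)).cexp

end IsNestedCycle

/-- The iterated residue formula for `psi`. The last row is split off: for a fixed value `y` of
this row, the other rows form the integral for `y` in place of `x`. The centres `c` are not tied
to `x`, as they stay fixed while `y` moves on its circles. -/
theorem circlesIntegral_omegaDensity (m k : ℕ) (c x lam : Fin (k + 1) → ℂ) (ρ : ℕ → ℝ)
    (h : IsNestedCycle c x ρ) (hx : Function.Injective x) :
    prodDiff x ^ (m + 1) * Complex.exp (lam (Fin.last k) * ∑ i, x i) *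
      circlesIntegral (omegaDensity m x lam) (cycleCenter c) (fun p => ρ p.1.val) =
    (-1) ^ ((m + 1) * (k + 1).choose 3) *
      (2 * Real.pi * Complex.I / m.factorial) ^ (k + 1).choose 2 * psi m (k + 1) x lam := by
  induction k with
  | zero =>
    have h1 := torusIntegral_cmKernel_mul_psi (m := m) (n := 0) lam hx
      (c := fun _ => 0) (R := fun _ => 0) (fun i => i.elim0)
      (fun t _ => ⟨fun i => i.elim0, fun i => i.elim0⟩)
    have hI : IsEmpty (TriIndex (0 + 1)) := inferInstanceAs (IsEmpty ((j : Fin 0) × _))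
    have h2 : circlesIntegral (omegaDensity m x lam) (cycleCenter c) (fun p => ρ p.1.val) = 1 := by
      have hv : (volume.restrict (Set.Icc (0 : TriIndex (0 + 1) → ℝ)
          fun _ => 2 * Real.pi)).real Set.univ = 1 := by
        simp [Measure.real, Real.volume_Icc_pi]
      have ho : ∀ t : TriIndex (0 + 1) → ℂ, omegaDensity m x lam t = 1 := by
        intro t
        unfold omegaDensity
        rw [Finset.univ_eq_empty (α := TriIndex (0 + 1))]
        simp
      unfold circlesIntegral
      rw [integral_unique, hv, torusPullback, ho]
      simp
    rw [torusIntegral_dim0] at h1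
    rw [h2]
    simp only [zero_add] at h1 ⊢
    rw [show (1 : ℕ).choose 3 = 0 from rfl, show (1 : ℕ).choose 2 = 0 from rfl]
    rw [show (0 : ℕ).choose 2 = 0 from rfl] at h1
    simp only [mul_zero, pow_zero, one_mul, mul_one] at h1 ⊢
    rw [← h1]
    simp [cmKernel, psi, numer, crossProd, prodDiff]
  | succ k ih =>
    have hk : 0 < ρ k := (norm_nonneg _).trans_lt (h.lt k (by omega) 0)
    have hk0 : ρ k ≤ ρ 0 := h.strictAnti.antitone (Nat.zero_le k)
    set c' : Fin (k + 1) → ℂ := fun i => c i.castSucc with hc'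
    have hsep : ∀ y : Fin (k + 1) → ℂ, (∀ i, ‖y i - c' i‖ ≤ ρ k) →
        Function.Injective y ∧ ∀ i l, l ≠ i.castSucc → y i ≠ x l := by
      intro y hy
      refine ⟨fun i j hij => ?_, fun i l hl he => ?_⟩
      · by_contra hne
        have h1 := h.sep i.castSucc j.castSucc fun h => hne (Fin.castSucc_injective _ h)
        have h2 : c i.castSucc - c j.castSucc = (y j - c' j) - (y i - c' i) := by
          rw [hij]; simp [hc']
        have h3 := norm_sub_le (y j - c' j) (y i - c' i)
        rw [← h2] at h3
        linarith [hy i, hy j]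
      · have h1 := h.sep i.castSucc l (Ne.symm hl)
        have h2 : c i.castSucc - c l = (x l - c l) - (y i - c' i) := by
          rw [he]; simp [hc']
        have h3 := norm_sub_le (x l - c l) (y i - c' i)
        rw [← h2] at h3
        linarith [hy i, h.lt k (by omega) l]
    have hnest : ∀ y : Fin (k + 1) → ℂ, (∀ i, ‖y i - c' i‖ = ρ k) → IsNestedCycle c' y ρ :=
      fun y hy => ⟨h.strictAnti, fun i j hij => h.sep _ _ fun h => hij (Fin.castSucc_injective _ h),
        fun j hj i => (hy i).trans_lt (h.strictAnti (by omega))⟩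
    set S : ℂ := (-1) ^ ((m + 1) * (k + 1).choose 3) *
      (2 * Real.pi * Complex.I / m.factorial) ^ (k + 1).choose 2 with hS
    rw [circlesIntegral_sum_equiv (triEquiv k) _ _ _ (h.integrableOn m lam),
      circlesIntegral_eq_torusIntegral, ← torusIntegral_const_mul]
    have hpt : ∀ y : Fin (k + 1) → ℂ, (∀ i, ‖y i - c' i‖ = ρ k) →
        prodDiff x ^ (m + 1) * Complex.exp (lam (Fin.last (k + 1)) * ∑ i, x i) *
          circlesIntegral (fun t : TriIndex (k + 1) → ℂ =>
              omegaDensity m x lam fun p => Sum.elim y t ((triEquiv k).symm p))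
            (fun i => cycleCenter c (triEquiv k (Sum.inr i)))
            (fun i => ρ (triEquiv k (Sum.inr i)).1.val) =
        S * (cmKernel (m + 1) (lam (Fin.last (k + 1))) x y *
          psi m (k + 1) y fun i => lam i.castSucc) := by
      intro y hy
      have h1 := ih c' y (fun i => lam i.castSucc) (hnest y hy) (hsep y fun i => (hy i).le).1
      have h2 : ∀ t : TriIndex (k + 1) → ℂ, omegaDensity m x lam
          (fun p => Sum.elim y t ((triEquiv k).symm p)) = _ := fun t =>
        omegaDensity_succ (m := m) x lam _ y t (fun i => by simp) (fun p => by simp)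
      have h3 : ∀ (a : ℂ) (f : (TriIndex (k + 1) → ℂ) → ℂ) (c : TriIndex (k + 1) → ℂ)
          (R : TriIndex (k + 1) → ℝ),
          circlesIntegral (fun t => a * f t) c R = a * circlesIntegral f c R := by
        intro a f c R
        unfold circlesIntegral torusPullback
        rw [← integral_const_mul]
        congr 1
        ext θ
        ring
      simp only [h2]
      rw [h3]
      change _ * (_ * circlesIntegral (omegaDensity m y fun i => lam i.castSucc) (cycleCenter c')
        fun p => ρ p.1.val) = _
      have hE : Complex.exp (lam (Fin.last (k + 1)) * ∑ i, x i) *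
          Complex.exp ((lam (Fin.last k).castSucc - lam (Fin.last (k + 1))) * ∑ i, y i) =
          Complex.exp (lam (Fin.last k).castSucc * ∑ i, y i) *
            Complex.exp (lam (Fin.last (k + 1)) * (∑ i, x i - ∑ i, y i)) := by
        rw [← Complex.exp_add, ← Complex.exp_add]
        congr 1
        ring
      rw [cmKernel]
      linear_combination (prodDiff x ^ (m + 1) * (crossProd x y)⁻¹ ^ (m + 1) *
        prodDiff y ^ (2 + 2 * m) * circlesIntegral (omegaDensity m y fun i => lam i.castSucc)
          (cycleCenter c') fun p => ρ p.1.val) * hE +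
        (prodDiff x ^ (m + 1) * prodDiff y ^ (m + 1) * (crossProd x y)⁻¹ ^ (m + 1) *
          Complex.exp (lam (Fin.last (k + 1)) * (∑ i, x i - ∑ i, y i))) * h1
    refine (torusIntegral_congr (fun _ => hk.le) hpt).trans ?_
    have hrow := torusIntegral_cmKernel_mul_psi (m := m) lam hx (c := c') (R := fun _ => ρ k)
      (fun i => h.lt k (by omega) i.castSucc) hsep
    refine (torusIntegral_const_mul _ _ _ _).trans ((congrArg (fun z => S * z) hrow).trans ?_)
    rw [hS, Nat.choose_succ_succ' (k + 1) 2, Nat.choose_succ_succ' (k + 1) 1, Nat.choose_one_right]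
    ring

/-! ### The Schrödinger equation for polynomial numerators -/

/-- The polynomial `A(x)`. -/
noncomputable def xDiff (n : ℕ) : XLPoly n := prodDiff fun i => MvPolynomial.X (Sum.inl i)

/-- The polynomial `A(λ)`. -/
noncomputable def lamDiff (n : ℕ) : XLPoly n := prodDiff fun i => MvPolynomial.X (Sum.inr i)

theorem eval_xDiff {n : ℕ} (x lam : Fin n → ℂ) :
    MvPolynomial.eval (Sum.elim x lam) (xDiff n) = prodDiff x := by
  simp [xDiff, map_prodDiff]

theorem eval_lamDiff {n : ℕ} (x lam : Fin n → ℂ) :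
    MvPolynomial.eval (Sum.elim x lam) (lamDiff n) = prodDiff lam := by
  simp [lamDiff, map_prodDiff]

theorem xDiff_ne_zero (n : ℕ) : xDiff n ≠ 0 :=
  prodDiff_ne_zero (MvPolynomial.X_injective.comp Sum.inl_injective)

theorem lamDiff_ne_zero (n : ℕ) : lamDiff n ≠ 0 :=
  prodDiff_ne_zero (MvPolynomial.X_injective.comp Sum.inr_injective)

theorem injective_of_prodDiff_ne_zero {n : ℕ} {x : Fin n → ℂ} (h : prodDiff x ≠ 0) :
    Function.Injective x := by
  intro i j hij
  by_contra hne
  refine h ?_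
  rcases lt_or_gt_of_ne hne with hlt | hlt
  · exact Finset.prod_eq_zero (Finset.mem_univ i)
      (Finset.prod_eq_zero (Finset.mem_Ioi.2 hlt) (sub_eq_zero.2 hij))
  · exact Finset.prod_eq_zero (Finset.mem_univ j)
      (Finset.prod_eq_zero (Finset.mem_Ioi.2 hlt) (sub_eq_zero.2 hij.symm))

theorem eq_zero_of_eval_eq_zero {n : ℕ} {p : XLPoly n}
    (h : ∀ x lam : Fin n → ℂ, Function.Injective x → Function.Injective lam →
      MvPolynomial.eval (Sum.elim x lam) p = 0) : p = 0 := by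
  have : p * (xDiff n * lamDiff n) = 0 := by
    refine MvPolynomial.funext fun y => ?_
    rw [← Sum.elim_comp_inl_inr y, map_mul, map_mul, eval_xDiff, eval_lamDiff, map_zero]
    by_cases h1 : prodDiff (y ∘ Sum.inl) = 0
    · simp [h1]
    by_cases h2 : prodDiff (y ∘ Sum.inr) = 0
    · simp [h2]
    rw [h _ _ (injective_of_prodDiff_ne_zero h1) (injective_of_prodDiff_ne_zero h2), zero_mul]
  exact (mul_eq_zero.1 this).resolve_right (mul_ne_zero (xDiff_ne_zero n) (lamDiff_ne_zero n))

/-- The function `q(x, λ) / A(x)^K * exp (λ, x)`. -/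
noncomputable def polyExp {n : ℕ} (K : ℕ) (q : XLPoly n) (lam x : Fin n → ℂ) : ℂ :=
  MvPolynomial.eval (Sum.elim x lam) q / prodDiff x ^ K * Complex.exp (∑ i, lam i * x i)

/-- The derivative in `x_i`. -/
noncomputable abbrev xDeriv {n : ℕ} (i : Fin n) (q : XLPoly n) : XLPoly n :=
  MvPolynomial.pderiv (Sum.inl i) q

/-- The variable `λ_i`. -/
noncomputable abbrev lamVar {n : ℕ} (i : Fin n) : XLPoly n := MvPolynomial.X (Sum.inr i)

/-- The numerator of `(Δ - c ∑ (x_i - x_j)^{-2} - (λ, λ)) f`, over `A(x)^{K + 2}`, for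
`f = polyExp K q`; the sum is over the ordered pairs. -/
noncomputable def schrodingerPoly {n : ℕ} (c : ℂ) (K : ℕ) (q : XLPoly n) : XLPoly n :=
  xDiff n ^ 2 * ∑ i, xDeriv i (xDeriv i q) +
    2 * ∑ i, xDeriv i q * (xDiff n ^ 2 * lamVar i -
      (K : XLPoly n) * xDiff n * xDeriv i (xDiff n)) +
    q * (MvPolynomial.C (K * (K + 1) - c) * ∑ i, xDeriv i (xDiff n) ^ 2 -
      2 * (K : XLPoly n) * xDiff n * ∑ i, lamVar i * xDeriv i (xDiff n))

theorem hasDerivAt_eval_update_inl {n : ℕ} (q : XLPoly n) (x lam : Fin n → ℂ) (i : Fin n) :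
    HasDerivAt (fun s => MvPolynomial.eval (Sum.elim (Function.update x i s) lam) q)
      (MvPolynomial.eval (Sum.elim x lam) (xDeriv i q)) (x i) := by
  simpa only [Sum.update_elim_inl, Sum.elim_inl] using
    hasDerivAt_eval_update q (Sum.elim x lam) (Sum.inl i)

theorem eval_xDeriv_xDiff {n : ℕ} {x : Fin n → ℂ} (hx : Function.Injective x) (lam : Fin n → ℂ)
    (i : Fin n) :
    MvPolynomial.eval (Sum.elim x lam) (xDeriv i (xDiff n)) = prodDiff x * sumInv x i := by
  have h := hasDerivAt_eval_update_inl (xDiff n) x lam i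
  simp only [eval_xDiff] at h
  exact h.unique (hasDerivAt_prodDiff_update hx i)

theorem hasDerivAt_mul_expDiv {n : ℕ} (K : ℕ) {g : (Fin n → ℂ) → ℂ} {g' : ℂ}
    (lam : Fin n → ℂ) {x : Fin n → ℂ} (hx : Function.Injective x) (i : Fin n)
    (hg : HasDerivAt (fun s => g (Function.update x i s)) g' (x i)) :
    HasDerivAt (fun s => g (Function.update x i s) / prodDiff (Function.update x i s) ^ K *
        Complex.exp (∑ j, lam j * Function.update x i s j))
      ((g' + g x * (lam i - K * sumInv x i)) / prodDiff x ^ K *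
        Complex.exp (∑ j, lam j * x j)) (x i) := by
  have h1 : HasDerivAt (fun s => prodDiff (Function.update x i s))
      (prodDiff (Function.update x i (x i)) * sumInv x i) (x i) := by
    simpa using hasDerivAt_prodDiff_update hx i
  have h2 : HasDerivAt (fun s => ∑ j, lam j * Function.update x i s j) (lam i) (x i) := by
    have := HasDerivAt.fun_sum (u := Finset.univ) fun j _ =>
      (hasDerivAt_update_apply x i j (x i)).const_mul (lam j)
    simpa using this
  have h3 := (hg.fun_mul ((h1.pow_log K).inv_log
    (by simpa using pow_ne_zero K (prodDiff_ne_zero hx)))).fun_mul h2.cexp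
  simp only [div_eq_mul_inv]
  refine h3.congr_deriv ?_
  simp only [Function.update_eq_self]
  ring

/-- The Schrödinger equation for `polyExp K q` is a polynomial identity. -/
theorem eval_schrodingerPoly {n : ℕ} (c : ℂ) (K : ℕ) (q : XLPoly n) (lam : Fin n → ℂ)
    {x : Fin n → ℂ} (hx : Function.Injective x) :
    MvPolynomial.eval (Sum.elim x lam) (schrodingerPoly c K q) / prodDiff x ^ K *
        Complex.exp (∑ i, lam i * x i) =
      prodDiff x ^ 2 * (∑ i, iteratedDeriv 2
          (fun s => polyExp K q lam (Function.update x i s)) (x i) -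
        (c * sumInvSq x + ∑ i, lam i ^ 2) * polyExp K q lam x) := by
  have key : ∀ i, iteratedDeriv 2 (fun s => polyExp K q lam (Function.update x i s)) (x i) =
      (MvPolynomial.eval (Sum.elim x lam) (xDeriv i (xDeriv i q)) +
        2 * MvPolynomial.eval (Sum.elim x lam) (xDeriv i q) * (lam i - K * sumInv x i) +
        MvPolynomial.eval (Sum.elim x lam) q * ((lam i - K * sumInv x i) ^ 2 +
          K * ∑ j, (x i - x j)⁻¹ ^ 2)) / prodDiff x ^ K * Complex.exp (∑ j, lam j * x j) := by
    intro i
    refine iteratedDeriv_two_update (isOpen_setOf_injective n) (l := i)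
      (f := polyExp K q lam)
      (f₁ := fun x => (MvPolynomial.eval (Sum.elim x lam) (xDeriv i q) +
        MvPolynomial.eval (Sum.elim x lam) q * (lam i - K * sumInv x i)) / prodDiff x ^ K *
          Complex.exp (∑ j, lam j * x j))
      (f₂ := fun x => (MvPolynomial.eval (Sum.elim x lam) (xDeriv i (xDeriv i q)) +
        2 * MvPolynomial.eval (Sum.elim x lam) (xDeriv i q) * (lam i - K * sumInv x i) +
        MvPolynomial.eval (Sum.elim x lam) q * ((lam i - K * sumInv x i) ^ 2 +
          K * ∑ j, (x i - x j)⁻¹ ^ 2)) / prodDiff x ^ K * Complex.exp (∑ j, lam j * x j))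
      (fun x hx => hasDerivAt_mul_expDiv K
        (g := fun x => MvPolynomial.eval (Sum.elim x lam) q) lam hx i
        (hasDerivAt_eval_update_inl q x lam i)) (fun x hx => ?_) hx
    have h2 := (hasDerivAt_eval_update_inl (xDeriv i q) x lam i).fun_add
      ((hasDerivAt_eval_update_inl q x lam i).fun_mul
        (((hasDerivAt_sumInv_update hx i).const_mul (K : ℂ)).const_sub (lam i)))
    refine (hasDerivAt_mul_expDiv K (g := fun x => MvPolynomial.eval (Sum.elim x lam)
      (xDeriv i q) + MvPolynomial.eval (Sum.elim x lam) q * (lam i - K * sumInv x i))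
      lam hx i h2).congr_deriv ?_
    simp only [Function.update_eq_self]
    ring
  have hA := prodDiff_ne_zero hx
  simp only [key, ← Finset.sum_mul, ← Finset.sum_div]
  simp only [polyExp, schrodingerPoly, map_add, map_mul, map_sub, map_sum, map_pow, eval_xDiff,
    eval_xDeriv_xDiff hx, MvPolynomial.eval_C, MvPolynomial.eval_X, Sum.elim_inr, map_natCast,
    map_ofNat]
  have e1 : ∑ i, (prodDiff x * sumInv x i) ^ 2 = prodDiff x ^ 2 * sumInvSq x := by
    simp only [mul_pow, ← Finset.mul_sum, sum_sumInv_sq hx]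
  have e2 : ∑ i, lam i * (prodDiff x * sumInv x i) = prodDiff x * ∑ i, lam i * sumInv x i := by
    rw [Finset.mul_sum]
    exact Finset.sum_congr rfl fun i _ => by ring
  have e3 : ∑ i, MvPolynomial.eval (Sum.elim x lam) (xDeriv i q) * (prodDiff x ^ 2 * lam i -
      K * prodDiff x * (prodDiff x * sumInv x i)) = prodDiff x ^ 2 *
      ∑ i, MvPolynomial.eval (Sum.elim x lam) (xDeriv i q) * (lam i - K * sumInv x i) := by
    rw [Finset.mul_sum]
    exact Finset.sum_congr rfl fun i _ => by ring
  have e4 : ∑ i, (lam i - K * sumInv x i) ^ 2 = ∑ i, lam i ^ 2 -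
      2 * K * ∑ i, lam i * sumInv x i + K ^ 2 * sumInvSq x := by
    rw [← sum_sumInv_sq hx, Finset.mul_sum, Finset.mul_sum, ← Finset.sum_sub_distrib,
      ← Finset.sum_add_distrib]
    exact Finset.sum_congr rfl fun i _ => by ring
  have e5 : ∑ i, ∑ j, (x i - x j)⁻¹ ^ 2 = sumInvSq x := rfl
  simp only [e1, e2, e3]
  simp only [Finset.sum_add_distrib, mul_assoc, ← Finset.mul_sum, e4, e5]
  ring

theorem schrodingerPoly_eq_zero {n : ℕ} {c : ℂ} {K : ℕ} {q : XLPoly n}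
    (h : ∀ x lam : Fin n → ℂ, Function.Injective x → Function.Injective lam →
      ∑ i, iteratedDeriv 2 (fun s => polyExp K q lam (Function.update x i s)) (x i) =
        (c * sumInvSq x + ∑ i, lam i ^ 2) * polyExp K q lam x) :
    schrodingerPoly c K q = 0 := by
  refine eq_zero_of_eval_eq_zero fun x lam hx hlam => ?_
  have h1 := eval_schrodingerPoly c K q lam hx
  rw [h x lam hx hlam, sub_self, mul_zero] at h1
  have := pow_ne_zero K (prodDiff_ne_zero hx)
  simpa [this, Complex.exp_ne_zero] using h1

/-! ### Poles of order at most `m` along the hyperplanes `x_i = x_j` -/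

theorem prime_X_sub_X {σ : Type*} {a b : σ} (h : a ≠ b) :
    Prime (MvPolynomial.X a - MvPolynomial.X b : MvPolynomial σ ℂ) := by
  classical
  refine (MvPolynomial.irreducible_of_totalDegree_eq_one ?_ fun y hy => ?_).prime
  · exact ((MvPolynomial.isHomogeneous_X ℂ a).sub (MvPolynomial.isHomogeneous_X ℂ b)).totalDegree
      (sub_ne_zero.2 fun h' => h (MvPolynomial.X_injective h'))
  · have := hy (Finsupp.single a 1)
    rw [MvPolynomial.coeff_sub, MvPolynomial.coeff_X, MvPolynomial.coeff_X, if_pos rfl,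
      if_neg, sub_zero] at this
    · exact isUnit_of_dvd_one this
    · exact fun h' => h (Finsupp.single_left_injective one_ne_zero h').symm

theorem not_X_sub_X_dvd {σ : Type*} {a b : σ} {f : MvPolynomial σ ℂ} (y : σ → ℂ)
    (hy : y a = y b) (hf : MvPolynomial.eval y f ≠ 0) :
    ¬ (MvPolynomial.X a - MvPolynomial.X b : MvPolynomial σ ℂ) ∣ f := by
  rintro ⟨g, rfl⟩
  simp [hy] at hf

theorem prodDiff_eq_prod_sigma {R : Type*} [CommRing R] {n : ℕ} (x : Fin n → R) :
    prodDiff x = ∏ p ∈ Finset.univ.sigma fun i : Fin n => Finset.Ioi i, (x p.1 - x p.2) :=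
  Finset.prod_sigma' _ _ _

theorem X_sub_X_dvd_xDiff {n : ℕ} {i j : Fin n} (hij : i < j) :
    (MvPolynomial.X (Sum.inl i) - MvPolynomial.X (Sum.inl j) : XLPoly n) ∣ xDiff n := by
  have h1 := Finset.dvd_prod_of_mem (fun j : Fin n =>
    (MvPolynomial.X (Sum.inl i) - MvPolynomial.X (Sum.inl j) : XLPoly n)) (Finset.mem_Ioi.2 hij)
  exact h1.trans (Finset.dvd_prod_of_mem (fun i : Fin n => ∏ j ∈ Finset.Ioi i,
    (MvPolynomial.X (Sum.inl i) - MvPolynomial.X (Sum.inl j) : XLPoly n)) (Finset.mem_univ i))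

/-- A point for which `x_i = x_j` is the only coincidence among the coordinates, for `i < j`. -/
theorem exists_unique_coincidence {n : ℕ} {i j : Fin n} (hij : i < j) :
    ∃ x : Fin n → ℂ, x i = x j ∧ ∀ k l, k < l → x k = x l → k = i ∧ l = j := by
  refine ⟨Function.update (fun k => ((k : ℕ) : ℂ)) j ((i : ℕ) : ℂ), ?_, fun k l hkl h => ?_⟩
  · simp [hij.ne]
  · by_cases hk : k = j
    · subst hk
      rw [Function.update_self, Function.update_of_ne hkl.ne'] at h
      have : (i : ℕ) = l := by exact_mod_cast h
      omega
    · by_cases hl : l = j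
      · subst hl
        rw [Function.update_self, Function.update_of_ne hk] at h
        exact ⟨Fin.ext (by exact_mod_cast h), rfl⟩
      · rw [Function.update_of_ne hk, Function.update_of_ne hl] at h
        have : (k : ℕ) = l := by exact_mod_cast h
        omega

/-- The sum of the squares of the partial derivatives of `A(x)` does not vanish on the hyperplane
`x_i = x_j`: at a generic point of it the gradient is a nonzero multiple of `e_i - e_j`. -/
theorem not_X_sub_X_dvd_sum_sq {n : ℕ} {i j : Fin n} (hij : i < j) :
    ¬ (MvPolynomial.X (Sum.inl i) - MvPolynomial.X (Sum.inl j) : XLPoly n) ∣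
      ∑ k, xDeriv k (xDiff n) ^ 2 := by
  obtain ⟨x, hx, hx'⟩ := exists_unique_coincidence hij
  refine not_X_sub_X_dvd (Sum.elim x 0) hx ?_
  set S := Finset.univ.sigma fun i : Fin n => Finset.Ioi i with hS
  set g : XLPoly n := ∏ p ∈ S.erase ⟨i, j⟩, (MvPolynomial.X (Sum.inl p.1) -
    MvPolynomial.X (Sum.inl p.2)) with hg
  have hA : xDiff n = (MvPolynomial.X (Sum.inl i) - MvPolynomial.X (Sum.inl j)) * g := by
    rw [xDiff, prodDiff_eq_prod_sigma, ← Finset.mul_prod_erase S _ (a := ⟨i, j⟩)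
      (by simp [hS, hij])]
  have hg0 : MvPolynomial.eval (Sum.elim x 0) g ≠ 0 := by
    rw [hg, map_prod]
    refine Finset.prod_ne_zero_iff.2 fun p hp => ?_
    obtain ⟨h1, h2⟩ := Finset.mem_erase.1 hp
    rw [map_sub, MvPolynomial.eval_X, MvPolynomial.eval_X]
    refine sub_ne_zero.2 fun h => h1 ?_
    obtain ⟨k, l⟩ := p
    obtain ⟨rfl, rfl⟩ := hx' k l (by simpa [hS] using h2) h
    rfl
  have hd : ∀ k, MvPolynomial.eval (Sum.elim x 0) (xDeriv k (xDiff n)) =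
      ((if k = i then 1 else 0) - if k = j then 1 else 0) *
        MvPolynomial.eval (Sum.elim x 0) g := by
    intro k
    rw [hA, xDeriv, MvPolynomial.pderiv_mul]
    simp only [map_add, map_mul, map_sub, MvPolynomial.eval_X, Sum.elim_inl, hx, sub_self,
      zero_mul, add_zero, MvPolynomial.pderiv_X, Pi.single_apply, Sum.inl.injEq, eq_comm (b := k)]
    split_ifs <;> simp
  have hsum : ∑ k, (((if k = i then 1 else 0) - if k = j then 1 else 0 : ℂ)) ^ 2 = 2 := by
    have : ∀ k, (((if k = i then 1 else 0) - if k = j then 1 else 0 : ℂ)) ^ 2 =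
        (if k = i then 1 else 0) + if k = j then 1 else 0 := by
      intro k
      by_cases h1 : k = i
      · subst h1; simp [hij.ne]
      · by_cases h2 : k = j <;> simp [h1, h2, hij.ne']
    simp only [this, Finset.sum_add_distrib]
    norm_num
  simp only [map_sum, map_pow, hd, mul_pow, ← Finset.sum_mul, hsum]
  simp [hg0]

/-- The exponents of the Schrödinger equation at `x_i = x_j` are `-m` and `m + 1`, so a pole of
order `K > m` is excluded. -/
theorem xDiff_dvd {n m K : ℕ} (hK : m < K) {q : XLPoly n}
    (hq : schrodingerPoly (m * (m + 1)) K q = 0) : xDiff n ∣ q := by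
  have hc : ((K : ℂ) * (K + 1) - m * (m + 1)) ≠ 0 := by
    rw [sub_ne_zero]
    exact_mod_cast (Nat.mul_lt_mul'' hK (Nat.succ_lt_succ hK)).ne'
  have h1 : xDiff n ∣ q * (MvPolynomial.C ((K : ℂ) * (K + 1) - m * (m + 1)) *
      ∑ i, xDeriv i (xDiff n) ^ 2) := by
    have h2 : ∑ i, xDeriv i q * (xDiff n ^ 2 * lamVar i -
        (K : XLPoly n) * xDiff n * xDeriv i (xDiff n)) = xDiff n * ∑ i, xDeriv i q *
          (xDiff n * lamVar i - (K : XLPoly n) * xDeriv i (xDiff n)) := by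
      rw [Finset.mul_sum]
      exact Finset.sum_congr rfl fun i _ => by ring
    rw [schrodingerPoly, h2] at hq
    refine ⟨-(xDiff n * ∑ i, xDeriv i (xDeriv i q) + 2 * ∑ i, xDeriv i q *
      (xDiff n * lamVar i - (K : XLPoly n) * xDeriv i (xDiff n)) -
        q * (2 * (K : XLPoly n) * ∑ i, lamVar i * xDeriv i (xDiff n))), ?_⟩
    linear_combination hq
  rw [xDiff, prodDiff_eq_prod_sigma]
  refine Finset.prod_dvd_of_isRelPrime (fun p hp p' hp' hne => ?_) fun p hp => ?_
  · obtain ⟨i, j⟩ := p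
    obtain ⟨k, l⟩ := p'
    have hij : i < j := by simpa using hp
    have hkl : k < l := by simpa using hp'
    refine (prime_X_sub_X (Sum.inl_injective.ne hij.ne)).irreducible.isRelPrime_iff_not_dvd.2 ?_
    obtain ⟨x, hx, hx'⟩ := exists_unique_coincidence hij
    refine not_X_sub_X_dvd (Sum.elim x 0) hx ?_
    rw [map_sub, MvPolynomial.eval_X, MvPolynomial.eval_X]
    refine sub_ne_zero.2 fun h => hne ?_
    obtain ⟨rfl, rfl⟩ := hx' k l hkl h
    rfl
  · obtain ⟨i, j⟩ := p
    have hij : i < j := by simpa using hp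
    have hpr := prime_X_sub_X ((Sum.inl_injective (β := Fin n)).ne hij.ne)
    rcases hpr.dvd_or_dvd ((X_sub_X_dvd_xDiff hij).trans h1) with h | h
    · exact h
    · rcases hpr.dvd_or_dvd h with h | h
      · exact absurd (isUnit_of_dvd_unit h ((isUnit_iff_ne_zero.2 hc).map MvPolynomial.C))
          hpr.not_isUnit
      · exact absurd h (not_X_sub_X_dvd_sum_sq hij)

theorem iteratedDeriv_update_congr {n : ℕ} (k : ℕ) {f g : (Fin n → ℂ) → ℂ}
    (h : ∀ x, Function.Injective x → f x = g x) {x : Fin n → ℂ} (hx : Function.Injective x)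
    (i : Fin n) :
    iteratedDeriv k (fun s => f (Function.update x i s)) (x i) =
      iteratedDeriv k (fun s => g (Function.update x i s)) (x i) := by
  refine Filter.EventuallyEq.iteratedDeriv_eq k ?_
  have hc : Continuous fun s => Function.update x i s := by fun_prop
  have : ∀ᶠ s in nhds (x i), Function.update x i s ∈ {x | Function.Injective x} :=
    hc.continuousAt.eventually_mem (by simpa using (isOpen_setOf_injective n).mem_nhds hx)
  filter_upwards [this] with s hs using h _ hs

/-- A solution of the Schrödinger equation is a polynomial over `A(x)^m`. -/
theorem exists_eq_xDiff_pow_mul {n m : ℕ} {F : (Fin n → ℂ) → (Fin n → ℂ) → ℂ}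
    (hF : ∀ x lam : Fin n → ℂ, Function.Injective x →
      ∑ i, iteratedDeriv 2 (fun s => F lam (Function.update x i s)) (x i) =
        (m * (m + 1) * sumInvSq x + ∑ i, lam i ^ 2) * F lam x) (d : ℕ) {q : XLPoly n}
    (hq : ∀ x lam, Function.Injective x → polyExp (m + d) q lam x = F lam x) :
    ∃ P, q = xDiff n ^ d * P := by
  induction d generalizing q with
  | zero => exact ⟨q, by simp⟩
  | succ d ih =>
    have h1 : schrodingerPoly (m * (m + 1)) (m + (d + 1)) q = 0 := by
      refine schrodingerPoly_eq_zero fun x lam hx _ => ?_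
      rw [hq x lam hx, ← hF x lam hx]
      refine Finset.sum_congr rfl fun i _ => ?_
      exact iteratedDeriv_update_congr 2 (fun x hx => hq x lam hx) hx i
    obtain ⟨r, rfl⟩ := xDiff_dvd (by omega) h1
    obtain ⟨P, rfl⟩ := ih (q := r) fun x lam hx => by
      rw [← hq x lam hx, polyExp, polyExp, map_mul, eval_xDiff, ← add_assoc, pow_succ',
        mul_div_mul_left _ _ (prodDiff_ne_zero hx)]
    exact ⟨P, by ring⟩

/-! ### Degrees and leading terms -/

theorem sum_card_Ioi (n : ℕ) : ∑ i : Fin n, (Finset.Ioi i).card = n * (n - 1) / 2 := by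
  simp only [Fin.card_Ioi]
  rw [Fin.sum_univ_eq_sum_range (fun i => n - 1 - i), Finset.sum_range_reflect (fun i => i),
    Finset.sum_range_id]

theorem isWeightedHomogeneous_prodDiff_X {σ : Type*} {w : σ → ℕ} {n c : ℕ} {v : Fin n → σ}
    (h : ∀ i, w (v i) = c) :
    MvPolynomial.IsWeightedHomogeneous w
      (prodDiff fun i => (MvPolynomial.X (v i) : MvPolynomial σ ℂ)) (n * (n - 1) / 2 * c) := by
  have hX : ∀ i, MvPolynomial.IsWeightedHomogeneous w
      (MvPolynomial.X (v i) : MvPolynomial σ ℂ) c := fun i =>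
    h i ▸ MvPolynomial.isWeightedHomogeneous_X ℂ w (v i)
  rw [← sum_card_Ioi, Finset.sum_mul]
  simp only [← smul_eq_mul, ← Finset.sum_const]
  exact MvPolynomial.IsWeightedHomogeneous.prod _ _ _ fun i _ =>
    MvPolynomial.IsWeightedHomogeneous.prod _ _ _ fun j _ => (hX i).sub (hX j)

theorem weightedHomogeneousComponent_mul_add {σ : Type*} {w : σ → ℕ} {a : MvPolynomial σ ℂ}
    {k : ℕ} (ha : MvPolynomial.IsWeightedHomogeneous w a k) (r : MvPolynomial σ ℂ) (j : ℕ) :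
    MvPolynomial.weightedHomogeneousComponent w (k + j) (a * r) =
      a * MvPolynomial.weightedHomogeneousComponent w j r := by
  classical
  let _ := MvPolynomial.weightedGradedAlgebra ℂ w
  have h := DirectSum.coe_decompose_mul_add_of_left_mem
    (MvPolynomial.weightedHomogeneousSubmodule ℂ w) (b := r) (j := j) ha
  have e1 := MvPolynomial.weightedDecomposition.decompose'_apply ℂ w (a * r) (k + j)
  have e2 := MvPolynomial.weightedDecomposition.decompose'_apply ℂ w r j
  rw [← e1, ← e2]
  exact h

theorem weight_lt_of_mul {σ : Type*} {w : σ → ℕ} {a : MvPolynomial σ ℂ} {k N : ℕ}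
    (ha : MvPolynomial.IsWeightedHomogeneous w a k) (ha0 : a ≠ 0) {r : MvPolynomial σ ℂ}
    (h : ∀ e ∈ (a * r).support, Finsupp.weight w e < k + N) :
    ∀ e ∈ r.support, Finsupp.weight w e < N := by
  classical
  intro e he
  by_contra hlt
  have h1 := weightedHomogeneousComponent_mul_add ha r (Finsupp.weight w e)
  rw [MvPolynomial.weightedHomogeneousComponent_eq_zero' _ _ fun d hd => by
    have := h d hd
    omega] at h1
  have h2 := (mul_eq_zero.1 h1.symm).resolve_left ha0
  have h3 := MvPolynomial.coeff_weightedHomogeneousComponent (w := w) (Finsupp.weight w e) r e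
  rw [h2, if_pos rfl, MvPolynomial.coeff_zero] at h3
  exact MvPolynomial.mem_support_iff.1 he h3.symm

/-- The weights `α` of the variables `x_i` and `β` of the variables `λ_i`. -/
def xlWeight (n α β : ℕ) : Fin n ⊕ Fin n → ℕ := Sum.elim (fun _ => α) fun _ => β

/-- The substitution `h = t` for the homogenizing variable. -/
noncomputable def specialize {n : ℕ} (t : ℂ) : HPoly n →ₐ[ℂ] XLPoly n :=
  MvPolynomial.aeval fun o => o.elim (MvPolynomial.C t) MvPolynomial.X

theorem eval_specialize {n : ℕ} (t : ℂ) (Q : HPoly n) (x lam : Fin n → ℂ) :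
    MvPolynomial.eval (Sum.elim x lam) (specialize t Q) = MvPolynomial.eval (hPoint x lam t) Q := by
  induction Q using MvPolynomial.induction_on with
  | C a => simp [specialize]
  | add p q hp hq => simp only [map_add, hp, hq]
  | mul_X p o hp =>
    rw [map_mul, map_mul, map_mul, hp]
    congr 1
    rcases o with _ | s <;> simp [specialize, hPoint]

theorem specialize_monomial {n : ℕ} (t a : ℂ) (u : Option (Fin n ⊕ Fin n) →₀ ℕ) :
    specialize t (MvPolynomial.monomial u a) = MvPolynomial.monomial u.some (a * t ^ u none) := by
  rw [specialize, MvPolynomial.aeval_monomial, Finsupp.prod_option_index u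
    (fun o k => (o.elim (MvPolynomial.C t) MvPolynomial.X : XLPoly n) ^ k)
    (fun o => pow_zero _) fun o k l => pow_add _ _ _]
  simp only [Option.elim_none, Option.elim_some, MvPolynomial.algebraMap_eq, ← map_pow,
    ← mul_assoc, ← map_mul]
  rw [MvPolynomial.monomial_eq]

theorem weight_hWeight {n α β : ℕ} (u : Option (Fin n ⊕ Fin n) →₀ ℕ) :
    Finsupp.weight (hWeight n α β) u =
      u none * (α + β) + Finsupp.weight (xlWeight n α β) u.some := by
  rw [Finsupp.weight_apply, Finsupp.sum_option_index_smul, Finsupp.weight_apply]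
  rfl

/-- The value at `h = 0` is the leading term, with respect to the weights, of the value at
`h = 1`. -/
theorem specialize_leading {n α β d : ℕ} (hαβ : 0 < α + β) {Q : HPoly n}
    (hQ : MvPolynomial.IsWeightedHomogeneous (hWeight n α β) Q d) :
    MvPolynomial.IsWeightedHomogeneous (xlWeight n α β) (specialize 0 Q) d ∧
      ∀ e ∈ (specialize 1 Q - specialize 0 Q).support,
        Finsupp.weight (xlWeight n α β) e < d := by
  classical
  have hsum : ∀ t : ℂ, specialize t Q =
      ∑ u ∈ Q.support, MvPolynomial.monomial u.some (MvPolynomial.coeff u Q * t ^ u none) := by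
    intro t
    conv_lhs => rw [Q.as_sum]
    rw [map_sum]
    exact Finset.sum_congr rfl fun u _ => specialize_monomial t _ u
  constructor
  · rw [hsum]
    refine MvPolynomial.IsWeightedHomogeneous.sum _ _ _ fun u hu => ?_
    by_cases h0 : u none = 0
    · refine MvPolynomial.isWeightedHomogeneous_monomial _ _ _ ?_
      have := hQ (MvPolynomial.mem_support_iff.1 hu)
      rw [weight_hWeight, h0] at this
      simpa using this
    · simpa [h0] using MvPolynomial.isWeightedHomogeneous_zero ℂ (xlWeight n α β) d
  · intro e he
    rw [MvPolynomial.mem_support_iff, hsum, hsum, ← Finset.sum_sub_distrib,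
      MvPolynomial.coeff_sum] at he
    obtain ⟨u, hu, hne⟩ := Finset.exists_ne_zero_of_sum_ne_zero he
    have hd := hQ (MvPolynomial.mem_support_iff.1 hu)
    rw [weight_hWeight] at hd
    by_cases h0 : u none = 0
    · simp [h0] at hne
    · have h1 : u.some = e := by
        by_contra h1
        simp [MvPolynomial.coeff_monomial, h1] at hne
      subst h1
      have := Nat.mul_pos (Nat.pos_of_ne_zero h0) hαβ
      omega

theorem leadingPoly_eq (n m : ℕ) : leadingPoly n m = xDiff n ^ m * lamDiff n ^ m := rfl

/-- The Baker--Akhiezer function has a numerator with the correct leading terms. -/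
theorem exists_numerator (m k : ℕ) : ∃ P : XLPoly (k + 1),
    (∀ x lam : Fin (k + 1) → ℂ, Function.Injective x → polyExp m P lam x = psi m (k + 1) x lam) ∧
    ∀ α β, 0 < α + β → ∀ e ∈ (P - leadingPoly (k + 1) m).support,
      Finsupp.weight (xlWeight (k + 1) α β) e < m * ((k + 1) * (k + 1 - 1) / 2 * (α + β)) := by
  obtain ⟨D, hD⟩ : ∃ D, (numer m (k + 1)).2 = m + D := by
    refine Nat.exists_eq_add_of_le ?_
    change m ≤ 3 * (RowPoly.residue m (numer m k)).2
    rw [RowPoly.snd_residue]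
    have := Nat.zero_le (m * k)
    omega
  obtain ⟨P, hP⟩ := exists_eq_xDiff_pow_mul (F := fun lam x => psi m (k + 1) x lam)
    (fun x lam hx => sum_iteratedDeriv_psi m (k + 1) x lam hx) D
    (q := specialize 1 (numer m (k + 1)).1) fun x lam _ => by
      rw [polyExp, psi, eval_specialize, hD]
  refine ⟨P, fun x lam hx => ?_, fun α β hαβ => ?_⟩
  · have hA := prodDiff_ne_zero hx
    have h1 := congrArg (MvPolynomial.eval (Sum.elim x lam)) hP
    rw [eval_specialize, map_mul, map_pow, eval_xDiff] at h1
    rw [polyExp, psi, h1, hD, pow_add, mul_comm (prodDiff x ^ m),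
      mul_div_mul_left _ _ (pow_ne_zero D hA)]
  · obtain ⟨d, hd⟩ := isHom_numer m α β (k + 1)
    obtain ⟨h1, h2⟩ := specialize_leading hαβ hd
    have h0 : specialize 0 (numer m (k + 1)).1 = xDiff (k + 1) ^ (m + D) * lamDiff (k + 1) ^ m := by
      refine MvPolynomial.funext fun y => ?_
      rw [← Sum.elim_comp_inl_inr y, eval_specialize, eval_numer_zero, hD, map_mul, map_pow,
        map_pow, eval_xDiff, eval_lamDiff]
    have hx : MvPolynomial.IsWeightedHomogeneous (xlWeight (k + 1) α β) (xDiff (k + 1)) _ :=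
      isWeightedHomogeneous_prodDiff_X (c := α) fun _ => rfl
    have hl : MvPolynomial.IsWeightedHomogeneous (xlWeight (k + 1) α β) (lamDiff (k + 1)) _ :=
      isWeightedHomogeneous_prodDiff_X (c := β) fun _ => rfl
    have hd' := h1.inj_right (h0 ▸ mul_ne_zero (pow_ne_zero _ (xDiff_ne_zero _))
      (pow_ne_zero _ (lamDiff_ne_zero _))) (h0 ▸ (hx.pow (m + D)).mul (hl.pow m))
    refine weight_lt_of_mul (hx.pow D) (pow_ne_zero _ (xDiff_ne_zero _)) ?_
    have h3 : xDiff (k + 1) ^ D * (P - leadingPoly (k + 1) m) =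
        specialize 1 (numer m (k + 1)).1 - specialize 0 (numer m (k + 1)).1 := by
      rw [hP, h0, leadingPoly_eq]
      ring
    rw [h3]
    refine fun e he => (h2 e he).trans_eq ?_
    rw [hd']
    simp only [smul_eq_mul]
    ring

/-! ### Uniqueness of the numerator -/

theorem weightedHomogeneousComponent_pderiv {σ : Type*} {w : σ → ℕ} {i : σ} (hi : w i = 0)
    (N : ℕ) (q : MvPolynomial σ ℂ) :
    MvPolynomial.weightedHomogeneousComponent w N (MvPolynomial.pderiv i q) =
      MvPolynomial.pderiv i (MvPolynomial.weightedHomogeneousComponent w N q) := by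
  classical
  ext e
  rw [MvPolynomial.coeff_weightedHomogeneousComponent, MvPolynomial.coeff_pderiv,
    MvPolynomial.coeff_pderiv, MvPolynomial.coeff_weightedHomogeneousComponent, map_add,
    Finsupp.weight_single, hi, smul_zero, add_zero, ite_mul, zero_mul]

/-- Restriction of a polynomial to the line `x + s λ`, as a polynomial in `s`. -/
noncomputable def restrictLine {n : ℕ} (x lam : Fin n → ℂ) : XLPoly n →ₐ[ℂ] Polynomial ℂ :=
  MvPolynomial.aeval (Sum.elim
    (fun i => Polynomial.C (lam i) * Polynomial.X + Polynomial.C (x i))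
    fun i => Polynomial.C (lam i))

theorem eval_zero_restrictLine {n : ℕ} (x lam : Fin n → ℂ) (p : XLPoly n) :
    (restrictLine x lam p).eval 0 = MvPolynomial.eval (Sum.elim x lam) p := by
  induction p using MvPolynomial.induction_on with
  | C a => simp [restrictLine]
  | add p q hp hq => simp only [map_add, Polynomial.eval_add, hp, hq]
  | mul_X p s hp =>
    rw [map_mul, map_mul, Polynomial.eval_mul, hp]
    congr 1
    rcases s with i | i <;> simp [restrictLine]

theorem derivative_restrictLine {n : ℕ} (x lam : Fin n → ℂ) (p : XLPoly n) :
    Polynomial.derivative (restrictLine x lam p) =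
      restrictLine x lam (∑ i, lamVar i * xDeriv i p) := by
  induction p using MvPolynomial.induction_on with
  | C a => simp [restrictLine]
  | add p q hp hq => simp only [map_add, hp, hq, mul_add, Finset.sum_add_distrib]
  | mul_X p s hp =>
    have h1 : ∑ i, lamVar i * xDeriv i (p * MvPolynomial.X s) =
        (∑ i, lamVar i * xDeriv i p) * MvPolynomial.X s +
          p * ∑ i, lamVar i * xDeriv i (MvPolynomial.X s) := by
      rw [Finset.sum_mul, Finset.mul_sum, ← Finset.sum_add_distrib]
      refine Finset.sum_congr rfl fun i _ => ?_
      rw [xDeriv, MvPolynomial.pderiv_mul]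
      ring
    rw [h1, map_mul, Polynomial.derivative_mul, hp, map_add, map_mul, map_mul]
    have h2 : Polynomial.derivative (restrictLine x lam (MvPolynomial.X s)) =
        restrictLine x lam (∑ i, lamVar i * xDeriv i (MvPolynomial.X s)) := by
      rcases s with j | j <;> simp [restrictLine, MvPolynomial.pderiv_X, Pi.single_apply]
    rw [h2]

theorem restrictLine_xDiff {n : ℕ} (x lam : Fin n → ℂ) : restrictLine x lam (xDiff n) =
    prodDiff fun i => Polynomial.C (lam i) * Polynomial.X + Polynomial.C (x i) := by
  rw [xDiff, ← AlgHom.coe_toRingHom, map_prodDiff]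
  simp [restrictLine]

theorem restrictLine_xDiff_ne_zero {n : ℕ} (x : Fin n → ℂ) {lam : Fin n → ℂ}
    (hlam : Function.Injective lam) : restrictLine x lam (xDiff n) ≠ 0 := by
  rw [restrictLine_xDiff]
  refine prodDiff_ne_zero fun i j h => hlam ?_
  simpa using congrArg (fun p : Polynomial ℂ => p.coeff 1) h

theorem natDegree_restrictLine_xDiff {n : ℕ} (x : Fin n → ℂ) {lam : Fin n → ℂ}
    (hlam : Function.Injective lam) :
    (restrictLine x lam (xDiff n)).natDegree = n * (n - 1) / 2 := by
  have h1 : ∀ i j : Fin n, j ∈ Finset.Ioi i → ((Polynomial.C (lam i) * Polynomial.X +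
      Polynomial.C (x i)) - (Polynomial.C (lam j) * Polynomial.X +
        Polynomial.C (x j))).natDegree = 1 := by
    intro i j hij
    have h : lam i - lam j ≠ 0 := sub_ne_zero.2 fun h => (Finset.mem_Ioi.1 hij).ne (hlam h)
    rw [← Polynomial.natDegree_linear (b := x i - x j) h, map_sub, map_sub]
    congr 1
    ring
  have h0 : ∀ i j : Fin n, j ∈ Finset.Ioi i → ((Polynomial.C (lam i) * Polynomial.X +
      Polynomial.C (x i)) - (Polynomial.C (lam j) * Polynomial.X + Polynomial.C (x j))) ≠ 0 :=
    fun i j hij h => by simpa [h] using h1 i j hij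
  rw [restrictLine_xDiff, prodDiff, Polynomial.natDegree_prod _ _ fun i _ =>
    Finset.prod_ne_zero_iff.2 (h0 i), ← sum_card_Ioi]
  refine Finset.sum_congr rfl fun i _ => ?_
  rw [Polynomial.natDegree_prod _ _ (h0 i), Finset.sum_congr rfl (h1 i), Finset.card_eq_sum_ones]

theorem natDegree_restrictLine_lt {n N : ℕ} (x lam : Fin n → ℂ) {p : XLPoly n}
    (hp : ∀ e ∈ p.support, ∑ i, e (Sum.inl i) < N) (h0 : restrictLine x lam p ≠ 0) :
    (restrictLine x lam p).natDegree < N := by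
  have hN : 0 < N := by
    rcases Finset.eq_empty_or_nonempty p.support with h | ⟨e, he⟩
    · rw [MvPolynomial.support_eq_empty] at h
      simp [h] at h0
    · exact (Nat.zero_le _).trans_lt (hp e he)
  refine lt_of_le_of_lt ?_ (Nat.sub_lt hN one_pos)
  rw [restrictLine, MvPolynomial.aeval_def, MvPolynomial.eval₂_eq]
  refine Polynomial.natDegree_sum_le_of_forall_le _ _ fun e he => ?_
  refine (Polynomial.natDegree_C_mul_le _ _).trans (le_trans ?_ (Nat.le_sub_one_of_lt (hp e he)))
  classical
  rw [Finset.prod_subset (Finset.subset_univ _) fun s _ hs => by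
    rw [Finsupp.notMem_support_iff.1 hs, pow_zero]]
  rw [Fintype.prod_sum_type]
  simp only [Sum.elim_inl, Sum.elim_inr, ← map_pow, ← map_prod]
  refine (Polynomial.natDegree_mul_C_le _ _).trans ?_
  refine (Polynomial.natDegree_prod_le _ _).trans (Finset.sum_le_sum fun i _ => ?_)
  exact (Polynomial.natDegree_pow_le_of_le _ Polynomial.natDegree_linear_le).trans_eq (mul_one _)

/-- A polynomial with logarithmic derivative `m a' / a` has the degree of `a ^ m`. -/
theorem natDegree_eq_of_mul_derivative {a p : Polynomial ℂ} {m : ℕ} (ha : a ≠ 0) (hp : p ≠ 0)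
    (h : a * Polynomial.derivative p = (m : Polynomial ℂ) * p * Polynomial.derivative a) :
    p.natDegree = m * a.natDegree := by
  have hX : ∀ q : Polynomial ℂ, ∀ k, (Polynomial.X * Polynomial.derivative q).coeff k =
      k * q.coeff k := by
    intro q k
    rcases k with _ | k
    · simp
    · rw [Polynomial.coeff_X_mul, Polynomial.coeff_derivative]
      push_cast
      ring
  have hd : ∀ q : Polynomial ℂ, (Polynomial.X * Polynomial.derivative q).natDegree ≤
      q.natDegree := fun q => Polynomial.natDegree_le_iff_coeff_eq_zero.2 fun k hk => by
    rw [hX, Polynomial.coeff_eq_zero_of_natDegree_lt hk, mul_zero]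
  -- compare the leading coefficients; the factor `X` makes the degrees of the derivatives add up
  have h1 := congrArg (fun q => (Polynomial.X * q).coeff (a.natDegree + p.natDegree)) h
  have e1 : Polynomial.X * (a * Polynomial.derivative p) =
      a * (Polynomial.X * Polynomial.derivative p) := by ring
  have e2 : Polynomial.X * ((m : Polynomial ℂ) * p * Polynomial.derivative a) =
      Polynomial.C (m : ℂ) * (Polynomial.X * Polynomial.derivative a * p) := by
    rw [map_natCast]
    ring
  simp only [e1, e2, Polynomial.coeff_C_mul] at h1
  rw [Polynomial.coeff_mul_add_eq_of_natDegree_le le_rfl (hd p),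
    Polynomial.coeff_mul_add_eq_of_natDegree_le (hd a) le_rfl, hX, hX] at h1
  have ha' : a.coeff a.natDegree ≠ 0 := Polynomial.leadingCoeff_ne_zero.2 ha
  have hp' : p.coeff p.natDegree ≠ 0 := Polynomial.leadingCoeff_ne_zero.2 hp
  have h2 : (p.natDegree : ℂ) = m * a.natDegree := by
    refine mul_left_cancel₀ (mul_ne_zero ha' hp') ?_
    linear_combination h1
  exact_mod_cast h2

/-- The part of top degree in `λ` of a solution of the homogeneous Schrödinger equation is
divisible by `A(x)^m` along the lines of direction `λ`, so it vanishes if its degree in `x` is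
too small. -/
theorem eq_zero_of_transport {n m : ℕ} {p : XLPoly n}
    (hdeg : ∀ e ∈ p.support, ∑ i, e (Sum.inl i) < m * (n * (n - 1) / 2))
    (h : xDiff n * ∑ i, lamVar i * xDeriv i p =
      (m : XLPoly n) * p * ∑ i, lamVar i * xDeriv i (xDiff n)) : p = 0 := by
  refine eq_zero_of_eval_eq_zero fun x lam _ hlam => ?_
  rw [← eval_zero_restrictLine]
  by_contra h0
  have hp0 : restrictLine x lam p ≠ 0 := fun h1 => h0 (by rw [h1, Polynomial.eval_zero])
  have h1 := congrArg (restrictLine x lam) h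
  simp only [map_mul, ← derivative_restrictLine, map_natCast] at h1
  have h2 := natDegree_eq_of_mul_derivative (restrictLine_xDiff_ne_zero x hlam) hp0 h1
  rw [natDegree_restrictLine_xDiff x hlam] at h2
  exact (natDegree_restrictLine_lt x lam hdeg hp0).ne h2

theorem schrodingerPoly_sub {n : ℕ} (c : ℂ) (K : ℕ) (p q : XLPoly n) :
    schrodingerPoly c K (p - q) = schrodingerPoly c K p - schrodingerPoly c K q := by
  simp only [schrodingerPoly, map_sub, sub_mul, Finset.sum_sub_distrib]
  ring

/-- A nonzero polynomial numerator of a solution over `A(x)^m` has degree at least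
`m n (n - 1) / 2` in `x`. -/
theorem eq_zero_of_schrodingerPoly {n m : ℕ} {q : XLPoly n}
    (hq : schrodingerPoly (m * (m + 1)) m q = 0)
    (hdeg : ∀ e ∈ q.support, ∑ i, e (Sum.inl i) < m * (n * (n - 1) / 2)) : q = 0 := by
  classical
  by_contra hq0
  -- for `K = m` the most singular term vanishes, and a factor `A(x)` cancels
  have heq : xDiff n * ∑ i, xDeriv i (xDeriv i q) +
      2 * (∑ i, xDiff n * lamVar i * xDeriv i q - (m : XLPoly n) *
        ∑ i, xDeriv i (xDiff n) * xDeriv i q) -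
      2 * ((m : XLPoly n) * ∑ i, lamVar i * xDeriv i (xDiff n) * q) = 0 := by
    refine (mul_eq_zero.1 (?_ : xDiff n * _ = 0)).resolve_left (xDiff_ne_zero n)
    have h1 : ∑ i, xDeriv i q * (xDiff n ^ 2 * lamVar i -
        (m : XLPoly n) * xDiff n * xDeriv i (xDiff n)) =
        xDiff n * (∑ i, xDiff n * lamVar i * xDeriv i q - (m : XLPoly n) *
          ∑ i, xDeriv i (xDiff n) * xDeriv i q) := by
      rw [Finset.mul_sum (a := (m : XLPoly n)), ← Finset.sum_sub_distrib, Finset.mul_sum]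
      exact Finset.sum_congr rfl fun i _ => by ring
    rw [schrodingerPoly, h1, sub_self, map_zero, zero_mul, zero_sub] at hq
    rw [← Finset.sum_mul]
    linear_combination hq
  -- the part of `q` of top degree `N` in `λ`
  set w := xlWeight n 0 1 with hw
  obtain ⟨e, he, hmax⟩ := Finset.exists_max_image q.support (Finsupp.weight w)
    (Finset.nonempty_iff_ne_empty.2 fun h => hq0 (MvPolynomial.support_eq_empty.1 h))
  set N := Finsupp.weight w e with hN
  set comp := MvPolynomial.weightedHomogeneousComponent (R := ℂ) w with hcomp
  have htop : comp (N + 1) q = 0 :=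
    MvPolynomial.weightedHomogeneousComponent_eq_zero' _ _ fun d hd => by
      have := hmax d hd
      omega
  have hx : ∀ i : Fin n, w (Sum.inl i) = 0 := fun _ => rfl
  have hA : MvPolynomial.IsWeightedHomogeneous w (xDiff n) 0 :=
    isWeightedHomogeneous_prodDiff_X (c := 0) hx
  have hA' : ∀ i, MvPolynomial.IsWeightedHomogeneous w (xDeriv i (xDiff n)) 0 := fun i =>
    hA.pderiv (i := Sum.inl i) rfl
  have hl : ∀ i : Fin n, MvPolynomial.IsWeightedHomogeneous w (lamVar i) 1 := fun i =>
    MvPolynomial.isWeightedHomogeneous_X ℂ w (Sum.inr i)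
  have hm : MvPolynomial.IsWeightedHomogeneous w (m : XLPoly n) 0 := by
    rw [← map_natCast MvPolynomial.C]
    exact MvPolynomial.isWeightedHomogeneous_C w _
  have h2 : MvPolynomial.IsWeightedHomogeneous w (2 : XLPoly n) 0 := by
    rw [← map_ofNat MvPolynomial.C]
    exact MvPolynomial.isWeightedHomogeneous_C w _
  have mul0 : ∀ {a : XLPoly n}, MvPolynomial.IsWeightedHomogeneous w a 0 → ∀ r,
      comp (N + 1) (a * r) = a * comp (N + 1) r := fun ha r => by
    simpa using weightedHomogeneousComponent_mul_add ha r (N + 1)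
  have mul1 : ∀ {a : XLPoly n}, MvPolynomial.IsWeightedHomogeneous w a 1 → ∀ r,
      comp (N + 1) (a * r) = a * comp N r := fun ha r => by
    rw [add_comm N 1]
    exact weightedHomogeneousComponent_mul_add ha r N
  have hder : ∀ k i (r : XLPoly n), comp k (xDeriv i r) = xDeriv i (comp k r) := fun k i r =>
    weightedHomogeneousComponent_pderiv (hx i) k r
  have key := congrArg (comp (N + 1)) heq
  simp only [map_add, map_sub, map_sum, mul0 hA, mul0 hm, mul0 h2, mul0 (hA' _), hder, htop,
    map_zero, mul_zero, Finset.sum_const_zero, zero_add, sub_zero,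
    fun i => mul1 (a := xDiff n * lamVar i) (by simpa using hA.mul (hl i)),
    fun i => mul1 (a := lamVar i * xDeriv i (xDiff n)) (by simpa using (hl i).mul (hA' i))] at key
  have hzero : comp N q = 0 := by
    refine eq_zero_of_transport (m := m) (fun d hd => hdeg d ?_) ?_
    · rw [hcomp, MvPolynomial.support_weightedHomogeneousComponent] at hd
      exact (Finset.mem_filter.1 hd).1
    · rw [Finset.mul_sum]
      simp only [← mul_assoc]
      rw [← Finset.sum_mul] at key
      have h20 : (2 : XLPoly n) ≠ 0 := two_ne_zero
      refine mul_left_cancel₀ h20 ?_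
      linear_combination key
  have := MvPolynomial.coeff_weightedHomogeneousComponent (w := w) N q e
  rw [← hcomp, hzero, if_pos rfl, MvPolynomial.coeff_zero] at this
  exact MvPolynomial.mem_support_iff.1 he this.symm

/-! ### The Baker--Akhiezer function and its residue formula -/

theorem weight_xlWeight {n : ℕ} (α β : ℕ) (e : Fin n ⊕ Fin n →₀ ℕ) :
    Finsupp.weight (xlWeight n α β) e =
      (∑ i, e (Sum.inl i)) * α + (∑ i, e (Sum.inr i)) * β := by
  rw [Finsupp.weight_apply, Finsupp.sum_fintype _ (fun i c => c • xlWeight n α β i)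
    fun i => zero_smul _ _, Fintype.sum_sum_type, Finset.sum_mul, Finset.sum_mul]
  rfl

theorem baFunction_eq {n : ℕ} (m : ℕ) (P : XLPoly n) (x lam : Fin n → ℂ) :
    baFunction n m P x lam = (prodDiff lam ^ m)⁻¹ * polyExp m P lam x := by
  rw [baFunction, polyExp]
  simp only [div_eq_mul_inv, mul_inv]
  ring

theorem calogeroMoser_baFunction {n : ℕ} (m : ℕ) (P : XLPoly n) (x lam : Fin n → ℂ) :
    calogeroMoser n m (fun y => baFunction n m P y lam) x = (prodDiff lam ^ m)⁻¹ *
      (m * (m + 1) * sumInvSq x * polyExp m P lam x -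
        ∑ i, iteratedDeriv 2 (fun s => polyExp m P lam (Function.update x i s)) (x i)) := by
  have h1 : ∑ i, ∑ j ∈ Finset.Ioi i, 2 * (m : ℂ) * ((m : ℂ) + 1) / (x i - x j) ^ 2 *
      baFunction n m P x lam = m * (m + 1) * sumInvSq x * baFunction n m P x lam := by
    simp only [← sum_Ioi_inv_sq, Finset.mul_sum, Finset.sum_mul]
    refine Finset.sum_congr rfl fun i _ => Finset.sum_congr rfl fun j _ => ?_
    rw [div_eq_mul_inv, inv_pow]
    ring
  rw [calogeroMoser, h1]
  simp only [baFunction_eq, iteratedDeriv_const_mul_field, ← Finset.mul_sum]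
  ring

theorem IsBANumerator.schrodingerPoly_eq_zero {n m : ℕ} {P : XLPoly n}
    (h : IsBANumerator n m P) : schrodingerPoly (m * (m + 1)) m P = 0 := by
  refine _root_.schrodingerPoly_eq_zero fun x lam hx hlam => ?_
  have h1 := h.schrodinger x lam hx hlam
  rw [calogeroMoser_baFunction, baFunction_eq] at h1
  have h2 : (prodDiff lam ^ m)⁻¹ ≠ 0 := inv_ne_zero (pow_ne_zero m (prodDiff_ne_zero hlam))
  refine mul_left_cancel₀ h2 ?_
  linear_combination -h1

theorem IsBANumerator.eq {n m : ℕ} {P Q : XLPoly n} (hP : IsBANumerator n m P)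
    (hQ : IsBANumerator n m Q) : P = Q := by
  classical
  refine sub_eq_zero.1 (eq_zero_of_schrodingerPoly (m := m) ?_ fun e he => ?_)
  · rw [schrodingerPoly_sub, hP.schrodingerPoly_eq_zero, hQ.schrodingerPoly_eq_zero, sub_self]
  · rw [← sub_sub_sub_cancel_right P Q (leadingPoly n m)] at he
    rcases Finset.mem_union.1 (MvPolynomial.support_sub _ _ _ he) with h | h
    · exact hP.leading_x e h
    · exact hQ.leading_x e h

theorem exists_isBANumerator (m k : ℕ) : ∃ P : XLPoly (k + 1), IsBANumerator (k + 1) m P ∧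
    ∀ x lam : Fin (k + 1) → ℂ, Function.Injective x →
      polyExp m P lam x = psi m (k + 1) x lam := by
  obtain ⟨P, hP, hdeg⟩ := exists_numerator m k
  refine ⟨P, ⟨fun e he => ?_, fun e he => ?_, fun x lam hx hlam => ?_⟩, hP⟩
  · simpa [weight_xlWeight] using hdeg 1 0 one_pos e he
  · simpa [weight_xlWeight] using hdeg 0 1 one_pos e he
  · rw [calogeroMoser_baFunction, baFunction_eq, Finset.sum_congr rfl fun i _ =>
      iteratedDeriv_update_congr 2 (fun x hx => hP x lam hx) hx i,
      sum_iteratedDeriv_psi m (k + 1) x lam hx, hP x lam hx]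
    ring

theorem isNestedCycle_cycleRadius {n : ℕ} {x : Fin n → ℂ} {ε : ℝ} (hε : 0 < ε)
    (h : ∀ i j : Fin n, i ≠ j → 2 * (((n : ℝ) - 1) * ε) < ‖x i - x j‖) :
    IsNestedCycle x x fun j => ε * ((n : ℝ) - ((j : ℝ) + 1)) where
  strictAnti := fun i j hij => by
    have : (i : ℝ) < j := by exact_mod_cast hij
    exact mul_lt_mul_of_pos_left (by linarith) hε
  sep := fun i j hij => by
    refine lt_of_eq_of_lt ?_ (h i j hij)
    push_cast
    ring
  lt := fun j hj i => by
    have : ((j + 1 : ℕ) : ℝ) < n := by exact_mod_cast (by omega : j + 1 < n)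
    push_cast at this
    rw [sub_self, norm_zero]
    exact mul_pos hε (by linarith)

theorem mainTheorem2 (n m : ℕ) (hn : 1 ≤ n) (hm : 1 ≤ m) :
    (∃! P : XLPoly n, IsBANumerator n m P) ∧
    ∀ P : XLPoly n, IsBANumerator n m P →
      ∀ x lam : Fin n → ℂ, Function.Injective x → Function.Injective lam →
      ∀ ε : ℝ, 0 < ε →
        (∀ i j : Fin n, i ≠ j → 2 * (((n : ℝ) - 1) * ε) < ‖x i - x j‖) →
        IntegrableOn (torusPullback (omegaDensity m x lam) (cycleCenter x) (cycleRadius ε))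
          (Set.Icc (0 : TriIndex n → ℝ) (fun _ => 2 * Real.pi)) ∧
        baFunction n m P x lam =
          (-1) ^ ((m + 1) * n.choose 3) *
            ((m.factorial : ℂ) / (2 * Real.pi * Complex.I)) ^ (n * (n - 1) / 2) *
            Complex.exp (lam ⟨n - 1, by omega⟩ * ∑ i, x i) *
            prodDiff x ^ (1 + m) * (prodDiff lam ^ m)⁻¹ *
            circlesIntegral (omegaDensity m x lam) (cycleCenter x) (cycleRadius ε) := by
  obtain ⟨k, rfl⟩ := Nat.exists_eq_add_of_le' hn
  obtain ⟨P₀, hP₀, hpsi⟩ := exists_isBANumerator m k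
  refine ⟨⟨P₀, hP₀, fun Q hQ => hQ.eq hP₀⟩, fun P hP x lam hx hlam ε hε hsep => ?_⟩
  obtain rfl := hP.eq hP₀
  have hc := isNestedCycle_cycleRadius hε hsep
  refine ⟨hc.integrableOn m lam, ?_⟩
  have h1 := circlesIntegral_omegaDensity m k x x lam _ hc hx
  change _ * circlesIntegral (omegaDensity m x lam) (cycleCenter x) (cycleRadius ε) = _ at h1
  have h2 : ((m.factorial : ℂ) / (2 * Real.pi * Complex.I)) ^ (k + 1).choose 2 *
      (2 * Real.pi * Complex.I / m.factorial) ^ (k + 1).choose 2 = 1 := by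
    have e1 : (m.factorial : ℂ) ≠ 0 := by exact_mod_cast m.factorial_ne_zero
    have e2 := Complex.two_pi_I_ne_zero
    rw [← mul_pow, div_mul_div_cancel₀ e2, div_self e1, one_pow]
  have h3 : ((-1 : ℂ) ^ ((m + 1) * (k + 1).choose 3)) *
      (-1) ^ ((m + 1) * (k + 1).choose 3) = 1 := by
    rw [← mul_pow, neg_one_mul, neg_neg, one_pow]
  have h4 : lam ⟨k + 1 - 1, by omega⟩ = lam (Fin.last k) := rfl
  rw [baFunction_eq, hpsi x lam hx, h4, ← Nat.choose_two_right, add_comm 1 m]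
  set c := circlesIntegral (omegaDensity m x lam) (cycleCenter x) (cycleRadius ε)
  set s := (-1 : ℂ) ^ ((m + 1) * (k + 1).choose 3)
  set a := ((m.factorial : ℂ) / (2 * Real.pi * Complex.I)) ^ (k + 1).choose 2
  set b := (2 * Real.pi * Complex.I / m.factorial : ℂ) ^ (k + 1).choose 2
  linear_combination -(prodDiff lam ^ m)⁻¹ * (s * a * h1 +
    psi m (k + 1) x lam * (s * s * h2 + h3))
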